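/- **Setting.** A PROP is a symmetric strict monoidal category whose objects are the natural numbers, with $\oplus$ on objects given by addition; $f\,;g$ denotes composition in diagrammatic order. Let $\Sigma$ be a monoidal signature, i.e. a set of generators $o\colon n\to m$ with $n,m\in\mathbb N$. Let $\mathbf S_\Sigma$ be the PROP freely generated by $\Sigma$, let $\mathbf{Frob}$ be the PROP presented by a special Frobenius monoid (generators $\mu\colon 2\to1$, $\eta\colon 0\to1$, $\delta\colon 1\to2$, $\epsilon\colon 1\to0$; the laws of a commutative monoid, of a cocommutative comonoid, the Frobenius law and $\delta\,;\mu=\mathrm{id}_1$), and let $\mathbf S_\Sigma+\mathbf{Frob}$ be their coproduct as PROPs, i.e. the PROP presented by all these generators and equations. A $\Sigma$-hypergraph is a finite directed hypergraph each of whose hyperedges is labelled by a generator $o\colon k\to l$ of $\Sigma$ and has $k$ ordered source nodes and $l$ ordered target nodes; homomorphisms preserve labels, sources and targets. The PROP $\mathrm{FTerm}_\Sigma$ has as arrows $n\to m$ the isomorphism classes of cospans $n\to G\leftarrow m$ of $\Sigma$-hypergraphs, where $n$ and $m$ are discrete (edgeless); composition is by pushout, $\oplus$ by coproduct. Let $\Phi\colon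 \mathbf S_\Sigma+\mathbf{Frob}\to\mathrm{FTerm}_\Sigma$ be the PROP morphism that sends $o\colon n\to m$ in $\Sigma$ to the cospan $n\to G\leftarrow m$ where $G$ has $n+m$ distinct nodes and one hyperedge labelled $o$, with the nodes of $n$ as sources and those of $m$ as targets, and that sends each Frobenius generator $n\to m$ to the unique discrete cospan $n\to 1\leftarrow m$. A rewriting system $\mathcal R$ on a PROP is a set of pairs $\langle l,r\rangle$ of arrows $l,r\colon i\to j$ of the same type. For $d,e\colon n\to m$, write $d\Rightarrow_{\mathcal R}e$ if there are $\langle l,r\rangle\colon (i,j)$ in $\mathcal R$, $k\in\mathbb N$, $c_1\colon n\to k+i$ and $c_2\colon k+j\to m$ with $d=c_1\,;(\mathrm{id}_k\oplus l)\,;c_2$ and $e=c_1\,;(\mathrm{id}_k\oplus r)\,;c_2$. For $d\colon n\to m$ in $\mathbf S_\Sigma+\mathbf{Frob}$ let $\ulcorner d\urcorner=\mathrm{cap}_n\,;(\mathrm{id}_n\oplus d)\colon 0\to n+m$, where $\mathrm{cap}_0=\mathrm{id}_0$, $\mathrm{cap}_1=\eta\,;\delta$ and $\mathrm{cap}_{n+1}=(\mathrm{cap}_n\oplus\mathrm{cap}_1)\,;(\mathrm{id}_n\oplus\sigma_{n,1}\oplus\mathrm{id}_1)$,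 and let $\ulcorner\mathcal R\urcorner=\{\langle\ulcorner l\urcorner,\ulcorner r\urcorner\rangle \mid \langle l,r\rangle\in\mathcal R\}$. A rule $\langle 0\to L\leftarrow j,\;0\to R\leftarrow j\rangle$ in $\mathrm{FTerm}_\Sigma$ is identified with the DPO rule $L\leftarrow j\to R$; thus $\Phi(\ulcorner\mathcal R\urcorner)=\{\langle\Phi(\ulcorner l\urcorner),\Phi(\ulcorner r\urcorner)\rangle\mid\langle l,r\rangle\in\mathcal R\}$ is a DPO system. For a DPO system $\mathcal D$ and arrows $(0\to G\leftarrow m)$ and $(0\to H\leftarrow m)$ of $\mathrm{FTerm}_\Sigma$, there is a DPO step from the first to the second by $\mathcal D$ if there are a rule $L\leftarrow j\to R$ in $\mathcal D$, a cospan $j\to C\leftarrow m$, and homomorphisms $L\to G\leftarrow C\to H\leftarrow R$ such that the squares $(j,L,C,G)$ and $(j,R,C,H)$ are pushouts of $\Sigma$-hypergraphs and the composites $m\to C\to G$ and $m\to C\to H$ are the given maps $m\to G$ and $m\to H$. **Theorem.** For every signature $\Sigma$, $\Phi\colon \mathbf S_\Sigma+\mathbf{Frob}\to\mathrm{FTerm}_\Sigma$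 is an isomorphism of PROPs, and for every rewriting system $\mathcal R$ on $\mathbf S_\Sigma+\mathbf{Frob}$ and all arrows $d,e\colon n\to m$ of $\mathbf S_\Sigma+\mathbf{Frob}$, $$d\Rightarrow_{\mathcal R}e\quad\Longleftrightarrow\quad \Phi(\ulcorner d\urcorner)\ \text{rewrites to}\ \Phi(\ulcorner e\urcorner)\ \text{by one DPO step of the system}\ \Phi(\ulcorner\mathcal R\urcorner).$$ -/

import Mathlib

open CategoryTheory CategoryTheory.Limits

universe u v w

namespace StringRewriting

/-! ## Props -/

/-- Transport of an arrow `a ⟶ b` along equalities of its source and target. -/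
def castHom (H : ℕ → ℕ → Type v) {a a' b b' : ℕ} (ha : a = a') (hb : b = b') (f : H a b) :
    H a' b' :=
  hb ▸ ha ▸ f

theorem castHom_rfl (H : ℕ → ℕ → Type v) {a b : ℕ} (ha : a = a) (hb : b = b) (f : H a b) :
    castHom H ha hb f = f := rfl

/-- A PROP: a symmetric strict monoidal category whose objects are the natural numbers and whose
monoidal product is addition on objects. `comp f g` is `f ; g`, in diagrammatic order. The casts
account for the strict equalities `(a + b) + c = a + (b + c)` and `0 + a = a` on objects. -/
structure PROP where
  Hom : ℕ → ℕ → Type v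
  id : ∀ n : ℕ, Hom n n
  comp : ∀ {a b c : ℕ}, Hom a b → Hom b c → Hom a c
  tensor : ∀ {a b c d : ℕ}, Hom a b → Hom c d → Hom (a + c) (b + d)
  symm : ∀ n m : ℕ, Hom (n + m) (m + n)
  id_comp : ∀ {a b : ℕ} (f : Hom a b), comp (id a) f = f
  comp_id : ∀ {a b : ℕ} (f : Hom a b), comp f (id b) = f
  assoc : ∀ {a b c d : ℕ} (f : Hom a b) (g : Hom b c) (h : Hom c d),
    comp (comp f g) h = comp f (comp g h)
  tensor_id : ∀ n m : ℕ, tensor (id n) (id m) = id (n + m)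
  tensor_comp : ∀ {a b c a' b' c' : ℕ} (f : Hom a b) (g : Hom b c) (f' : Hom a' b')
    (g' : Hom b' c'), tensor (comp f g) (comp f' g') = comp (tensor f f') (tensor g g')
  tensor_assoc : ∀ {a b c a' b' c' : ℕ} (f : Hom a a') (g : Hom b b') (h : Hom c c'),
    castHom Hom (Nat.add_assoc a b c) (Nat.add_assoc a' b' c') (tensor (tensor f g) h) =
      tensor f (tensor g h)
  id_zero_tensor : ∀ {a b : ℕ} (f : Hom a b),
    castHom Hom (Nat.zero_add a) (Nat.zero_add b) (tensor (id 0) f) = f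
  tensor_id_zero : ∀ {a b : ℕ} (f : Hom a b),
    castHom Hom (Nat.add_zero a) (Nat.add_zero b) (tensor f (id 0)) = f
  symm_natural : ∀ {a b c d : ℕ} (f : Hom a b) (g : Hom c d),
    comp (tensor f g) (symm b d) = comp (symm a c) (tensor g f)
  symm_symm : ∀ n m : ℕ, comp (symm n m) (symm m n) = id (n + m)
  symm_add : ∀ a b c : ℕ,
    symm a (b + c) =
      comp
        (castHom Hom (Nat.add_assoc a b c) (Nat.add_assoc b a c) (tensor (symm a b) (id c)))
        (castHom Hom rfl (Nat.add_assoc b c a).symm (tensor (id b) (symm a c)))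

/-- Morphisms of PROPs: identity-on-objects strict symmetric monoidal functors. -/
@[ext]
structure PROPHom (X : PROP.{v}) (Y : PROP.{w}) where
  map : ∀ {n m : ℕ}, X.Hom n m → Y.Hom n m
  map_id : ∀ n : ℕ, map (X.id n) = Y.id n
  map_comp : ∀ {a b c : ℕ} (f : X.Hom a b) (g : X.Hom b c),
    map (X.comp f g) = Y.comp (map f) (map g)
  map_tensor : ∀ {a b c d : ℕ} (f : X.Hom a b) (g : X.Hom c d),
    map (X.tensor f g) = Y.tensor (map f) (map g)
  map_symm : ∀ n m : ℕ, map (X.symm n m) = Y.symm n m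

/-- A morphism of PROPs is an isomorphism iff it is bijective on every hom-set. -/
def PROPHom.IsIso {X : PROP.{v}} {Y : PROP.{w}} (F : PROPHom X Y) : Prop :=
  ∀ n m : ℕ, Function.Bijective (fun f : X.Hom n m => F.map f)

/-! ## Symmetric monoidal theories and the PROPs they present -/

/-- A (one-sorted) monoidal signature: `S n m` is the set of generators of arity `n` and
coarity `m`. -/
abbrev Signature := ℕ → ℕ → Type u

/-- Formal terms over a signature, built from generators, identities and symmetries by `;` and
`⊕`. -/
inductive Term (S : Signature.{u}) : ℕ → ℕ → Type u
  | gen {n m : ℕ} (o : S n m) : Term S n m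
  | id (n : ℕ) : Term S n n
  | symm (n m : ℕ) : Term S (n + m) (m + n)
  | comp {a b c : ℕ} (f : Term S a b) (g : Term S b c) : Term S a c
  | tensor {a b c d : ℕ} (f : Term S a b) (g : Term S c d) : Term S (a + c) (b + d)

/-- Renaming of generators in a term. -/
def Term.map {S : Signature.{u}} {T : Signature.{v}} (φ : ∀ {n m : ℕ}, S n m → T n m) :
    ∀ {n m : ℕ}, Term S n m → Term T n m
  | _, _, .gen o => .gen (φ o)
  | _, _, .id n => .id n
  | _, _, .symm n m => .symm n m
  | _, _, .comp f g => .comp (f.map φ) (g.map φ)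
  | _, _, .tensor f g => .tensor (f.map φ) (g.map φ)

/-- A symmetric monoidal theory: a signature and a set of equations between parallel terms. -/
structure SMT where
  sig : Signature.{u}
  eqs : ∀ {n m : ℕ}, Term sig n m → Term sig n m → Prop

/-- Provable equality: the smallest congruence on terms that contains the laws of symmetric
strict monoidal categories and the equations of the theory. -/
inductive SMT.Rel (T : SMT.{u}) : ∀ {n m : ℕ}, Term T.sig n m → Term T.sig n m → Prop
  | refl {n m : ℕ} (f : Term T.sig n m) : Rel T f f
  | symm {n m : ℕ} {f g : Term T.sig n m} : Rel T f g → Rel T g f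
  | trans {n m : ℕ} {f g h : Term T.sig n m} : Rel T f g → Rel T g h → Rel T f h
  | comp {a b c : ℕ} {f f' : Term T.sig a b} {g g' : Term T.sig b c} :
      Rel T f f' → Rel T g g' → Rel T (.comp f g) (.comp f' g')
  | tensor {a b c d : ℕ} {f f' : Term T.sig a b} {g g' : Term T.sig c d} :
      Rel T f f' → Rel T g g' → Rel T (.tensor f g) (.tensor f' g')
  | ax {n m : ℕ} {f g : Term T.sig n m} : T.eqs f g → Rel T f g
  | id_comp {a b : ℕ} (f : Term T.sig a b) : Rel T (.comp (.id a) f) f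
  | comp_id {a b : ℕ} (f : Term T.sig a b) : Rel T (.comp f (.id b)) f
  | assoc {a b c d : ℕ} (f : Term T.sig a b) (g : Term T.sig b c) (h : Term T.sig c d) :
      Rel T (.comp (.comp f g) h) (.comp f (.comp g h))
  | tensor_id (n m : ℕ) : Rel T (.tensor (.id n) (.id m)) (.id (n + m))
  | tensor_comp {a b c a' b' c' : ℕ} (f : Term T.sig a b) (g : Term T.sig b c)
      (f' : Term T.sig a' b') (g' : Term T.sig b' c') :
      Rel T (.tensor (.comp f g) (.comp f' g')) (.comp (.tensor f f') (.tensor g g'))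
  | tensor_assoc {a b c a' b' c' : ℕ} (f : Term T.sig a a') (g : Term T.sig b b')
      (h : Term T.sig c c') :
      Rel T
        (castHom (Term T.sig) (Nat.add_assoc a b c) (Nat.add_assoc a' b' c')
          (.tensor (.tensor f g) h))
        (.tensor f (.tensor g h))
  | id_zero_tensor {a b : ℕ} (f : Term T.sig a b) :
      Rel T (castHom (Term T.sig) (Nat.zero_add a) (Nat.zero_add b) (.tensor (.id 0) f)) f
  | tensor_id_zero {a b : ℕ} (f : Term T.sig a b) :
      Rel T (castHom (Term T.sig) (Nat.add_zero a) (Nat.add_zero b) (.tensor f (.id 0))) f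
  | symm_natural {a b c d : ℕ} (f : Term T.sig a b) (g : Term T.sig c d) :
      Rel T (.comp (.tensor f g) (.symm b d)) (.comp (.symm a c) (.tensor g f))
  | symm_symm (n m : ℕ) : Rel T (.comp (.symm n m) (.symm m n)) (.id (n + m))
  | symm_add (a b c : ℕ) :
      Rel T (.symm a (b + c))
        (.comp
          (castHom (Term T.sig) (Nat.add_assoc a b c) (Nat.add_assoc b a c)
            (.tensor (.symm a b) (.id c)))
          (castHom (Term T.sig) rfl (Nat.add_assoc b c a).symm (.tensor (.id b) (.symm a c))))

/-- Provable equality as a setoid. -/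
def SMT.setoid (T : SMT.{u}) (n m : ℕ) : Setoid (Term T.sig n m) where
  r := T.Rel
  iseqv := ⟨.refl, .symm, .trans⟩

/-- Arrows `n ⟶ m` of the PROP presented by a theory: terms modulo provable equality. -/
abbrev SMT.Arrow (T : SMT.{u}) (n m : ℕ) : Type u := Quotient (T.setoid n m)

/-- The arrow represented by a term. -/
def SMT.cls (T : SMT.{u}) {n m : ℕ} (t : Term T.sig n m) : T.Arrow n m :=
  Quotient.mk (T.setoid n m) t

theorem SMT.cls_eq {T : SMT.{u}} {n m : ℕ} {f g : Term T.sig n m} (h : T.Rel f g) :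
    T.cls f = T.cls g :=
  Quotient.sound (s := T.setoid n m) h

theorem SMT.castHom_cls {T : SMT.{u}} {a a' b b' : ℕ} (ha : a = a') (hb : b = b')
    (f : Term T.sig a b) :
    castHom T.Arrow ha hb (T.cls f) = T.cls (castHom (Term T.sig) ha hb f) := by
  subst ha hb; rfl

/-- Composition of arrows of the presented PROP. -/
def SMT.arrowComp (T : SMT.{u}) {a b c : ℕ} (f : T.Arrow a b) (g : T.Arrow b c) : T.Arrow a c :=
  Quotient.liftOn₂ f g (fun s t => T.cls (.comp s t)) fun _ _ _ _ h h' => cls_eq (.comp h h')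

/-- Monoidal product of arrows of the presented PROP. -/
def SMT.arrowTensor (T : SMT.{u}) {a b c d : ℕ} (f : T.Arrow a b) (g : T.Arrow c d) :
    T.Arrow (a + c) (b + d) :=
  Quotient.liftOn₂ f g (fun s t => T.cls (.tensor s t)) fun _ _ _ _ h h' => cls_eq (.tensor h h')

/-- The PROP freely generated (presented) by a symmetric monoidal theory. -/
def SMT.free (T : SMT.{u}) : PROP.{u} where
  Hom := T.Arrow
  id n := T.cls (.id n)
  comp := T.arrowComp
  tensor := T.arrowTensor
  symm n m := T.cls (.symm n m)
  id_comp := by rintro a b ⟨f⟩; exact cls_eq (.id_comp f)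
  comp_id := by rintro a b ⟨f⟩; exact cls_eq (.comp_id f)
  assoc := by rintro a b c d ⟨f⟩ ⟨g⟩ ⟨h⟩; exact cls_eq (.assoc f g h)
  tensor_id n m := cls_eq (.tensor_id n m)
  tensor_comp := by rintro a b c a' b' c' ⟨f⟩ ⟨g⟩ ⟨f'⟩ ⟨g'⟩; exact cls_eq (.tensor_comp f g f' g')
  tensor_assoc := by
    rintro a b c a' b' c' ⟨f⟩ ⟨g⟩ ⟨h⟩
    exact (castHom_cls _ _ _).trans (cls_eq (.tensor_assoc f g h))
  id_zero_tensor := by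
    rintro a b ⟨f⟩
    exact (castHom_cls _ _ _).trans (cls_eq (.id_zero_tensor f))
  tensor_id_zero := by
    rintro a b ⟨f⟩
    exact (castHom_cls _ _ _).trans (cls_eq (.tensor_id_zero f))
  symm_natural := by rintro a b c d ⟨f⟩ ⟨g⟩; exact cls_eq (.symm_natural f g)
  symm_symm n m := cls_eq (.symm_symm n m)
  symm_add a b c := by
    refine (cls_eq (.symm_add a b c)).trans ?_
    have h₁ := castHom_cls (T := T) (Nat.add_assoc a b c) (Nat.add_assoc b a c)
      (.tensor (.symm a b) (.id c))
    have h₂ := castHom_cls (T := T) rfl (Nat.add_assoc b c a).symm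
      (.tensor (.id b) (.symm a c))
    exact (congrArg₂ T.arrowComp h₁ h₂).symm

/-- The arrow of the presented PROP represented by a term. -/
def SMT.arr (T : SMT.{u}) {n m : ℕ} (t : Term T.sig n m) : T.free.Hom n m := T.cls t

theorem SMT.arr_eq {T : SMT.{u}} {n m : ℕ} {f g : Term T.sig n m} (h : T.Rel f g) :
    T.arr f = T.arr g :=
  cls_eq h

/-- Interpretation of terms in a PROP, given an interpretation of the generators. -/
def Term.eval {S : Signature.{u}} (X : PROP.{v}) (φ : ∀ {n m : ℕ}, S n m → X.Hom n m) :
    ∀ {n m : ℕ}, Term S n m → X.Hom n m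
  | _, _, .gen o => φ o
  | _, _, .id n => X.id n
  | _, _, .symm n m => X.symm n m
  | _, _, .comp f g => X.comp (f.eval X φ) (g.eval X φ)
  | _, _, .tensor f g => X.tensor (f.eval X φ) (g.eval X φ)

theorem Term.eval_castHom {S : Signature.{u}} (X : PROP.{v})
    (φ : ∀ {n m : ℕ}, S n m → X.Hom n m) {a a' b b' : ℕ} (ha : a = a') (hb : b = b')
    (f : Term S a b) :
    (castHom (Term S) ha hb f).eval X φ = castHom X.Hom ha hb (f.eval X φ) := by
  subst ha hb; rfl

theorem SMT.eval_eq (T : SMT.{u}) (X : PROP.{v}) (φ : ∀ {n m : ℕ}, T.sig n m → X.Hom n m)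
    (h : ∀ {n m : ℕ} {f g : Term T.sig n m}, T.eqs f g → f.eval X φ = g.eval X φ)
    {n m : ℕ} {f g : Term T.sig n m} (hr : T.Rel f g) : f.eval X φ = g.eval X φ := by
  induction hr with
  | refl f => rfl
  | symm _ ih => exact ih.symm
  | trans _ _ ih₁ ih₂ => exact ih₁.trans ih₂
  | comp _ _ ih₁ ih₂ => simp only [Term.eval, ih₁, ih₂]
  | tensor _ _ ih₁ ih₂ => simp only [Term.eval, ih₁, ih₂]
  | ax h' => exact h h'
  | id_comp f => exact X.id_comp _
  | comp_id f => exact X.comp_id _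
  | assoc f g h => exact X.assoc _ _ _
  | tensor_id n m => exact X.tensor_id n m
  | tensor_comp f g f' g' => exact X.tensor_comp _ _ _ _
  | tensor_assoc f g h => rw [Term.eval_castHom]; exact X.tensor_assoc _ _ _
  | id_zero_tensor f => rw [Term.eval_castHom]; exact X.id_zero_tensor _
  | tensor_id_zero f => rw [Term.eval_castHom]; exact X.tensor_id_zero _
  | symm_natural f g => exact X.symm_natural _ _
  | symm_symm n m => exact X.symm_symm n m
  | symm_add a b c =>
    refine (X.symm_add a b c).trans ?_
    rw [Term.eval, Term.eval_castHom, Term.eval_castHom]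
    rfl

/-- The morphism out of a presented PROP that is determined by an interpretation of the generators
which satisfies the equations. -/
def SMT.lift (T : SMT.{u}) (X : PROP.{v}) (φ : ∀ {n m : ℕ}, T.sig n m → X.Hom n m)
    (h : ∀ {n m : ℕ} {f g : Term T.sig n m}, T.eqs f g → f.eval X φ = g.eval X φ) :
    PROPHom T.free X where
  map := fun f => Quotient.lift (s := T.setoid _ _) (fun t => t.eval X φ)
    (fun _ _ hr => T.eval_eq X φ h hr) f
  map_id _ := rfl
  map_comp := by rintro a b c ⟨f⟩ ⟨g⟩; rfl
  map_tensor := by rintro a b c d ⟨f⟩ ⟨g⟩; rfl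
  map_symm _ _ := rfl

/-- The sum of two theories: disjoint union of the signatures and union of the equations. It
presents the coproduct of the two presented PROPs. -/
def SMT.sum (T T' : SMT.{u}) : SMT.{u} where
  sig n m := T.sig n m ⊕ T'.sig n m
  eqs f g :=
    (∃ s t, T.eqs s t ∧ f = s.map (fun o => .inl o) ∧ g = t.map (fun o => .inl o)) ∨
    (∃ s t, T'.eqs s t ∧ f = s.map (fun o => .inr o) ∧ g = t.map (fun o => .inr o))

/-- The first coproduct injection. -/
def SMT.inl (T T' : SMT.{u}) : PROPHom T.free (T.sum T').free :=
  T.lift _ (fun o => (T.sum T').arr (.gen (.inl o))) fun {n m f g} h => by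
    have key : ∀ {n m : ℕ} (t : Term T.sig n m),
        t.eval (T.sum T').free (fun o => (T.sum T').arr (.gen (.inl o))) =
          (T.sum T').arr (t.map (fun o => .inl o)) := by
      intro n m t
      induction t with
      | gen o => rfl
      | id n => rfl
      | symm n m => rfl
      | comp f g ih₁ ih₂ => simp only [Term.eval, ih₁, ih₂]; rfl
      | tensor f g ih₁ ih₂ => simp only [Term.eval, ih₁, ih₂]; rfl
    rw [key, key]
    exact arr_eq (.ax (Or.inl ⟨f, g, h, rfl, rfl⟩))

/-- The second coproduct injection. -/
def SMT.inr (T T' : SMT.{u}) : PROPHom T'.free (T.sum T').free :=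
  T'.lift _ (fun o => (T.sum T').arr (.gen (.inr o))) fun {n m f g} h => by
    have key : ∀ {n m : ℕ} (t : Term T'.sig n m),
        t.eval (T.sum T').free (fun o => (T.sum T').arr (.gen (.inr o))) =
          (T.sum T').arr (t.map (fun o => .inr o)) := by
      intro n m t
      induction t with
      | gen o => rfl
      | id n => rfl
      | symm n m => rfl
      | comp f g ih₁ ih₂ => simp only [Term.eval, ih₁, ih₂]; rfl
      | tensor f g ih₁ ih₂ => simp only [Term.eval, ih₁, ih₂]; rfl
    rw [key, key]
    exact arr_eq (.ax (Or.inr ⟨f, g, h, rfl, rfl⟩))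

/-- Composition of morphisms of PROPs. -/
def PROPHom.comp {X : PROP.{u}} {Y : PROP.{v}} {Z : PROP.{w}} (F : PROPHom X Y)
    (G : PROPHom Y Z) : PROPHom X Z where
  map f := G.map (F.map f)
  map_id n := by rw [F.map_id, G.map_id]
  map_comp f g := by rw [F.map_comp, G.map_comp]
  map_tensor f g := by rw [F.map_tensor, G.map_tensor]
  map_symm n m := by rw [F.map_symm, G.map_symm]

theorem PROPHom.map_cls {T : SMT.{u}} {X : PROP.{v}} (F : PROPHom T.free X) {n m : ℕ}
    (t : Term T.sig n m) :
    F.map (T.arr t) = t.eval X (fun o => F.map (T.arr (.gen o))) := by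
  induction t with
  | gen o => rfl
  | id n => exact F.map_id n
  | symm n m => exact F.map_symm n m
  | comp f g ih₁ ih₂ => rw [Term.eval, ← ih₁, ← ih₂]; exact F.map_comp (T.arr f) (T.arr g)
  | tensor f g ih₁ ih₂ => rw [Term.eval, ← ih₁, ← ih₂]; exact F.map_tensor (T.arr f) (T.arr g)

theorem PROPHom.ext_gen {T : SMT.{u}} {X : PROP.{v}} {F G : PROPHom T.free X}
    (h : ∀ {n m : ℕ} (o : T.sig n m), F.map (T.arr (.gen o)) = G.map (T.arr (.gen o))) :
    F = G := by
  apply PROPHom.ext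
  funext n m f
  obtain ⟨t, rfl⟩ : ∃ t, T.arr t = f := Quotient.exists_rep f
  rw [F.map_cls, G.map_cls]
  congr 1
  funext n m o
  exact h o

theorem Term.eval_map {S : Signature.{u}} {S' : Signature.{v}} (X : PROP.{w})
    (φ : ∀ {n m : ℕ}, S n m → S' n m) (ψ : ∀ {n m : ℕ}, S' n m → X.Hom n m) {n m : ℕ}
    (t : Term S n m) : (t.map φ).eval X ψ = t.eval X (fun o => ψ (φ o)) := by
  induction t with
  | gen o => rfl
  | id n => rfl
  | symm n m => rfl
  | comp f g ih₁ ih₂ => simp only [Term.map, Term.eval, ih₁, ih₂]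
  | tensor f g ih₁ ih₂ => simp only [Term.map, Term.eval, ih₁, ih₂]

/-- The PROP presented by the sum of two theories is the coproduct, in the category of PROPs, of
the two PROPs that they present. -/
theorem SMT.sum_universal (T T' : SMT.{u}) (X : PROP.{v}) (α : PROPHom T.free X)
    (β : PROPHom T'.free X) :
    ∃! υ : PROPHom (T.sum T').free X, (T.inl T').comp υ = α ∧ (T.inr T').comp υ = β := by
  refine ⟨(T.sum T').lift X
      (fun o => o.elim (fun o => α.map (T.arr (.gen o))) (fun o => β.map (T'.arr (.gen o)))) ?_,
    ⟨?_, ?_⟩, ?_⟩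
  · rintro n m f g (⟨s, t, h, rfl, rfl⟩ | ⟨s, t, h, rfl, rfl⟩)
    · refine (Term.eval_map X _ _ s).trans (Eq.trans ?_ (Term.eval_map X _ _ t).symm)
      exact (α.map_cls s).symm.trans ((congrArg _ (arr_eq (.ax h))).trans (α.map_cls t))
    · refine (Term.eval_map X _ _ s).trans (Eq.trans ?_ (Term.eval_map X _ _ t).symm)
      exact (β.map_cls s).symm.trans ((congrArg _ (arr_eq (.ax h))).trans (β.map_cls t))
  · exact PROPHom.ext_gen fun o => rfl
  · exact PROPHom.ext_gen fun o => rfl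
  · rintro υ ⟨rfl, rfl⟩
    exact PROPHom.ext_gen fun o => by cases o <;> rfl

/-- The theory with signature `S` and no equations; it presents the PROP `𝐒_S`. -/
def SMT.ofSignature (S : Signature.{u}) : SMT.{u} where
  sig := S
  eqs _ _ := False

/-- The generators of special Frobenius monoids: multiplication, unit, comultiplication,
counit. -/
inductive FrobGen : ℕ → ℕ → Type u
  | mul : FrobGen 2 1
  | unit : FrobGen 0 1
  | comul : FrobGen 1 2
  | counit : FrobGen 1 0

namespace FrobGen

/-- The multiplication `2 ⟶ 1` as a term. -/
abbrev mulT : Term FrobGen.{u} 2 1 := .gen .mul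

/-- The unit `0 ⟶ 1` as a term. -/
abbrev unitT : Term FrobGen.{u} 0 1 := .gen .unit

/-- The comultiplication `1 ⟶ 2` as a term. -/
abbrev comulT : Term FrobGen.{u} 1 2 := .gen .comul

/-- The counit `1 ⟶ 0` as a term. -/
abbrev counitT : Term FrobGen.{u} 1 0 := .gen .counit

/-- The identity `1 ⟶ 1` as a term. -/
abbrev oneT : Term FrobGen.{u} 1 1 := .id 1

/-- The symmetry `2 ⟶ 2` as a term. -/
abbrev swapT : Term FrobGen.{u} 2 2 := .symm 1 1

/-- `f ⊕ id₁` as a term. -/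
abbrev padRight {a b : ℕ} (f : Term FrobGen.{u} a b) : Term FrobGen.{u} (a + 1) (b + 1) :=
  .tensor f oneT

/-- `id₁ ⊕ f` as a term. -/
abbrev padLeft {a b : ℕ} (f : Term FrobGen.{u} a b) : Term FrobGen.{u} (1 + a) (1 + b) :=
  .tensor oneT f

end FrobGen

open FrobGen in
/-- The equations of special Frobenius monoids: commutative monoid, cocommutative comonoid, the
special law and the Frobenius law. -/
inductive FrobEq : ∀ {n m : ℕ}, Term FrobGen.{u} n m → Term FrobGen.{u} n m → Prop
  | mul_comm : FrobEq (.comp swapT mulT) mulT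
  | mul_assoc : FrobEq (.comp (padRight mulT) mulT) (.comp (padLeft mulT) mulT)
  | unit_mul : FrobEq (.comp (padRight unitT) mulT) oneT
  | comul_comm : FrobEq (.comp comulT swapT) comulT
  | comul_assoc : FrobEq (.comp comulT (padRight comulT)) (.comp comulT (padLeft comulT))
  | counit_comul : FrobEq (.comp comulT (padRight counitT)) oneT
  | special : FrobEq (.comp comulT mulT) oneT
  | frobenius_left :
      FrobEq (.comp (padRight comulT) (padLeft mulT)) (.comp mulT comulT)
  | frobenius_right :
      FrobEq (.comp (padLeft comulT) (padRight mulT)) (.comp mulT comulT)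

/-- The theory of special Frobenius monoids; it presents the PROP `Frob`. -/
def frobSMT : SMT.{u} where
  sig := FrobGen
  eqs := FrobEq

/-- The theory presenting `𝐒_S + Frob`: the generators of `S` together with a chosen special
Frobenius structure. -/
abbrev synFrobSMT (S : Signature.{u}) : SMT.{u} := (SMT.ofSignature S).sum frobSMT

/-- The PROP `𝐒_S + Frob`. -/
abbrev synFrob (S : Signature.{u}) : PROP.{u} := (synFrobSMT S).free

/-! ## Hypergraphs -/

/-- A finite directed hypergraph typed over the signature `S`: a finite set of nodes and, for each
generator `o : k ⟶ l`, a set of hyperedges of type `o`, each with `k` ordered sources and `l`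
ordered targets; the total number of hyperedges is finite. This is an object of the slice over `S`
of the category of hypergraphs, with its type morphism given by its fibres. -/
structure Hyp (S : Signature.{u}) where
  V : Type
  E : ∀ {k l : ℕ}, S k l → Type
  src : ∀ {k l : ℕ} {o : S k l}, E o → Fin k → V
  tgt : ∀ {k l : ℕ} {o : S k l}, E o → Fin l → V
  finite_V : Finite V
  finite_E : Finite ((k : ℕ) × (l : ℕ) × (o : S k l) × E o)

namespace Hyp

variable {S : Signature.{u}}

/-- Homomorphisms of typed hypergraphs. -/
@[ext]
structure Hom (G H : Hyp S) where
  onV : G.V → H.V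
  onE : ∀ {k l : ℕ} {o : S k l}, G.E o → H.E o
  src_onE : ∀ {k l : ℕ} {o : S k l} (e : G.E o) (i : Fin k), H.src (onE e) i = onV (G.src e i)
  tgt_onE : ∀ {k l : ℕ} {o : S k l} (e : G.E o) (i : Fin l), H.tgt (onE e) i = onV (G.tgt e i)

instance : Category (Hyp S) where
  Hom := Hom
  id G := ⟨fun v => v, fun e => e, fun _ _ => rfl, fun _ _ => rfl⟩
  comp f g := ⟨fun v => g.onV (f.onV v), fun e => g.onE (f.onE e),
    fun e i => by rw [g.src_onE, f.src_onE], fun e i => by rw [g.tgt_onE, f.tgt_onE]⟩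

theorem hom_ext {G H : Hyp S} {f g : G ⟶ H} (hV : ∀ v, f.onV v = g.onV v)
    (hE : ∀ {k l : ℕ} {o : S k l} (e : G.E o), f.onE e = g.onE e) : f = g :=
  Hom.ext (funext hV) (by funext k l o e; exact hE e)

@[simp] theorem id_onV (G : Hyp S) (v : G.V) : Hom.onV (𝟙 G) v = v := rfl

@[simp] theorem id_onE (G : Hyp S) {k l : ℕ} {o : S k l} (e : G.E o) :
    Hom.onE (𝟙 G) e = e := rfl

@[simp] theorem comp_onV {G H K : Hyp S} (f : G ⟶ H) (g : H ⟶ K) (v : G.V) :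
    (f ≫ g).onV v = g.onV (f.onV v) := rfl

@[simp] theorem comp_onE {G H K : Hyp S} (f : G ⟶ H) (g : H ⟶ K) {k l : ℕ} {o : S k l}
    (e : G.E o) : (f ≫ g).onE e = g.onE (f.onE e) := rfl

/-- The discrete hypergraph with `n` nodes. -/
def disc (S : Signature.{u}) (n : ℕ) : Hyp S where
  V := Fin n
  E _ := Empty
  src e := e.elim
  tgt e := e.elim
  finite_V := inferInstanceAs (Finite (Fin n))
  finite_E := Finite.of_injective (fun x => (x.2.2.2.elim : Empty)) fun x => x.2.2.2.elim

/-- The homomorphism out of a discrete hypergraph given by a function on nodes. -/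
def ofFun {n : ℕ} {G : Hyp S} (f : Fin n → G.V) : disc S n ⟶ G :=
  Hom.mk f (fun e => e.elim) (fun e => e.elim) (fun e => e.elim)

@[simp] theorem ofFun_onV {n : ℕ} {G : Hyp S} (f : Fin n → G.V) (i : Fin n) :
    (ofFun f).onV i = f i := rfl

theorem disc_hom_ext {n : ℕ} {G : Hyp S} {f g : disc S n ⟶ G}
    (h : ∀ i : Fin n, f.onV i = g.onV i) : f = g :=
  hom_ext h fun e => e.elim

/-- The disjoint union (coproduct) of hypergraphs. -/
def sum (G H : Hyp S) : Hyp S where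
  V := G.V ⊕ H.V
  E o := G.E o ⊕ H.E o
  src e i := e.elim (fun e => .inl (G.src e i)) (fun e => .inr (H.src e i))
  tgt e i := e.elim (fun e => .inl (G.tgt e i)) (fun e => .inr (H.tgt e i))
  finite_V := by
    have := G.finite_V
    have := H.finite_V
    exact (inferInstance : Finite (G.V ⊕ H.V))
  finite_E := by
    have := G.finite_E
    have := H.finite_E
    refine Finite.of_surjective
      (α := ((k : ℕ) × (l : ℕ) × (o : S k l) × G.E o) ⊕ ((k : ℕ) × (l : ℕ) × (o : S k l) × H.E o))
      (fun x => x.elim (fun y => ⟨y.1, y.2.1, y.2.2.1, .inl y.2.2.2⟩)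
        (fun y => ⟨y.1, y.2.1, y.2.2.1, .inr y.2.2.2⟩)) ?_
    rintro ⟨k, l, o, e | e⟩
    · exact ⟨.inl ⟨k, l, o, e⟩, rfl⟩
    · exact ⟨.inr ⟨k, l, o, e⟩, rfl⟩

/-- The left inclusion. -/
def inl (G H : Hyp S) : G ⟶ G.sum H := Hom.mk .inl .inl (fun _ _ => rfl) (fun _ _ => rfl)

/-- The right inclusion. -/
def inr (G H : Hyp S) : H ⟶ G.sum H := Hom.mk .inr .inr (fun _ _ => rfl) (fun _ _ => rfl)

/-- The copairing of two homomorphisms. -/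
def desc {G H K : Hyp S} (f : G ⟶ K) (g : H ⟶ K) : G.sum H ⟶ K :=
  Hom.mk (fun v => v.elim f.onV g.onV) (fun e => e.elim f.onE g.onE)
    (by rintro k l o (e | e) i; exacts [f.src_onE e i, g.src_onE e i])
    (by rintro k l o (e | e) i; exacts [f.tgt_onE e i, g.tgt_onE e i])

@[simp] theorem inl_desc {G H K : Hyp S} (f : G ⟶ K) (g : H ⟶ K) : inl G H ≫ desc f g = f := rfl

@[simp] theorem inr_desc {G H K : Hyp S} (f : G ⟶ K) (g : H ⟶ K) : inr G H ≫ desc f g = g := rfl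

@[simp] theorem inl_desc_assoc {G H K L : Hyp S} (f : G ⟶ K) (g : H ⟶ K) (h : K ⟶ L) :
    inl G H ≫ desc f g ≫ h = f ≫ h := rfl

@[simp] theorem inr_desc_assoc {G H K L : Hyp S} (f : G ⟶ K) (g : H ⟶ K) (h : K ⟶ L) :
    inr G H ≫ desc f g ≫ h = g ≫ h := rfl

theorem sum_hom_ext {G H K : Hyp S} {f g : G.sum H ⟶ K} (h₁ : inl G H ≫ f = inl G H ≫ g)
    (h₂ : inr G H ≫ f = inr G H ≫ g) : f = g := by
  refine hom_ext ?_ ?_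
  · rintro (v | v)
    exacts [congrArg (fun t => Hom.onV t v) h₁, congrArg (fun t => Hom.onV t v) h₂]
  · rintro k l o (e | e)
    exacts [congrArg (fun t => Hom.onE t e) h₁, congrArg (fun t => Hom.onE t e) h₂]

section Pushout

variable {A G H : Hyp S} (f : A ⟶ G) (g : A ⟶ H)

/-- The gluing relation on nodes. -/
def glueV (x y : G.V ⊕ H.V) : Prop := ∃ a, x = .inl (f.onV a) ∧ y = .inr (g.onV a)

/-- The gluing relation on hyperedges. -/
def glueE {k l : ℕ} (o : S k l) (x y : G.E o ⊕ H.E o) : Prop :=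
  ∃ a : A.E o, x = .inl (f.onE a) ∧ y = .inr (g.onE a)

/-- The pushout of hypergraphs, computed pointwise. -/
def glue : Hyp S where
  V := Quot (glueV f g)
  E o := Quot (glueE f g o)
  src {k l o} e i := Quot.lift (fun e => Quot.mk (glueV f g) ((G.sum H).src e i))
    (by
      rintro _ _ ⟨a, rfl, rfl⟩
      exact Quot.sound ⟨A.src a i, congrArg Sum.inl (f.src_onE a i),
        congrArg Sum.inr (g.src_onE a i)⟩) e
  tgt {k l o} e i := Quot.lift (fun e => Quot.mk (glueV f g) ((G.sum H).tgt e i))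
    (by
      rintro _ _ ⟨a, rfl, rfl⟩
      exact Quot.sound ⟨A.tgt a i, congrArg Sum.inl (f.tgt_onE a i),
        congrArg Sum.inr (g.tgt_onE a i)⟩) e
  finite_V :=
    have : Finite (G.V ⊕ H.V) := (G.sum H).finite_V
    Finite.of_surjective (Quot.mk (glueV f g)) Quot.mk_surjective
  finite_E := by
    have := (G.sum H).finite_E
    refine Finite.of_surjective
      (α := (k : ℕ) × (l : ℕ) × (o : S k l) × (G.sum H).E o)
      (fun y => ⟨y.1, y.2.1, y.2.2.1, Quot.mk _ y.2.2.2⟩) ?_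
    rintro ⟨k, l, o, ⟨e⟩⟩
    exact ⟨⟨k, l, o, e⟩, rfl⟩

/-- The left leg into the pushout. -/
def glueInl : G ⟶ glue f g :=
  Hom.mk (fun v => Quot.mk _ (.inl v)) (fun e => Quot.mk _ (.inl e)) (fun _ _ => rfl)
    (fun _ _ => rfl)

/-- The right leg into the pushout. -/
def glueInr : H ⟶ glue f g :=
  Hom.mk (fun v => Quot.mk _ (.inr v)) (fun e => Quot.mk _ (.inr e)) (fun _ _ => rfl)
    (fun _ _ => rfl)

/-- The homomorphism out of the pushout induced by a cocone. -/
def glueDesc {K : Hyp S} (s : G ⟶ K) (t : H ⟶ K) (w : f ≫ s = g ≫ t) : glue f g ⟶ K :=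
  Hom.mk
    (Quot.lift (desc s t).onV
      (by rintro _ _ ⟨a, rfl, rfl⟩; exact congrArg (fun t => Hom.onV t a) w))
    (fun {k l o} => Quot.lift (desc s t).onE
      (by rintro _ _ ⟨a, rfl, rfl⟩; exact congrArg (fun t => Hom.onE t a) w))
    (by rintro k l o ⟨e⟩ i; exact (desc s t).src_onE e i)
    (by rintro k l o ⟨e⟩ i; exact (desc s t).tgt_onE e i)

theorem isPushout_of_desc {C : Type w} [Category.{v} C] {A G H P : C} {f : A ⟶ G} {g : A ⟶ H}
    {i : G ⟶ P} {j : H ⟶ P} (w : f ≫ i = g ≫ j)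
    (d : ∀ {K : C} (s : G ⟶ K) (t : H ⟶ K), f ≫ s = g ≫ t → ∃ u : P ⟶ K, i ≫ u = s ∧ j ≫ u = t)
    (he : ∀ {K : C} (u u' : P ⟶ K), i ≫ u = i ≫ u' → j ≫ u = j ≫ u' → u = u') :
    IsPushout f g i j := by
  choose d hd using @d
  refine ⟨⟨w⟩, ⟨PushoutCocone.IsColimit.mk w (fun s => d s.inl s.inr s.condition)
    (fun s => (hd _ _ s.condition).1) (fun s => (hd _ _ s.condition).2) ?_⟩⟩
  intro s m h₁ h₂
  exact he _ _ (h₁.trans (hd _ _ s.condition).1.symm) (h₂.trans (hd _ _ s.condition).2.symm)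

theorem isPushout_glue : IsPushout f g (glueInl f g) (glueInr f g) := by
  refine isPushout_of_desc ?_ (fun s t w => ⟨glueDesc f g s t w, rfl, rfl⟩) ?_
  · exact hom_ext (fun v => Quot.sound ⟨v, rfl, rfl⟩) (fun e => Quot.sound ⟨e, rfl, rfl⟩)
  · intro K u u' h₁ h₂
    refine hom_ext ?_ ?_
    · rintro ⟨v | v⟩
      exacts [congrArg (fun t => Hom.onV t v) h₁, congrArg (fun t => Hom.onV t v) h₂]
    · rintro k l o ⟨e | e⟩
      exacts [congrArg (fun t => Hom.onE t e) h₁, congrArg (fun t => Hom.onE t e) h₂]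

end Pushout

/-- The inclusion of the first `n` nodes. -/
def discInl (S : Signature.{u}) (n m : ℕ) : disc S n ⟶ disc S (n + m) := ofFun (Fin.castAdd m)

/-- The inclusion of the last `m` nodes. -/
def discInr (S : Signature.{u}) (n m : ℕ) : disc S m ⟶ disc S (n + m) := ofFun (Fin.natAdd n)

/-- The copairing `[f, g]` out of `n + m`. -/
def discDesc {n m : ℕ} {G : Hyp S} (f : disc S n ⟶ G) (g : disc S m ⟶ G) : disc S (n + m) ⟶ G :=
  ofFun (Fin.append f.onV g.onV)

@[simp] theorem discInl_discDesc {n m : ℕ} {G : Hyp S} (f : disc S n ⟶ G) (g : disc S m ⟶ G) :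
    discInl S n m ≫ discDesc f g = f :=
  disc_hom_ext fun i => Fin.append_left _ _ i

@[simp] theorem discInr_discDesc {n m : ℕ} {G : Hyp S} (f : disc S n ⟶ G) (g : disc S m ⟶ G) :
    discInr S n m ≫ discDesc f g = g :=
  disc_hom_ext fun i => Fin.append_right _ _ i

@[simp] theorem discInl_discDesc_assoc {n m : ℕ} {G H : Hyp S} (f : disc S n ⟶ G)
    (g : disc S m ⟶ G) (h : G ⟶ H) : discInl S n m ≫ discDesc f g ≫ h = f ≫ h := by
  rw [← Category.assoc, discInl_discDesc]

@[simp] theorem discInr_discDesc_assoc {n m : ℕ} {G H : Hyp S} (f : disc S n ⟶ G)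
    (g : disc S m ⟶ G) (h : G ⟶ H) : discInr S n m ≫ discDesc f g ≫ h = g ≫ h := by
  rw [← Category.assoc, discInr_discDesc]

theorem disc_add_hom_ext {n m : ℕ} {G : Hyp S} {f g : disc S (n + m) ⟶ G}
    (h₁ : discInl S n m ≫ f = discInl S n m ≫ g) (h₂ : discInr S n m ≫ f = discInr S n m ≫ g) :
    f = g := by
  refine disc_hom_ext fun i => ?_
  refine Fin.addCases (fun i => ?_) (fun i => ?_) i
  exacts [congrArg (fun t => Hom.onV t i) h₁, congrArg (fun t => Hom.onV t i) h₂]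

end Hyp

/-! ## Frobenius termgraphs -/

/-- A discrete cospan `n ⟶ G ⟵ m` of `S`-typed hypergraphs. -/
structure Cospan (S : Signature.{u}) (n m : ℕ) where
  apex : Hyp S
  left : Hyp.disc S n ⟶ apex
  right : Hyp.disc S m ⟶ apex

namespace Cospan

open Hyp

variable {S : Signature.{u}}

/-- Isomorphism of cospans. -/
def Equiv {n m : ℕ} (A B : Cospan S n m) : Prop :=
  ∃ i : A.apex ≅ B.apex, A.left ≫ i.hom = B.left ∧ A.right ≫ i.hom = B.right

theorem Equiv.refl {n m : ℕ} (A : Cospan S n m) : A.Equiv A :=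
  ⟨Iso.refl _, Category.comp_id _, Category.comp_id _⟩

theorem Equiv.symm {n m : ℕ} {A B : Cospan S n m} : A.Equiv B → B.Equiv A := by
  rintro ⟨i, h₁, h₂⟩
  exact ⟨i.symm, by simp [← h₁], by simp [← h₂]⟩

theorem Equiv.trans {n m : ℕ} {A B C : Cospan S n m} : A.Equiv B → B.Equiv C → A.Equiv C := by
  rintro ⟨i, h₁, h₂⟩ ⟨j, h₃, h₄⟩
  exact ⟨i.trans j, by simp [← h₃, ← h₁], by simp [← h₄, ← h₂]⟩

/-- Isomorphism of cospans as a setoid. -/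
def setoid (S : Signature.{u}) (n m : ℕ) : Setoid (Cospan S n m) where
  r := Equiv
  iseqv := ⟨.refl, .symm, .trans⟩

/-- The identity cospan. -/
def id (S : Signature.{u}) (n : ℕ) : Cospan S n n := ⟨disc S n, 𝟙 _, 𝟙 _⟩

/-- Composition of cospans, by pushout. -/
def comp {a b c : ℕ} (A : Cospan S a b) (B : Cospan S b c) : Cospan S a c :=
  ⟨glue A.right B.left, A.left ≫ glueInl A.right B.left, B.right ≫ glueInr A.right B.left⟩

/-- The monoidal product of cospans, by coproduct. -/
def tensor {a b c d : ℕ} (A : Cospan S a b) (B : Cospan S c d) : Cospan S (a + c) (b + d) :=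
  ⟨A.apex.sum B.apex, discDesc (A.left ≫ inl _ _) (B.left ≫ inr _ _),
    discDesc (A.right ≫ inl _ _) (B.right ≫ inr _ _)⟩

/-- The block swap `m + n ⟶ n + m` of discrete hypergraphs. -/
def swap (S : Signature.{u}) (n m : ℕ) : disc S (m + n) ⟶ disc S (n + m) :=
  discDesc (discInr S n m) (discInl S n m)

/-- The symmetry cospan. -/
def symm (S : Signature.{u}) (n m : ℕ) : Cospan S (n + m) (m + n) :=
  ⟨disc S (n + m), 𝟙 _, swap S n m⟩

/-- `C` is a composite of `A` and `B`, witnessed by some pushout square. -/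
def IsComp {a b c : ℕ} (A : Cospan S a b) (B : Cospan S b c) (C : Cospan S a c) : Prop :=
  ∃ (i : A.apex ⟶ C.apex) (j : B.apex ⟶ C.apex), IsPushout A.right B.left i j ∧
    A.left ≫ i = C.left ∧ B.right ≫ j = C.right

theorem isComp_comp {a b c : ℕ} (A : Cospan S a b) (B : Cospan S b c) :
    IsComp A B (A.comp B) :=
  ⟨_, _, isPushout_glue _ _, rfl, rfl⟩

theorem IsComp.equiv {a b c : ℕ} {A A' : Cospan S a b} {B B' : Cospan S b c}
    {C C' : Cospan S a c} (h : IsComp A B C) (h' : IsComp A' B' C') (hA : A.Equiv A')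
    (hB : B.Equiv B') : C.Equiv C' := by
  obtain ⟨A, Al, Ar⟩ := A
  obtain ⟨B, Bl, Br⟩ := B
  obtain ⟨i, j, hp, h₁, h₂⟩ := h
  obtain ⟨i', j', hp', h₁', h₂'⟩ := h'
  obtain ⟨x, hx₁, hx₂⟩ := hA
  obtain ⟨y, hy₁, hy₂⟩ := hB
  have hp'' : IsPushout Ar Bl (x.hom ≫ i') (y.hom ≫ j') := by
    refine isPushout_of_desc ?_ ?_ ?_
    · have := hp'.w
      rw [← hx₂, ← hy₁] at this
      simpa using this
    · intro K s t w
      have hw : A'.right ≫ x.inv ≫ s = B'.left ≫ y.inv ≫ t := by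
        rw [← hx₂, ← hy₁]
        simpa using w
      exact ⟨hp'.desc (x.inv ≫ s) (y.inv ≫ t) hw, by simp, by simp⟩
    · intro K u u' h₁ h₂
      refine hp'.hom_ext ?_ ?_
      · simpa [Category.assoc] using h₁
      · simpa [Category.assoc] using h₂
  refine ⟨hp.isoIsPushout _ _ hp'', ?_, ?_⟩
  · rw [← h₁, ← h₁', ← hx₁, Category.assoc, Category.assoc, IsPushout.inl_isoIsPushout_hom]
  · rw [← h₂, ← h₂', ← hy₂, Category.assoc, Category.assoc, IsPushout.inr_isoIsPushout_hom]

theorem comp_equiv {a b c : ℕ} {A : Cospan S a b} {B : Cospan S b c} {C : Cospan S a c}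
    (h : IsComp A B C) : (A.comp B).Equiv C :=
  (isComp_comp A B).equiv h (.refl _) (.refl _)

theorem comp_congr {a b c : ℕ} {A A' : Cospan S a b} {B B' : Cospan S b c} (hA : A.Equiv A')
    (hB : B.Equiv B') : (A.comp B).Equiv (A'.comp B') :=
  (isComp_comp A B).equiv (isComp_comp A' B') hA hB

theorem tensor_congr {a b c d : ℕ} {A A' : Cospan S a b} {B B' : Cospan S c d}
    (hA : A.Equiv A') (hB : B.Equiv B') : (A.tensor B).Equiv (A'.tensor B') := by
  obtain ⟨x, hx₁, hx₂⟩ := hA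
  obtain ⟨y, hy₁, hy₂⟩ := hB
  refine ⟨⟨desc (x.hom ≫ inl _ _) (y.hom ≫ inr _ _), desc (x.inv ≫ inl _ _) (y.inv ≫ inr _ _),
    ?_, ?_⟩, ?_, ?_⟩
  · apply sum_hom_ext <;> simp [tensor]
  · apply sum_hom_ext <;> simp [tensor]
  · apply disc_add_hom_ext <;> simp [tensor, ← hx₁, ← hy₁]
  · apply disc_add_hom_ext <;> simp [tensor, ← hx₂, ← hy₂]

/-- A cospan whose left leg is precomposed with a map of discrete hypergraphs. -/
def preLeft {a b c : ℕ} (p : disc S a ⟶ disc S b) (A : Cospan S b c) : Cospan S a c :=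
  ⟨A.apex, p ≫ A.left, A.right⟩

/-- A cospan whose right leg is precomposed with a map of discrete hypergraphs. -/
def preRight {a b c : ℕ} (A : Cospan S a b) (q : disc S c ⟶ disc S b) : Cospan S a c :=
  ⟨A.apex, A.left, q ≫ A.right⟩

theorem isComp_preLeft {a b c : ℕ} (p : disc S a ⟶ disc S b) (A : Cospan S b c) :
    IsComp ⟨disc S b, p, 𝟙 _⟩ A (A.preLeft p) :=
  ⟨A.left, 𝟙 _, IsPushout.of_id_fst, rfl, Category.comp_id _⟩

theorem isComp_preRight {a b c : ℕ} (A : Cospan S a b) (q : disc S c ⟶ disc S b) :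
    IsComp A ⟨disc S b, 𝟙 _, q⟩ (A.preRight q) :=
  ⟨𝟙 _, A.right, IsPushout.of_id_snd, Category.comp_id _, rfl⟩

theorem id_comp {a b : ℕ} (A : Cospan S a b) : ((id S a).comp A).Equiv A :=
  (comp_equiv (isComp_preLeft (𝟙 _) A)).trans ⟨Iso.refl _, by simp [preLeft], by simp [preLeft]⟩

theorem comp_id {a b : ℕ} (A : Cospan S a b) : (A.comp (id S b)).Equiv A :=
  (comp_equiv (isComp_preRight A (𝟙 _))).trans
    ⟨Iso.refl _, by simp [preRight], by simp [preRight]⟩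

theorem assoc {a b c d : ℕ} (A : Cospan S a b) (B : Cospan S b c) (C : Cospan S c d) :
    ((A.comp B).comp C).Equiv (A.comp (B.comp C)) := by
  have h₁ := isPushout_glue A.right B.left
  have h₂ := isPushout_glue B.right C.left
  have h := isPushout_glue (glueInr A.right B.left) (glueInl B.right C.left)
  set i := glueInl (glueInr A.right B.left) (glueInl B.right C.left)
  set j := glueInr (glueInr A.right B.left) (glueInl B.right C.left)
  let X : Cospan S a d := ⟨_, (A.comp B).left ≫ i, (B.comp C).right ≫ j⟩
  have e₁ : IsComp (A.comp B) C X := by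
    refine ⟨i, glueInr B.right C.left ≫ j, ?_, rfl, ?_⟩
    · exact (h₂.flip.paste_vert h.flip).flip
    · simp [X, comp]
  have e₂ : IsComp A (B.comp C) X := by
    refine ⟨glueInl A.right B.left ≫ i, j, ?_, ?_, rfl⟩
    · exact h₁.paste_vert h
    · simp [X, comp]
  exact (comp_equiv e₁).trans (comp_equiv e₂).symm

theorem isPushout_sum {n m : ℕ} {G H P G' H' P' : Hyp S} {f : disc S n ⟶ G} {g : disc S n ⟶ H}
    {i : G ⟶ P} {j : H ⟶ P} {f' : disc S m ⟶ G'} {g' : disc S m ⟶ H'} {i' : G' ⟶ P'}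
    {j' : H' ⟶ P'} (hp : IsPushout f g i j) (hp' : IsPushout f' g' i' j') :
    IsPushout (discDesc (f ≫ inl G G') (f' ≫ inr G G')) (discDesc (g ≫ inl H H') (g' ≫ inr H H'))
      (desc (i ≫ inl P P') (i' ≫ inr P P')) (desc (j ≫ inl P P') (j' ≫ inr P P')) := by
  refine isPushout_of_desc ?_ ?_ ?_
  · apply disc_add_hom_ext
    · simp [reassoc_of% hp.w]
    · simp [reassoc_of% hp'.w]
  · intro K s t w
    have w₁ := congrArg (fun f => discInl S _ _ ≫ f) w
    have w₂ := congrArg (fun f => discInr S _ _ ≫ f) w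
    simp only [discInl_discDesc_assoc, discInr_discDesc_assoc, Category.assoc] at w₁ w₂
    refine ⟨desc (hp.desc (inl _ _ ≫ s) (inl _ _ ≫ t) w₁)
      (hp'.desc (inr _ _ ≫ s) (inr _ _ ≫ t) w₂), ?_, ?_⟩
    · apply sum_hom_ext <;> simp
    · apply sum_hom_ext <;> simp
  · intro K u u' h₁ h₂
    have k₁ := congrArg (fun f => inl _ _ ≫ f) h₁
    have k₂ := congrArg (fun f => inr _ _ ≫ f) h₁
    have k₃ := congrArg (fun f => inl _ _ ≫ f) h₂
    have k₄ := congrArg (fun f => inr _ _ ≫ f) h₂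
    simp only [inl_desc_assoc, inr_desc_assoc, Category.assoc] at k₁ k₂ k₃ k₄
    apply sum_hom_ext
    · exact hp.hom_ext k₁ k₃
    · exact hp'.hom_ext k₂ k₄

theorem IsComp.tensor {a b c a' b' c' : ℕ} {A : Cospan S a b} {B : Cospan S b c}
    {C : Cospan S a c} {A' : Cospan S a' b'} {B' : Cospan S b' c'} {C' : Cospan S a' c'}
    (h : IsComp A B C) (h' : IsComp A' B' C') :
    IsComp (A.tensor A') (B.tensor B') (C.tensor C') := by
  obtain ⟨i, j, hp, h₁, h₂⟩ := h
  obtain ⟨i', j', hp', h₁', h₂'⟩ := h'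
  refine ⟨_, _, isPushout_sum hp hp', ?_, ?_⟩
  · apply disc_add_hom_ext <;> simp [Cospan.tensor, ← h₁, ← h₁']
  · apply disc_add_hom_ext <;> simp [Cospan.tensor, ← h₂, ← h₂']

theorem tensor_comp {a b c a' b' c' : ℕ} (A : Cospan S a b) (B : Cospan S b c)
    (A' : Cospan S a' b') (B' : Cospan S b' c') :
    ((A.comp B).tensor (A'.comp B')).Equiv ((A.tensor A').comp (B.tensor B')) :=
  (comp_equiv ((isComp_comp A B).tensor (isComp_comp A' B'))).symm

/-- The isomorphism between the two ways to form a discrete hypergraph with `n + m` nodes. -/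
def discIso (S : Signature.{u}) (n m : ℕ) : (disc S n).sum (disc S m) ≅ disc S (n + m) where
  hom := desc (discInl S n m) (discInr S n m)
  inv := discDesc (inl _ _) (inr _ _)
  hom_inv_id := by apply sum_hom_ext <;> simp
  inv_hom_id := by apply disc_add_hom_ext <;> simp

theorem tensor_disc {a b c a' b' c' : ℕ} (p : disc S a ⟶ disc S b) (q : disc S c ⟶ disc S b)
    (p' : disc S a' ⟶ disc S b') (q' : disc S c' ⟶ disc S b') :
    (tensor ⟨disc S b, p, q⟩ ⟨disc S b', p', q'⟩).Equiv
      ⟨disc S (b + b'), discDesc (p ≫ discInl S b b') (p' ≫ discInr S b b'),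
        discDesc (q ≫ discInl S b b') (q' ≫ discInr S b b')⟩ := by
  refine ⟨discIso S b b', ?_, ?_⟩
  · apply disc_add_hom_ext <;> simp [tensor, discIso]
  · apply disc_add_hom_ext <;> simp [tensor, discIso]

theorem tensor_id (n m : ℕ) : ((id S n).tensor (id S m)).Equiv (id S (n + m)) := by
  refine (tensor_disc _ _ _ _).trans ⟨Iso.refl _, ?_, ?_⟩
  · apply disc_add_hom_ext <;> simp [id]
  · apply disc_add_hom_ext <;> simp [id]

/-- The identification of discrete hypergraphs along an equality of sizes. -/
def dcast (S : Signature.{u}) {a a' : ℕ} (h : a = a') : disc S a' ⟶ disc S a :=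
  ofFun (Fin.cast h.symm)

theorem dcast_rfl (n : ℕ) (h : n = n) : dcast S h = 𝟙 _ := disc_hom_ext fun _ => rfl

theorem discDesc_id (n m : ℕ) : discDesc (discInl S n m) (discInr S n m) = 𝟙 _ := by
  apply disc_add_hom_ext <;> simp

theorem discDesc_val {x y k : ℕ} (f : disc S x ⟶ disc S k) (g : disc S y ⟶ disc S k)
    (i : Fin (x + y)) :
    ((discDesc f g).onV i : Fin k).val =
      if h : i.val < x then (f.onV (⟨i.val, h⟩ : Fin x) : Fin k).val
      else (g.onV (⟨i.val - x, by omega⟩ : Fin y) : Fin k).val := by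
  refine Fin.addCases (fun j => ?_) (fun j => ?_) i
  · have := congrArg (fun t => (Hom.onV t j : Fin k).val) (discInl_discDesc f g)
    refine this.trans ?_
    simp
  · have := congrArg (fun t => (Hom.onV t j : Fin k).val) (discInr_discDesc f g)
    refine this.trans ?_
    simp

theorem discInl_val {n m : ℕ} (i : Fin n) :
    ((discInl S n m).onV i : Fin (n + m)).val = i.val := rfl

theorem discInr_val {n m : ℕ} (i : Fin m) :
    ((discInr S n m).onV i : Fin (n + m)).val = n + i.val := rfl

theorem castHom_eq {a a' b b' : ℕ} (ha : a = a') (hb : b = b') (A : Cospan S a b) :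
    castHom (Cospan S) ha hb A = ⟨A.apex, dcast S ha ≫ A.left, dcast S hb ≫ A.right⟩ := by
  subst ha hb
  rw [dcast_rfl, dcast_rfl, Category.id_comp, Category.id_comp]
  rfl

theorem castHom_congr {a a' b b' : ℕ} (ha : a = a') (hb : b = b') {A B : Cospan S a b}
    (h : A.Equiv B) : (castHom (Cospan S) ha hb A).Equiv (castHom (Cospan S) ha hb B) := by
  subst ha hb; exact h

theorem dcast_discDesc {x y z : ℕ} {K : Hyp S} (f : disc S x ⟶ K) (g : disc S y ⟶ K)
    (h : disc S z ⟶ K) : dcast S (Nat.add_assoc x y z) ≫ discDesc (discDesc f g) h =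
      discDesc f (discDesc g h) := by
  refine disc_hom_ext fun i => ?_
  have := congrFun (Fin.append_assoc f.onV g.onV h.onV) (Fin.cast (Nat.add_assoc x y z).symm i)
  exact this

theorem discDesc_comp {x y : ℕ} {K L : Hyp S} (f : disc S x ⟶ K) (g : disc S y ⟶ K)
    (h : K ⟶ L) : discDesc f g ≫ h = discDesc (f ≫ h) (g ≫ h) := by
  apply disc_add_hom_ext <;> simp

/-- Associativity of the disjoint union. -/
def sumAssoc (G H K : Hyp S) : (G.sum H).sum K ≅ G.sum (H.sum K) where
  hom := desc (desc (inl _ _) (inl _ _ ≫ inr _ _)) (inr _ _ ≫ inr _ _)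
  inv := desc (inl _ _ ≫ inl _ _) (desc (inr _ _ ≫ inl _ _) (inr _ _))
  hom_inv_id := by
    apply sum_hom_ext
    · apply sum_hom_ext <;> simp
    · simp
  inv_hom_id := by
    apply sum_hom_ext
    · simp
    · apply sum_hom_ext <;> simp

theorem sumAssoc_leg {x y z : ℕ} {G H K : Hyp S} (f : disc S x ⟶ G) (g : disc S y ⟶ H)
    (h : disc S z ⟶ K) :
    (dcast S (Nat.add_assoc x y z) ≫
      discDesc (discDesc (f ≫ inl G H) (g ≫ inr G H) ≫ inl (G.sum H) K)
        (h ≫ inr (G.sum H) K)) ≫ (sumAssoc G H K).hom =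
    discDesc (f ≫ inl G (H.sum K)) (discDesc (g ≫ inl H K) (h ≫ inr H K) ≫ inr G (H.sum K)) := by
  rw [discDesc_comp, dcast_discDesc, discDesc_comp, discDesc_comp, discDesc_comp]
  simp [sumAssoc]

theorem tensor_assoc {a b c a' b' c' : ℕ} (A : Cospan S a a') (B : Cospan S b b')
    (C : Cospan S c c') :
    (castHom (Cospan S) (Nat.add_assoc a b c) (Nat.add_assoc a' b' c')
      ((A.tensor B).tensor C)).Equiv (A.tensor (B.tensor C)) := by
  rw [castHom_eq]
  exact ⟨sumAssoc _ _ _, sumAssoc_leg _ _ _, sumAssoc_leg _ _ _⟩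

/-- The empty hypergraph is a unit for the disjoint union, on the left. -/
def zeroSum (G : Hyp S) : (disc S 0).sum G ≅ G where
  hom := desc (ofFun Fin.elim0) (𝟙 _)
  inv := inr _ _
  hom_inv_id := by
    apply sum_hom_ext
    · exact disc_hom_ext fun i => i.elim0
    · simp
  inv_hom_id := by simp

/-- The empty hypergraph is a unit for the disjoint union, on the right. -/
def sumZero (G : Hyp S) : G.sum (disc S 0) ≅ G where
  hom := desc (𝟙 _) (ofFun Fin.elim0)
  inv := inl _ _
  hom_inv_id := by
    apply sum_hom_ext
    · simp
    · exact disc_hom_ext fun i => i.elim0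
  inv_hom_id := by simp

theorem zeroSum_leg {x : ℕ} {G : Hyp S} (f : disc S x ⟶ G) :
    (dcast S (Nat.zero_add x) ≫ discDesc (𝟙 _ ≫ inl (disc S 0) G) (f ≫ inr (disc S 0) G)) ≫
      (zeroSum G).hom = f := by
  have h₁ : (f ≫ inr (disc S 0) G) ≫ (zeroSum G).hom = f := by simp [zeroSum]
  rw [Category.assoc, discDesc_comp, h₁]
  refine disc_hom_ext fun i => ?_
  have : (Fin.cast (Nat.zero_add x).symm i) = Fin.natAdd 0 i := Fin.ext (by simp)
  exact (congrArg (discDesc ((𝟙 _ ≫ inl (disc S 0) G) ≫ (zeroSum G).hom) f).onV this).trans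
    (congrArg (fun t : disc S x ⟶ G => t.onV i)
      (discInr_discDesc ((𝟙 _ ≫ inl (disc S 0) G) ≫ (zeroSum G).hom) f))

theorem sumZero_leg {x : ℕ} {G : Hyp S} (f : disc S x ⟶ G) :
    (dcast S (Nat.add_zero x) ≫ discDesc (f ≫ inl G (disc S 0)) (𝟙 _ ≫ inr G (disc S 0))) ≫
      (sumZero G).hom = f := by
  have h₁ : (f ≫ inl G (disc S 0)) ≫ (sumZero G).hom = f := by simp [sumZero]
  rw [Category.assoc, discDesc_comp, h₁]
  refine disc_hom_ext fun i => ?_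
  have : (Fin.cast (Nat.add_zero x).symm i) = Fin.castAdd 0 i := Fin.ext (by simp)
  exact (congrArg (discDesc f ((𝟙 _ ≫ inr G (disc S 0)) ≫ (sumZero G).hom)).onV this).trans
    (congrFun (congrArg Hom.onV
      (discInl_discDesc f ((𝟙 _ ≫ inr G (disc S 0)) ≫ (sumZero G).hom))) i)

theorem id_zero_tensor {a b : ℕ} (A : Cospan S a b) :
    (castHom (Cospan S) (Nat.zero_add a) (Nat.zero_add b) ((id S 0).tensor A)).Equiv A := by
  rw [castHom_eq]
  exact ⟨zeroSum _, zeroSum_leg _, zeroSum_leg _⟩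

theorem tensor_id_zero {a b : ℕ} (A : Cospan S a b) :
    (castHom (Cospan S) (Nat.add_zero a) (Nat.add_zero b) (A.tensor (id S 0))).Equiv A := by
  rw [castHom_eq]
  exact ⟨sumZero _, sumZero_leg _, sumZero_leg _⟩

theorem swap_swap (n m : ℕ) : swap S n m ≫ swap S m n = 𝟙 _ := by
  apply disc_add_hom_ext <;> simp [swap]

/-- The block swap is an isomorphism. -/
def swapIso (S : Signature.{u}) (n m : ℕ) : disc S (n + m) ≅ disc S (m + n) where
  hom := swap S m n
  inv := swap S n m
  hom_inv_id := swap_swap m n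
  inv_hom_id := swap_swap n m

theorem symm_equiv (n m : ℕ) : (symm S n m).Equiv ⟨disc S (m + n), swap S m n, 𝟙 _⟩ :=
  ⟨swapIso S n m, by simp [symm, swapIso], by simp [symm, swapIso, swap_swap]⟩

theorem symm_symm (n m : ℕ) : ((symm S n m).comp (symm S m n)).Equiv (id S (n + m)) := by
  refine (comp_congr (.refl _) (symm_equiv m n)).trans ?_
  refine (comp_equiv (C := ⟨disc S (n + m), 𝟙 _, 𝟙 _⟩) ?_).trans (.refl _)
  refine ⟨𝟙 _, 𝟙 _, ?_, by simp [symm], by simp⟩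
  have : IsPushout (swap S n m) (swap S n m) (𝟙 _) (𝟙 _) := by
    have : IsIso (swap S n m) := (swapIso S m n).isIso_hom
    exact IsPushout.of_horiz_isIso ⟨rfl⟩
  exact this

/-- Commutativity of the disjoint union. -/
def sumComm (G H : Hyp S) : G.sum H ≅ H.sum G where
  hom := desc (inr _ _) (inl _ _)
  inv := desc (inr _ _) (inl _ _)
  hom_inv_id := by apply sum_hom_ext <;> simp
  inv_hom_id := by apply sum_hom_ext <;> simp

theorem sumComm_leg {x y : ℕ} {G H : Hyp S} (f : disc S x ⟶ G) (g : disc S y ⟶ H) :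
    discDesc (f ≫ inl G H) (g ≫ inr G H) ≫ (sumComm G H).hom =
      swap S y x ≫ discDesc (g ≫ inl H G) (f ≫ inr H G) := by
  rw [discDesc_comp]
  apply disc_add_hom_ext <;> simp [swap, sumComm]

theorem symm_natural {a b c d : ℕ} (A : Cospan S a b) (B : Cospan S c d) :
    ((A.tensor B).comp (symm S b d)).Equiv ((symm S a c).comp (B.tensor A)) := by
  refine (comp_equiv (isComp_preRight _ _)).trans (Equiv.symm ?_)
  refine (comp_congr (symm_equiv a c) (.refl _)).trans ?_
  refine (comp_equiv (isComp_preLeft _ _)).trans ?_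
  refine Equiv.symm ⟨sumComm _ _, sumComm_leg _ _, ?_⟩
  have := sumComm_leg A.right B.right
  change (swap S b d ≫ discDesc (A.right ≫ inl _ _) (B.right ≫ inr _ _)) ≫ (sumComm _ _).hom =
    discDesc (B.right ≫ inl _ _) (A.right ≫ inr _ _)
  rw [Category.assoc, this, ← Category.assoc, swap_swap, Category.id_comp]

theorem swap_val {n m : ℕ} (i : Fin (m + n)) :
    ((swap S n m).onV i : Fin (n + m)).val = if i.val < m then n + i.val else i.val - m := by
  refine (discDesc_val _ _ i).trans ?_
  split_ifs <;> rfl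

theorem symm_add (a b c : ℕ) :
    (symm S a (b + c)).Equiv
      ((castHom (Cospan S) (Nat.add_assoc a b c) (Nat.add_assoc b a c)
          ((symm S a b).tensor (id S c))).comp
        (castHom (Cospan S) rfl (Nat.add_assoc b c a).symm ((id S b).tensor (symm S a c)))) := by
  have h₁ : (castHom (Cospan S) (Nat.add_assoc a b c) (Nat.add_assoc b a c)
      ((symm S a b).tensor (id S c))).Equiv
      ⟨disc S (a + b + c), dcast S (Nat.add_assoc a b c),
        dcast S (Nat.add_assoc b a c) ≫
          discDesc (swap S a b ≫ discInl S (a + b) c) (discInr S (a + b) c)⟩ := by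
    refine (castHom_congr _ _ (tensor_disc _ _ _ _)).trans ?_
    rw [castHom_eq]
    refine ⟨Iso.refl _, ?_, ?_⟩
    · simp [discDesc_id]
    · simp
  have h₂ : (castHom (Cospan S) rfl (Nat.add_assoc b c a).symm
      ((id S b).tensor (symm S a c))).Equiv
      ⟨disc S (b + (a + c)), 𝟙 _, dcast S (Nat.add_assoc b c a).symm ≫
        discDesc (discInl S b (a + c)) (swap S a c ≫ discInr S b (a + c))⟩ := by
    refine (castHom_congr _ _ (tensor_disc _ _ _ _)).trans ?_
    rw [castHom_eq]
    refine ⟨Iso.refl _, ?_, ?_⟩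
    · simp [discDesc_id, dcast_rfl]
    · simp
  refine Equiv.symm ((comp_congr h₁ h₂).trans ((comp_equiv (isComp_preRight _ _)).trans ?_))
  refine ⟨⟨dcast S (Nat.add_assoc a b c).symm, dcast S (Nat.add_assoc a b c), ?_, ?_⟩, ?_, ?_⟩
  · exact disc_hom_ext fun i => rfl
  · exact disc_hom_ext fun i => rfl
  · exact disc_hom_ext fun i => rfl
  · refine disc_hom_ext fun i => ?_
    apply Fin.ext
    set k : Fin (b + (a + c)) :=
      (discDesc (discInl S b (a + c)) (swap S a c ≫ discInr S b (a + c))).onV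
        (Fin.cast (Nat.add_assoc b c a) i) with hk
    have hk' : k.val = if i.val < b then i.val else
        b + (if i.val - b < c then a + (i.val - b) else i.val - b - c) := by
      refine (discDesc_val _ _ _).trans ?_
      by_cases h₁ : i.val < b
      · exact (dif_pos (c := i.val < b) h₁).trans (if_pos h₁).symm
      · refine (dif_neg (c := i.val < b) h₁).trans (Eq.trans ?_ (if_neg h₁).symm)
        exact congrArg (b + ·) (swap_val _)
    have hl : ((discDesc (swap S a b ≫ discInl S (a + b) c) (discInr S (a + b) c)).onV
        (Fin.cast (Nat.add_assoc b a c).symm k) : Fin (a + b + c)).val =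
        if k.val < b + a then (if k.val < b then a + k.val else k.val - b) else
          a + b + (k.val - (b + a)) := by
      refine (discDesc_val _ _ _).trans ?_
      by_cases h₁ : k.val < b + a
      · refine (dif_pos (c := k.val < b + a) h₁).trans (Eq.trans ?_ (if_pos h₁).symm)
        exact swap_val (S := S) (n := a) (m := b) ⟨k.val, h₁⟩
      · exact (dif_neg (c := k.val < b + a) h₁).trans (if_neg h₁).symm
    refine hl.trans (Eq.trans ?_ (swap_val (n := a) (m := b + c) i).symm)
    have hi : i.val < b + c + a := i.isLt
    split_ifs at hk' ⊢ <;> omega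

end Cospan

/-- Arrows `n ⟶ m` of the PROP of Frobenius termgraphs: isomorphism classes of discrete cospans. -/
abbrev TermGraph (S : Signature.{u}) (n m : ℕ) : Type (max u 1) := Quotient (Cospan.setoid S n m)

/-- The isomorphism class of a discrete cospan. -/
def Cospan.cls {S : Signature.{u}} {n m : ℕ} (A : Cospan S n m) : TermGraph S n m :=
  Quotient.mk (Cospan.setoid S n m) A

theorem Cospan.Equiv.cls_eq {S : Signature.{u}} {n m : ℕ} {A B : Cospan S n m} (h : A.Equiv B) :
    A.cls = B.cls :=
  Quotient.sound (s := Cospan.setoid S n m) h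

namespace TermGraph

variable {S : Signature.{u}}

theorem castHom_cls {a a' b b' : ℕ} (ha : a = a') (hb : b = b') (A : Cospan S a b) :
    castHom (TermGraph S) ha hb A.cls = (castHom (Cospan S) ha hb A).cls := by
  subst ha hb; rfl

/-- Composition of isomorphism classes of cospans. -/
def comp {a b c : ℕ} (f : TermGraph S a b) (g : TermGraph S b c) : TermGraph S a c :=
  Quotient.liftOn₂ f g (fun A B => (A.comp B).cls)
    fun _ _ _ _ h h' => (Cospan.comp_congr h h').cls_eq

/-- Monoidal product of isomorphism classes of cospans. -/
def tensor {a b c d : ℕ} (f : TermGraph S a b) (g : TermGraph S c d) :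
    TermGraph S (a + c) (b + d) :=
  Quotient.liftOn₂ f g (fun A B => (A.tensor B).cls)
    fun _ _ _ _ h h' => (Cospan.tensor_congr h h').cls_eq

end TermGraph

/-- The PROP of Frobenius termgraphs over `S`. -/
def FTerm (S : Signature.{u}) : PROP.{max u 1} where
  Hom := TermGraph S
  id n := (Cospan.id S n).cls
  comp := TermGraph.comp
  tensor := TermGraph.tensor
  symm n m := (Cospan.symm S n m).cls
  id_comp := by rintro a b ⟨A⟩; exact (Cospan.id_comp A).cls_eq
  comp_id := by rintro a b ⟨A⟩; exact (Cospan.comp_id A).cls_eq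
  assoc := by rintro a b c d ⟨A⟩ ⟨B⟩ ⟨C⟩; exact (Cospan.assoc A B C).cls_eq
  tensor_id n m := (Cospan.tensor_id n m).cls_eq
  tensor_comp := by
    rintro a b c a' b' c' ⟨A⟩ ⟨B⟩ ⟨A'⟩ ⟨B'⟩; exact (Cospan.tensor_comp A B A' B').cls_eq
  tensor_assoc := by
    rintro a b c a' b' c' ⟨A⟩ ⟨B⟩ ⟨C⟩
    exact (TermGraph.castHom_cls _ _ _).trans (Cospan.tensor_assoc A B C).cls_eq
  id_zero_tensor := by
    rintro a b ⟨A⟩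
    exact (TermGraph.castHom_cls _ _ _).trans (Cospan.id_zero_tensor A).cls_eq
  tensor_id_zero := by
    rintro a b ⟨A⟩
    exact (TermGraph.castHom_cls _ _ _).trans (Cospan.tensor_id_zero A).cls_eq
  symm_natural := by rintro a b c d ⟨A⟩ ⟨B⟩; exact (Cospan.symm_natural A B).cls_eq
  symm_symm n m := (Cospan.symm_symm n m).cls_eq
  symm_add a b c := by
    refine (Cospan.symm_add a b c).cls_eq.trans ?_
    have h₁ := TermGraph.castHom_cls (Nat.add_assoc a b c) (Nat.add_assoc b a c)
      ((Cospan.symm S a b).tensor (Cospan.id S c))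
    have h₂ := TermGraph.castHom_cls rfl (Nat.add_assoc b c a).symm
      ((Cospan.id S b).tensor (Cospan.symm S a c))
    exact (congrArg₂ TermGraph.comp h₁ h₂).symm

/-! ## The interpretation of `𝐒_S + Frob` in Frobenius termgraphs -/

/-- The hyperedges of the hypergraph that consists of a single hyperedge of type `o`. -/
inductive SingleEdge {S : Signature.{u}} {n m : ℕ} (o : S n m) : ∀ {k l : ℕ}, S k l → Type
  | edge : SingleEdge o o

/-- The cospan `n ⟶ G ⟵ m` of a generator `o : n ⟶ m`: `G` has a single hyperedge, of type `o`,
whose sources and targets are `n + m` distinct nodes; the legs list the sources and the targets. -/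
def genCospan {S : Signature.{u}} {n m : ℕ} (o : S n m) : Cospan S n m where
  apex :=
    { V := Fin n ⊕ Fin m
      E := SingleEdge o
      src := fun e => match e with | .edge => .inl
      tgt := fun e => match e with | .edge => .inr
      finite_V := inferInstance
      finite_E := by
        refine Finite.of_surjective (α := Unit) (fun _ => ⟨n, m, o, .edge⟩) ?_
        rintro ⟨k, l, o', ⟨⟩⟩
        exact ⟨(), rfl⟩ }
  left := Hyp.ofFun .inl
  right := Hyp.ofFun .inr

/-- The cospan `n ⟶ 1 ⟵ m` of discrete hypergraphs. -/
def spider (S : Signature.{u}) (n m : ℕ) : Cospan S n m where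
  apex := Hyp.disc S 1
  left := Hyp.ofFun fun _ => (0 : Fin 1)
  right := Hyp.ofFun fun _ => (0 : Fin 1)

section Spider

open Hyp Cospan

variable {S : Signature.{u}}

/-- The map `a + c ⟶ 2` that sends the first block to `0` and the second one to `1`. -/
def two (S : Signature.{u}) (a c : ℕ) : disc S (a + c) ⟶ disc S 2 :=
  ofFun (Fin.append (fun _ => (0 : Fin 2)) (fun _ => (1 : Fin 2)))

theorem inl_two (a c : ℕ) : discInl S a c ≫ two S a c = ofFun fun _ => (0 : Fin 2) :=
  disc_hom_ext fun i => Fin.append_left (fun _ => (0 : Fin 2)) (fun _ => (1 : Fin 2)) i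

theorem inr_two (a c : ℕ) : discInr S a c ≫ two S a c = ofFun fun _ => (1 : Fin 2) :=
  disc_hom_ext fun i => Fin.append_right (fun _ => (0 : Fin 2)) (fun _ => (1 : Fin 2)) i

theorem discDesc_eq_two (a c : ℕ) :
    discDesc ((ofFun fun _ => (0 : Fin 1) : disc S a ⟶ disc S 1) ≫ discInl S 1 1)
      ((ofFun fun _ => (0 : Fin 1) : disc S c ⟶ disc S 1) ≫ discInr S 1 1) = two S a c := by
  apply disc_add_hom_ext
  · rw [discInl_discDesc, inl_two]
    exact disc_hom_ext fun _ => rfl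
  · rw [discInr_discDesc, inr_two]
    exact disc_hom_ext fun _ => rfl

theorem tensor_spider (a b c d : ℕ) :
    ((spider S a b).tensor (spider S c d)).Equiv ⟨disc S 2, two S a c, two S b d⟩ := by
  refine (tensor_disc _ _ _ _).trans ⟨Iso.refl _, ?_, ?_⟩
  · exact (Category.comp_id _).trans (discDesc_eq_two a c)
  · exact (Category.comp_id _).trans (discDesc_eq_two b d)

theorem to_one_ext {n : ℕ} (f g : disc S n ⟶ disc S 1) : f = g :=
  disc_hom_ext fun _ => Subsingleton.elim (α := Fin 1) _ _

theorem id_equiv_spider : (Cospan.id S 1).Equiv (spider S 1 1) :=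
  ⟨Iso.refl _, to_one_ext _ _, to_one_ext _ _⟩

theorem comp_equiv_spider {a b c x y : ℕ} (p : disc S a ⟶ disc S (x + 1))
    (f : Fin b → Fin (x + 1)) (g : Fin b → Fin y) (q : disc S c ⟶ disc S y)
    (h : ∀ {K : Type} (s : Fin (x + 1) → K) (t : Fin y → K), (∀ i, s (f i) = t (g i)) →
      (∀ i, s i = s 0) ∧ ∀ j, t j = s 0) :
    (Cospan.comp ⟨disc S (x + 1), p, ofFun f⟩ ⟨disc S y, ofFun g, q⟩).Equiv (spider S a c) := by
  refine comp_equiv ⟨ofFun fun _ => (0 : Fin 1), ofFun fun _ => (0 : Fin 1), ?_, to_one_ext _ _,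
    to_one_ext _ _⟩
  refine isPushout_of_desc rfl ?_ ?_
  · intro K s t w
    have hs := h (K := K.V) s.onV t.onV fun i => congrFun (congrArg Hom.onV w) i
    refine ⟨ofFun fun _ => s.onV (0 : Fin (x + 1)), ?_, ?_⟩
    · exact disc_hom_ext fun i => (hs.1 i).symm
    · exact disc_hom_ext fun i => (hs.2 i).symm
  · intro K u u' h₁ _
    refine disc_hom_ext fun i => ?_
    have : i = 0 := Subsingleton.elim _ _
    subst this
    exact congrArg (fun r => Hom.onV r (0 : Fin (x + 1))) h₁

theorem symm_comp_spider : ((Cospan.symm S 1 1).comp (spider S 2 1)).Equiv (spider S 2 1) :=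
  (comp_congr (symm_equiv 1 1) (.refl _)).trans
    ((comp_equiv (isComp_preLeft (swap S 1 1) (spider S 2 1))).trans
      ⟨Iso.refl _, to_one_ext _ _, to_one_ext _ _⟩)

theorem spider_comp_symm : ((spider S 1 2).comp (Cospan.symm S 1 1)).Equiv (spider S 1 2) :=
  (comp_equiv (isComp_preRight (spider S 1 2) (swap S 1 1))).trans
    ⟨Iso.refl _, to_one_ext _ _, to_one_ext _ _⟩

theorem spider_comp_spider (a b c : ℕ) :
    ((spider S a (b + 1)).comp (spider S (b + 1) c)).Equiv (spider S a c) :=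
  comp_equiv_spider _ _ _ _ fun s t w =>
    ⟨fun i => congrArg s (Subsingleton.elim (α := Fin 1) i 0),
      fun j => (congrArg t (Subsingleton.elim (α := Fin 1) j 0)).trans (w 0).symm⟩

theorem two_comp_spider (a b c : ℕ) :
    (Cospan.comp ⟨disc S 2, two S a b, two S 1 1⟩ (spider S 2 c)).Equiv (spider S (a + b) c) := by
  refine comp_equiv_spider _ _ _ _ fun s t w => ?_
  have w₀ : s 0 = t 0 := w 0
  have w₁ : s 1 = t 0 := w 1
  exact ⟨Fin.forall_fin_two.2 ⟨rfl, w₁.trans w₀.symm⟩, fun j =>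
    (congrArg t (Subsingleton.elim (α := Fin 1) j 0)).trans w₀.symm⟩

theorem spider_comp_two (a b c : ℕ) :
    ((spider S c 2).comp ⟨disc S 2, two S 1 1, two S a b⟩).Equiv (spider S c (a + b)) := by
  refine comp_equiv_spider _ _ _ _ fun s t w => ?_
  have w₀ : s 0 = t 0 := w 0
  have w₁ : s 0 = t 1 := w 1
  exact ⟨fun i => congrArg s (Subsingleton.elim (α := Fin 1) i 0), Fin.forall_fin_two.2 ⟨w₀.symm, w₁.symm⟩⟩

theorem frobenius_left_equiv :
    (Cospan.comp ⟨disc S 2, two S 1 1, two S 2 1⟩ ⟨disc S 2, two S 1 2, two S 1 1⟩).Equiv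
      (spider S 2 2) := by
  refine comp_equiv_spider _ _ _ _ fun s t w => ?_
  have w₀ : s 0 = t 0 := w 0
  have w₁ : s 0 = t 1 := w 1
  have w₂ : s 1 = t 1 := w 2
  exact ⟨Fin.forall_fin_two.2 ⟨rfl, w₂.trans w₁.symm⟩, Fin.forall_fin_two.2 ⟨w₀.symm, w₁.symm⟩⟩

theorem frobenius_right_equiv :
    (Cospan.comp ⟨disc S 2, two S 1 1, two S 1 2⟩ ⟨disc S 2, two S 2 1, two S 1 1⟩).Equiv
      (spider S 2 2) := by
  refine comp_equiv_spider _ _ _ _ fun s t w => ?_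
  have w₀ : s 0 = t 0 := w 0
  have w₁ : s 1 = t 0 := w 1
  have w₂ : s 1 = t 1 := w 2
  exact ⟨Fin.forall_fin_two.2 ⟨rfl, w₁.trans w₀.symm⟩,
    Fin.forall_fin_two.2 ⟨w₀.symm, w₂.symm.trans (w₁.trans w₀.symm)⟩⟩

theorem frob_sound {n m : ℕ} {f g : Term FrobGen.{u} n m} (h : FrobEq f g) :
    f.eval (FTerm S) (fun {n m} _ => (spider S n m).cls) =
      g.eval (FTerm S) (fun {n m} _ => (spider S n m).cls) := by
  have hi : (Cospan.id S 1).Equiv (spider S 1 1) := id_equiv_spider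
  have hl : ∀ a b : ℕ, ((spider S a b).tensor (Cospan.id S 1)).Equiv
      ⟨disc S 2, two S a 1, two S b 1⟩ := fun a b =>
    (tensor_congr (.refl _) hi).trans (tensor_spider a b 1 1)
  have hr : ∀ a b : ℕ, ((Cospan.id S 1).tensor (spider S a b)).Equiv
      ⟨disc S 2, two S 1 a, two S 1 b⟩ := fun a b =>
    (tensor_congr hi (.refl _)).trans (tensor_spider 1 1 a b)
  cases h with
  | mul_comm => exact symm_comp_spider.cls_eq
  | mul_assoc =>
    exact (((comp_congr (hl 2 1) (.refl _)).trans (two_comp_spider 2 1 1)).trans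
      ((comp_congr (hr 2 1) (.refl _)).trans (two_comp_spider 1 2 1)).symm).cls_eq
  | unit_mul =>
    exact (((comp_congr (hl 0 1) (.refl _)).trans (two_comp_spider 0 1 1)).trans hi.symm).cls_eq
  | comul_comm => exact spider_comp_symm.cls_eq
  | comul_assoc =>
    exact (((comp_congr (.refl _) (hl 1 2)).trans (spider_comp_two 2 1 1)).trans
      ((comp_congr (.refl _) (hr 1 2)).trans (spider_comp_two 1 2 1)).symm).cls_eq
  | counit_comul =>
    exact (((comp_congr (.refl _) (hl 1 0)).trans (spider_comp_two 0 1 1)).trans hi.symm).cls_eq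
  | special => exact ((spider_comp_spider 1 1 1).trans hi.symm).cls_eq
  | frobenius_left =>
    exact (((comp_congr (hl 1 2) (hr 2 1)).trans frobenius_left_equiv).trans
      (spider_comp_spider 2 0 2).symm).cls_eq
  | frobenius_right =>
    exact (((comp_congr (hr 1 2) (hl 2 1)).trans frobenius_right_equiv).trans
      (spider_comp_spider 2 0 2).symm).cls_eq

end Spider

/-- The interpretation of the generators of `𝐒_S + Frob`: a generator of `S` is sent to the cospan
of a single hyperedge, and the four Frobenius generators `n ⟶ m` to `n ⟶ 1 ⟵ m`. -/
def interp {S : Signature.{u}} {n m : ℕ} (o : (synFrobSMT S).sig n m) : (FTerm S).Hom n m :=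
  o.elim (fun o => (genCospan o).cls) (fun _ => (spider S n m).cls)

/-- The canonical morphism of PROPs `Φ : 𝐒_S + Frob ⟶ FTerm S`. -/
def Phi (S : Signature.{u}) : PROPHom (synFrob S) (FTerm S) :=
  (synFrobSMT S).lift (FTerm S) interp <| by
    rintro n m f g (⟨s, t, h, _, _⟩ | ⟨s, t, h, rfl, rfl⟩)
    · exact h.elim
    · exact (Term.eval_map (FTerm S) (fun o => .inr o) interp s).trans
        ((frob_sound h).trans (Term.eval_map (FTerm S) (fun o => .inr o) interp t).symm)

/-! ## Rewriting in a PROP -/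

/-- A rewriting rule of type `i ⟶ j` in a PROP. -/
structure PROP.Rule (X : PROP.{v}) where
  i : ℕ
  j : ℕ
  lhs : X.Hom i j
  rhs : X.Hom i j

/-- A rewriting system on a PROP: a set of rewriting rules. -/
abbrev PROP.System (X : PROP.{v}) := Set X.Rule

/-- The rewriting step: `d = c₁ ; (id_k ⊕ l) ; c₂` and `e = c₁ ; (id_k ⊕ r) ; c₂` for some rule
`⟨l, r⟩` of the system. -/
def PROP.Step (X : PROP.{v}) (R : X.System) {n m : ℕ} (d e : X.Hom n m) : Prop :=
  ∃ ρ ∈ R, ∃ (k : ℕ) (c₁ : X.Hom n (k + ρ.i)) (c₂ : X.Hom (k + ρ.j) m),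
    d = X.comp (X.comp c₁ (X.tensor (X.id k) ρ.lhs)) c₂ ∧
    e = X.comp (X.comp c₁ (X.tensor (X.id k) ρ.rhs)) c₂

/-- The image of a rewriting system under a morphism of PROPs. -/
def PROPHom.mapSystem {X : PROP.{v}} {Y : PROP.{w}} (F : PROPHom X Y) (R : X.System) : Y.System :=
  (fun ρ => ⟨ρ.i, ρ.j, F.map ρ.lhs, F.map ρ.rhs⟩) '' R

/-- The caps `0 ⟶ n + n` generated by a cap `0 ⟶ 1 + 1`; the `i`-th wire of the first block is
connected to the `i`-th wire of the second one. -/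
def PROP.cap (X : PROP.{v}) (c : X.Hom 0 (1 + 1)) : ∀ n : ℕ, X.Hom 0 (n + n)
  | 0 => X.id 0
  | n + 1 =>
    X.comp (X.tensor (X.cap c n) c)
      (castHom X.Hom (by omega : n + ((n + 1) + 1) = (n + n) + (1 + 1))
        (by omega : n + ((1 + n) + 1) = (n + 1) + (n + 1))
        (X.tensor (X.id n) (X.tensor (X.symm n 1) (X.id 1))))

/-- The cap `unit ; comultiplication` of the chosen Frobenius structure on `𝐒_S + Frob`. -/
def frobCap (S : Signature.{u}) : (synFrob S).Hom 0 (1 + 1) :=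
  (synFrob S).comp ((synFrobSMT S).arr (.gen (.inr .unit)))
    ((synFrobSMT S).arr (.gen (.inr .comul)))

/-- Bending: `⌜d⌝ = cap_n ; (id_n ⊕ d) : 0 ⟶ n + m`, for `d : n ⟶ m`. -/
def bend {S : Signature.{u}} {n m : ℕ} (d : (synFrob S).Hom n m) : (synFrob S).Hom 0 (n + m) :=
  (synFrob S).comp ((synFrob S).cap (frobCap S) n) ((synFrob S).tensor ((synFrob S).id n) d)

/-- The ground rewriting system obtained by bending every rule. -/
def bendSystem {S : Signature.{u}} (R : (synFrob S).System) : (synFrob S).System :=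
  (fun ρ => ⟨0, ρ.i + ρ.j, bend ρ.lhs, bend ρ.rhs⟩) '' R

/-! ## Double pushout rewriting -/

/-- A DPO rule: a span `L ⟵ j ⟶ R` of typed hypergraphs, with `j` discrete. -/
structure DPORule (S : Signature.{u}) where
  j : ℕ
  L : Hyp S
  R : Hyp S
  left : Hyp.disc S j ⟶ L
  right : Hyp.disc S j ⟶ R

/-- The ground rule `⟨0 ⟶ L ⟵ j, 0 ⟶ R ⟵ j⟩` that corresponds to a DPO rule. -/
def DPORule.toRule {S : Signature.{u}} (ρ : DPORule S) : (FTerm S).Rule where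
  i := 0
  j := ρ.j
  lhs := (Cospan.mk ρ.L (Hyp.ofFun Fin.elim0) ρ.left).cls
  rhs := (Cospan.mk ρ.R (Hyp.ofFun Fin.elim0) ρ.right).cls

/-- The DPO system that corresponds to a ground rewriting system on `FTerm S`. -/
def dpoSystem {S : Signature.{u}} (R : (FTerm S).System) : Set (DPORule S) :=
  {ρ | ρ.toRule ∈ R}

/-- The DPO rewriting step with interface `m`, for arrows `d = (0 ⟶ G ⟵ m)` and
`e = (0 ⟶ H ⟵ m)`: for a rule `L ⟵ j ⟶ R` and a cospan `j ⟶ C ⟵ m` there are pushout squares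
of `L ⟵ j ⟶ C` with vertex `G` and of `R ⟵ j ⟶ C` with vertex `H`, compatible with the
interface. -/
def DPOStep {S : Signature.{u}} (R : Set (DPORule S)) {m : ℕ} (d e : (FTerm S).Hom 0 m) : Prop :=
  ∃ G H : Cospan S 0 m, G.cls = d ∧ H.cls = e ∧
    ∃ ρ ∈ R, ∃ (C : Cospan S ρ.j m) (f : ρ.L ⟶ G.apex) (f' : ρ.R ⟶ H.apex)
      (g : C.apex ⟶ G.apex) (h : C.apex ⟶ H.apex),
      IsPushout ρ.left C.left f g ∧ IsPushout ρ.right C.left f' h ∧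
        C.right ≫ g = G.right ∧ C.right ≫ h = H.right

end StringRewriting

/-! Two facts carry the isomorphism: arrows of `𝐒_S + Frob` have normal forms that are hypergraphs
in disguise, and the normal form depends only on the isomorphism class of the hypergraph.

A commutative monoid on the object `1` turns every function `w : Fin n → Fin k` into an arrow `up w
: n ⟶ k`, functorially; dually a cocommutative comonoid gives `dn w : k ⟶ n`. The Frobenius law lets
copying and merging pass each other (`dn_idAppend_up`), and the special law removes the loop that
arises when two copies of one strand are multiplied. A generator `o : a ⟶ b` is bent into a state `0
⟶ a + b`, and a hyperedge on `k` nodes acts on `k` strands by merging the wires of that state with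
the strands of its sources and targets. A hypergraph with nodes `Fin k`, hyperedges `es` and legs
`l`, `r` then gives the arrow `normalForm l es r`, namely `up l`, followed by the actions of the
hyperedges, followed by `dn r`.

Every arrow has this form, because normal forms are stable under composition with each generator
placed beside identity strands: comultiplication, counit and symmetries only change `r`; the unit
adds a node; the multiplication fuses two nodes or does nothing (`exists_dn_mu`); a generator of `S`
adds a hyperedge and fresh target nodes (`dn_idAppend_comp`). By `Phi_normalForm`, `Φ` sends a
normal form to the cospan it was read off from. Since every cospan can be enumerated, `Φ` is
surjective on arrows. Isomorphic cospans differ by a bijection of nodes, absorbed by `up σ ⨾ dn σ =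
id`, and a reordering of hyperedges, harmless because actions of states commute (`act_comm`); so `Φ`
is injective.

For rewriting, bending merely moves the left leg of a cospan to the right. The composite `c₁ ; (id_k
⊕ l) ; c₂` is the pushout of `l` with the context obtained by gluing `c₁` and `c₂` along `k`
(`isComp_of_context`). This context does not mention `l`, so it serves for both sides of a rule and
is the object `C` of a double pushout. Conversely, any `C` with interfaces `i + j` and `n + m`
splits into such `c₁` and `c₂` with `k = n + i`; fullness and faithfulness of `Φ` bring the
decomposition back to `𝐒_S + Frob`. -/

namespace StringRewriting

/-! ## Categories on `ℕ` with an extra strand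

The arrows of a PROP, with the functor `- ⊕ id₁` and the swap of the last two strands as the only
remaining monoidal structure. All equations between objects are definitional here. -/

/-- A category with objects the natural numbers, an endofunctor `pad = - ⊕ id₁` and the swap of the
last two strands. -/
structure PadCat where
  Hom : ℕ → ℕ → Type v
  id : ∀ n, Hom n n
  comp : ∀ {a b c}, Hom a b → Hom b c → Hom a c
  pad : ∀ {a b}, Hom a b → Hom (a + 1) (b + 1)
  sw : ∀ n, Hom (n + 1 + 1) (n + 1 + 1)
  id_comp : ∀ {a b} (f : Hom a b), comp (id a) f = f
  comp_id : ∀ {a b} (f : Hom a b), comp f (id b) = f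
  assoc : ∀ {a b c d} (f : Hom a b) (g : Hom b c) (h : Hom c d),
    comp (comp f g) h = comp f (comp g h)
  pad_id : ∀ n, pad (id n) = id (n + 1)
  pad_comp : ∀ {a b c} (f : Hom a b) (g : Hom b c), pad (comp f g) = comp (pad f) (pad g)
  sw_nat : ∀ {a b} (f : Hom a b), comp (pad (pad f)) (sw b) = comp (sw a) (pad (pad f))
  sw_sw : ∀ n, comp (sw n) (sw n) = id (n + 1 + 1)
  braid : ∀ n, comp (sw (n + 1)) (comp (pad (sw n)) (sw (n + 1))) =
    comp (pad (sw n)) (comp (sw (n + 1)) (pad (sw n)))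

namespace PadCat

/-- The opposite category. -/
def op (B : PadCat.{v}) : PadCat.{v} where
  Hom a b := B.Hom b a
  id := B.id
  comp f g := B.comp g f
  pad := B.pad
  sw := B.sw
  id_comp := B.comp_id
  comp_id := B.id_comp
  assoc f g h := (B.assoc h g f).symm
  pad_id := B.pad_id
  pad_comp f g := B.pad_comp g f
  sw_nat f := (B.sw_nat f).symm
  sw_sw := B.sw_sw
  braid n := (B.assoc _ _ _).trans ((B.braid n).trans (B.assoc _ _ _).symm)

local infixr:80 "⨾" => PadCat.comp _

variable {B : PadCat.{v}}

/-- Composites are kept bracketed to the right, so an equation between short composites can act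
inside a longer one only in a form that carries a tail `z`. -/
theorem re {a b c d : ℕ} {f : B.Hom a b} {g : B.Hom b c} {k : B.Hom a c} (h : f ⨾ g = k)
    (z : B.Hom c d) : f ⨾ g ⨾ z = k ⨾ z := by rw [← B.assoc, h]

theorem re₃ {a b c d e : ℕ} {f : B.Hom a b} {g : B.Hom b c} {g' : B.Hom c d} {k : B.Hom a d}
    (h : f ⨾ g ⨾ g' = k) (z : B.Hom d e) : f ⨾ g ⨾ g' ⨾ z = k ⨾ z := by
  rw [← h, B.assoc, B.assoc]

theorem pad_eq {a b c : ℕ} {f : B.Hom a b} {g : B.Hom b c} {k : B.Hom a c} (h : f ⨾ g = k) :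
    B.pad f ⨾ B.pad g = B.pad k := by rw [← B.pad_comp, h]

end PadCat

/-! ### Functions between finite ordinals as arrows, for a commutative monoid -/

/-- A commutative monoid on the strand `1`: the multiplication and the unit on the last strands. -/
structure PadMonoid (B : PadCat.{v}) where
  mu : ∀ n, B.Hom (n + 1 + 1) (n + 1)
  et : ∀ n, B.Hom n (n + 1)
  mu_nat : ∀ {a b} (f : B.Hom a b), B.comp (B.pad (B.pad f)) (mu b) = B.comp (mu a) (B.pad f)
  et_nat : ∀ {a b} (f : B.Hom a b), B.comp f (et b) = B.comp (et a) (B.pad f)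
  sw_mu : ∀ n, B.comp (B.sw n) (mu n) = mu n
  mu_assoc : ∀ n, B.comp (B.pad (mu n)) (mu n) = B.comp (mu (n + 1)) (mu n)
  pad_et_mu : ∀ n, B.comp (B.pad (et n)) (mu n) = B.id (n + 1)
  et_sw : ∀ n, B.comp (et (n + 1)) (B.sw n) = B.pad (et n)
  mu_sw : ∀ n, B.comp (mu (n + 1)) (B.sw n) =
    B.comp (B.pad (B.sw n)) (B.comp (B.sw (n + 1)) (B.pad (mu n)))

namespace PadMonoid

open PadCat

local infixr:80 "⨾" => PadCat.comp _

variable {B : PadCat.{v}} (M : PadMonoid B)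

theorem et_mu (n : ℕ) : M.et (n + 1) ⨾ M.mu n = B.id (n + 1) := by
  rw [← M.sw_mu, re (M.et_sw n), M.pad_et_mu]

theorem pad_et_sw (n : ℕ) : B.pad (M.et n) ⨾ B.sw n = M.et (n + 1) := by
  rw [← M.et_sw, B.assoc, B.sw_sw, B.comp_id]

/-- This is `mu_sw` solved for the multiplication, using that swaps are involutions. -/
theorem pad_sw_mu (n : ℕ) :
    B.pad (B.sw n) ⨾ M.mu (n + 1) = B.sw (n + 1) ⨾ B.pad (M.mu n) ⨾ B.sw n := by
  have h : M.mu (n + 1) =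
      B.pad (B.sw n) ⨾ B.sw (n + 1) ⨾ B.pad (M.mu n) ⨾ B.sw n := by
    rw [re₃ (M.mu_sw n).symm, B.assoc, B.sw_sw, B.comp_id]
  rw [h, re (pad_eq (B.sw_sw n)), B.pad_id, B.id_comp]

/-- The merging of the last of `k + 1` strands with the strand `v`. -/
def ins : ∀ {k : ℕ}, Fin k → B.Hom (k + 1) k
  | 0 => fun v => v.elim0
  | k + 1 => Fin.lastCases (M.mu k) fun v => B.sw k ⨾ B.pad (ins v)

@[simp] theorem ins_last (k : ℕ) : M.ins (Fin.last k) = M.mu k := by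
  simp [ins]

@[simp] theorem ins_castSucc {k : ℕ} (v : Fin k) :
    M.ins v.castSucc = B.sw k ⨾ B.pad (M.ins v) := by
  simp [ins]

/-- Two merges into the last strand commute by associativity and commutativity, and a merge into the
last strand commutes with one into an earlier strand by naturality. If both targets are earlier
strands, the merges slide through the swaps and the braid relation rearranges the three strands
involved. -/
theorem ins_comm {k : ℕ} (u v : Fin k) :
    B.pad (M.ins u) ⨾ M.ins v = B.sw k ⨾ B.pad (M.ins v) ⨾ M.ins u := by
  induction k with
  | zero => exact u.elim0
  | succ j ih =>
    -- The case of an earlier strand and the last one; composing with the involution `sw` gives the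
    -- case with the roles exchanged.
    have key : ∀ u : Fin j, B.pad (M.ins u.castSucc) ⨾ M.ins (Fin.last j) =
        B.sw (j + 1) ⨾ B.pad (M.ins (Fin.last j)) ⨾ M.ins u.castSucc := fun u => by
      rw [ins_castSucc, ins_last, B.pad_comp, B.assoc, M.mu_nat, re (M.pad_sw_mu j), B.assoc,
        B.assoc]
    induction u using Fin.lastCases with
    | last =>
      induction v using Fin.lastCases with
      | last => rw [ins_last, M.mu_assoc, re (M.sw_mu _)]
      | cast v => rw [key, re (B.sw_sw _), B.id_comp]
    | cast u =>
      induction v using Fin.lastCases with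
      | last => exact key u
      | cast v =>
        simp only [ins_castSucc, B.pad_comp, B.assoc]
        rw [re (B.sw_nat (M.ins u)), re (B.sw_nat (M.ins v)), B.assoc, B.assoc, pad_eq (ih u v),
          B.pad_comp, B.pad_comp, re₃ (B.braid j), B.assoc, B.assoc]

/-- Associativity of the multiplication, transported to an arbitrary strand. -/
theorem mu_ins {k : ℕ} (v : Fin k) : M.mu k ⨾ M.ins v = B.pad (M.ins v) ⨾ M.ins v := by
  induction k with
  | zero => exact v.elim0
  | succ j ih =>
    induction v using Fin.lastCases with
    | last => rw [ins_last, M.mu_assoc]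
    | cast v =>
      rw [ins_castSucc, re (M.mu_sw j), B.assoc, B.assoc, pad_eq (ih v), B.pad_comp, B.pad_comp,
        B.assoc, re (B.sw_nat (M.ins v)), B.assoc]

theorem et_ins {k : ℕ} (v : Fin k) : M.et k ⨾ M.ins v = B.id k := by
  induction k with
  | zero => exact v.elim0
  | succ j ih =>
    induction v using Fin.lastCases with
    | last => rw [ins_last, M.et_mu]
    | cast v => rw [ins_castSucc, re (M.et_sw j), pad_eq (ih v), B.pad_id]

/-- The arrow `0 ⟶ k` consisting of units. -/
def units : ∀ k : ℕ, B.Hom 0 k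
  | 0 => B.id 0
  | k + 1 => units k ⨾ M.et k

/-- The arrow `n ⟶ k` of a function `Fin n → Fin k`. -/
def up : ∀ {n k : ℕ}, (Fin n → Fin k) → B.Hom n k
  | 0, k => fun _ => M.units k
  | n + 1, _ => fun w => B.pad (up fun i : Fin n => w i.castSucc) ⨾ M.ins (w (Fin.last n))

theorem up_succ {n k : ℕ} (w : Fin (n + 1) → Fin k) :
    M.up w = B.pad (M.up fun i : Fin n => w i.castSucc) ⨾ M.ins (w (Fin.last n)) := rfl

/-- The extension of a function by a value at the last place. -/
abbrev snoc {n k : ℕ} (w : Fin n → Fin k) (v : Fin k) : Fin (n + 1) → Fin k :=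
  Fin.snoc (α := fun _ => Fin k) w v

theorem up_snoc {n k : ℕ} (w : Fin n → Fin k) (v : Fin k) :
    M.up (snoc w v) = B.pad (M.up w) ⨾ M.ins v := by
  rw [up_succ]; simp [snoc]

/-- The heart of functoriality of `up`. If `a` is the last strand, two successive merges into one
strand are collected by `mu_ins`; otherwise the new merge has to overtake the merge of the last
strand, which is `ins_comm`. -/
theorem ins_up {k l : ℕ} (a : Fin k) (v : Fin k → Fin l) :
    M.ins a ⨾ M.up v = B.pad (M.up v) ⨾ M.ins (v a) := by
  induction k with
  | zero => exact a.elim0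
  | succ j ih =>
    rw [up_succ]
    induction a using Fin.lastCases with
    | last =>
      rw [ins_last, re (M.mu_nat _).symm, B.assoc, M.mu_ins, B.pad_comp, B.assoc]
    | cast a =>
      rw [ins_castSucc, B.assoc, re (pad_eq (ih a _)), B.pad_comp, B.assoc, re (B.sw_nat _).symm,
        B.assoc, B.pad_comp, B.assoc, ins_comm, re (B.sw_sw _), B.id_comp]

theorem units_up {k l : ℕ} (v : Fin k → Fin l) : M.units k ⨾ M.up v = M.units l := by
  induction k with
  | zero => exact B.id_comp _
  | succ j ih =>
    rw [units, up_succ, B.assoc, re (M.et_nat _).symm, B.assoc, M.et_ins, B.comp_id, ih]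

theorem up_comp {n k l : ℕ} (w : Fin n → Fin k) (v : Fin k → Fin l) :
    M.up w ⨾ M.up v = M.up (fun i => v (w i)) := by
  induction n with
  | zero => exact M.units_up v
  | succ n ih =>
    rw [up_succ, up_succ, B.assoc, ins_up, re (pad_eq (ih _))]

/-- A strand outside the image of a function is created by the unit. -/
theorem up_castSucc {n k : ℕ} (w : Fin n → Fin k) :
    M.up (fun i => (w i).castSucc) = M.up w ⨾ M.et k := by
  induction n with
  | zero => rfl
  | succ n ih =>
    rw [up_succ, up_succ, ih, ins_castSucc, B.pad_comp, B.assoc, re (M.pad_et_sw k), B.assoc,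
      M.et_nat]

theorem up_id (n : ℕ) : M.up (fun i : Fin n => i) = B.id n := by
  induction n with
  | zero => rfl
  | succ n ih =>
    rw [up_succ, up_castSucc, ih, B.id_comp, ins_last, M.pad_et_mu]

/-- The function `w ⊕ id₁`. -/
abbrev padFun {n k : ℕ} (w : Fin n → Fin k) : Fin (n + 1) → Fin (k + 1) :=
  snoc (fun i => (w i).castSucc) (Fin.last k)

theorem up_padFun {n k : ℕ} (w : Fin n → Fin k) : M.up (padFun w) = B.pad (M.up w) := by
  rw [up_snoc, up_castSucc, B.pad_comp, ins_last, B.assoc, M.pad_et_mu, B.comp_id]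

theorem up_snoc_id {k : ℕ} (v : Fin k) : M.up (snoc (fun i => i) v) = M.ins v := by
  rw [up_snoc, up_id, B.pad_id, B.id_comp]

theorem et_eq_up (n : ℕ) : M.et n = M.up Fin.castSucc := by
  have := M.up_castSucc (fun i : Fin n => i)
  rw [up_id, B.id_comp] at this
  exact this.symm

/-- The function that interchanges the last two places. -/
abbrev swFun (n : ℕ) : Fin (n + 1 + 1) → Fin (n + 1 + 1) :=
  snoc (snoc (fun i => i.castSucc.castSucc) (Fin.last _)) (Fin.last n).castSucc

/-- Unfolded, the right-hand side creates two unit strands and merges the interchanged pair into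
them; the units cancel. Read in `B` and in its opposite, this places the swap in the image of both
`up` and `dn`. -/
theorem sw_eq_up (n : ℕ) : B.sw n = M.up (swFun n) := by
  rw [up_snoc, up_snoc, M.up_castSucc (fun i : Fin n => i.castSucc),
    M.up_castSucc (fun i : Fin n => i), up_id, B.id_comp, ins_last, ins_castSucc, ins_last,
    B.pad_comp, B.pad_comp, B.assoc, B.pad_comp, B.assoc, re (pad_eq (M.pad_et_mu (n + 1))),
    B.pad_id, B.id_comp, re (B.sw_nat _), B.assoc, pad_eq (M.pad_et_mu n), B.pad_id, B.comp_id]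

end PadMonoid

/-! ### Interaction of merging and copying -/

/-- A special commutative Frobenius monoid on the strand `1`. -/
structure PadFrob (B : PadCat.{v}) where
  M : PadMonoid B
  W : PadMonoid B.op
  frob_left : ∀ n, B.comp (B.pad (W.mu n)) (M.mu (n + 1)) = B.comp (M.mu n) (W.mu n)
  frob_right : ∀ n, B.comp (W.mu (n + 1)) (B.pad (M.mu n)) = B.comp (M.mu n) (W.mu n)
  special : ∀ n, B.comp (W.mu n) (M.mu n) = B.id (n + 1)

namespace PadFrob

open PadCat PadMonoid

local infixr:80 "⨾" => PadCat.comp _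

variable {B : PadCat.{v}} (F : PadFrob B)

/-- The comultiplication on the last strand. -/
def de (n : ℕ) : B.Hom (n + 1) (n + 1 + 1) := F.W.mu n

/-- The copying of the strand `v` to a new last strand. -/
def cop {k : ℕ} (v : Fin k) : B.Hom k (k + 1) := F.W.ins v

/-- The arrow `n ⟶ k` of a function `Fin n → Fin k`. -/
def up {n k : ℕ} (w : Fin n → Fin k) : B.Hom n k := F.M.up w

/-- The arrow `k ⟶ n` of a function `Fin n → Fin k`. -/
def dn {n k : ℕ} (w : Fin n → Fin k) : B.Hom k n := F.W.up w

theorem up_comp {n k l : ℕ} (w : Fin n → Fin k) (v : Fin k → Fin l) :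
    F.up w ⨾ F.up v = F.up (fun i => v (w i)) := F.M.up_comp w v

theorem dn_comp {n k l : ℕ} (w : Fin n → Fin k) (v : Fin k → Fin l) :
    F.dn v ⨾ F.dn w = F.dn (fun i => v (w i)) := F.W.up_comp w v

theorem up_id (n : ℕ) : F.up (fun i : Fin n => i) = B.id n := F.M.up_id n

theorem dn_id (n : ℕ) : F.dn (fun i : Fin n => i) = B.id n := F.W.up_id n

theorem up_padFun {n k : ℕ} (w : Fin n → Fin k) : F.up (padFun w) = B.pad (F.up w) :=
  F.M.up_padFun w

theorem dn_padFun {n k : ℕ} (w : Fin n → Fin k) : F.dn (padFun w) = B.pad (F.dn w) :=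
  F.W.up_padFun w

theorem dn_snoc {n k : ℕ} (w : Fin n → Fin k) (v : Fin k) :
    F.dn (snoc w v) = F.cop v ⨾ B.pad (F.dn w) := F.W.up_snoc w v

theorem up_swFun (n : ℕ) : F.up (swFun n) = B.sw n := (F.M.sw_eq_up n).symm

theorem dn_swFun (n : ℕ) : F.dn (swFun n) = B.sw n := (F.W.sw_eq_up n).symm

theorem cop_last (k : ℕ) : F.cop (Fin.last k) = F.de k := F.W.ins_last k

theorem cop_castSucc {k : ℕ} (v : Fin k) :
    F.cop v.castSucc = B.pad (F.cop v) ⨾ B.sw k := F.W.ins_castSucc v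

theorem cop_de {k : ℕ} (v : Fin k) : F.cop v ⨾ F.de k = F.cop v ⨾ B.pad (F.cop v) :=
  F.W.mu_ins v

theorem de_nat {a b : ℕ} (f : B.Hom a b) :
    F.de a ⨾ B.pad (B.pad f) = B.pad f ⨾ F.de b := F.W.mu_nat f

theorem de_sw (n : ℕ) : F.de n ⨾ B.sw n = F.de n := F.W.sw_mu n

theorem sw_de (n : ℕ) : B.sw n ⨾ F.de (n + 1) =
    B.pad (F.de n) ⨾ B.sw (n + 1) ⨾ B.pad (B.sw n) :=
  (F.W.mu_sw n).trans (B.assoc _ _ _)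

theorem de_pad_sw (n : ℕ) : F.de (n + 1) ⨾ B.pad (B.sw n) =
    B.sw n ⨾ B.pad (F.de n) ⨾ B.sw (n + 1) := by
  rw [← B.id_comp (F.de (n + 1)), ← B.sw_sw, B.assoc, B.assoc, re (F.sw_de n), B.assoc, B.assoc,
    pad_eq (B.sw_sw n), B.pad_id, B.comp_id]

theorem frob_left' (n : ℕ) : B.pad (F.de n) ⨾ F.M.mu (n + 1) = F.M.mu n ⨾ F.de n :=
  F.frob_left n

theorem frob_right' (n : ℕ) : F.de (n + 1) ⨾ B.pad (F.M.mu n) = F.M.mu n ⨾ F.de n :=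
  F.frob_right n

theorem de_mu (n : ℕ) : F.de n ⨾ F.M.mu n = B.id (n + 1) := F.special n

/-- The Frobenius law transported to the strand `u`: the copy of `u` is multiplied with the last
strand. The base of the induction is `frob_left`. -/
theorem pad_cop_mu {k : ℕ} (u : Fin k) :
    B.pad (F.cop u) ⨾ F.M.mu k = F.M.ins u ⨾ F.cop u := by
  induction k with
  | zero => exact u.elim0
  | succ j ih =>
    induction u using Fin.lastCases with
    | last => rw [cop_last, ins_last]; exact F.frob_left' j
    | cast u =>
      rw [cop_castSucc, ins_castSucc, B.pad_comp, B.assoc, F.M.pad_sw_mu, re (B.sw_nat _),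
        B.assoc, re (pad_eq (ih u)), B.pad_comp, B.assoc, B.assoc]

/-- For `u ≠ w` the copied strand and the target of the merge do not meet, so naturality suffices;
for `u = w` this is a Frobenius law. -/
theorem pad_cop_sw_ins {k : ℕ} (u w : Fin k) :
    B.pad (F.cop u) ⨾ B.sw k ⨾ B.pad (F.M.ins w) = F.M.ins w ⨾ F.cop u := by
  induction k with
  | zero => exact u.elim0
  | succ j ih =>
    induction u using Fin.lastCases with
    | last =>
      induction w using Fin.lastCases with
      | last =>
        -- Cocommutativity supplies the missing swap, after which `mu_sw` can be read from right to
        -- left.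
        have h : B.pad (F.de j) = B.pad (F.de j) ⨾ B.pad (B.sw j) := (pad_eq (F.de_sw j)).symm
        rw [cop_last, ins_last, h, B.assoc, ← F.M.mu_sw, ← B.assoc,
          F.frob_left', B.assoc,
          de_sw]
      | cast w =>
        rw [cop_last, ins_castSucc, B.pad_comp, re₃ (F.sw_de j).symm, B.assoc, B.assoc, de_nat]
    | cast u =>
      induction w using Fin.lastCases with
      | last =>
        rw [cop_castSucc, ins_last, B.pad_comp, B.assoc, ← F.M.mu_sw, re (F.M.mu_nat _), B.assoc]
      | cast w =>
        rw [cop_castSucc, ins_castSucc, B.pad_comp, B.pad_comp, B.assoc, B.assoc,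
          re (pad_eq (ih u w).symm), B.pad_comp, B.pad_comp, B.assoc, B.assoc, B.sw_nat,
          re (B.sw_nat (F.cop u)).symm, B.assoc, re₃ (B.braid j).symm, B.assoc, B.assoc]

/-- The other Frobenius law on the strand `u`: the last strand is copied, one copy is merged into
`u` and the other survives. -/
theorem de_pad_ins {k : ℕ} (u : Fin k) :
    F.de k ⨾ B.pad (F.M.ins u) = F.M.ins u ⨾ F.cop u := by
  induction k with
  | zero => exact u.elim0
  | succ j ih =>
    induction u using Fin.lastCases with
    | last => rw [cop_last, ins_last]; exact F.frob_right' j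
    | cast u =>
      rw [cop_castSucc, ins_castSucc, B.pad_comp, B.assoc, re (pad_eq (ih u).symm), B.pad_comp,
        B.assoc, B.sw_nat, re (F.de_pad_sw j), B.assoc, B.assoc]

/-- Copying before or after merging along `f`. -/
theorem cop_pad_up {n k : ℕ} (f : Fin n → Fin k) (v : Fin n) :
    F.cop v ⨾ B.pad (F.up f) = F.up f ⨾ F.cop (f v) := by
  induction n with
  | zero => exact v.elim0
  | succ n ih =>
    have hf : F.up f = B.pad (F.up fun i : Fin n => f i.castSucc) ⨾ F.M.ins (f (Fin.last n)) := rfl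
    rw [hf, B.pad_comp, B.assoc]
    induction v using Fin.lastCases with
    | last => rw [cop_last, re (F.de_nat _), B.assoc, de_pad_ins]
    | cast v =>
      rw [cop_castSucc, B.assoc, re (B.sw_nat _).symm, B.assoc, re (pad_eq (ih _ v)), B.pad_comp,
        B.assoc, pad_cop_sw_ins]

/-- The function `[id, x] : n + a ⟶ n`. -/
abbrev idAppend {n a : ℕ} (x : Fin a → Fin n) : Fin (n + a) → Fin n := Fin.append (fun i => i) x

/-- The function `f ⊕ id_a`. -/
def addFun {n k : ℕ} (f : Fin n → Fin k) (a : ℕ) : Fin (n + a) → Fin (k + a) :=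
  Fin.append (fun i => Fin.castAdd a (f i)) (Fin.natAdd k)

theorem append_succ {n a k : ℕ} (f : Fin n → Fin k) (x : Fin (a + 1) → Fin k) :
    (Fin.append f x : Fin (n + (a + 1)) → Fin k) =
      snoc (Fin.append f fun i => x i.castSucc) (x (Fin.last a)) := by
  funext i
  induction i using Fin.addCases with
  | left i => 
    rw [Fin.append_left]
    have : Fin.castAdd (a + 1) i = (Fin.castAdd a i).castSucc := rfl
    rw [this, snoc, Fin.snoc_castSucc, Fin.append_left]
  | right i => 
    rw [Fin.append_right]
    induction i using Fin.lastCases with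
    | last =>
      have : Fin.natAdd n (Fin.last a) = Fin.last (n + a) := rfl
      rw [this, snoc, Fin.snoc_last]
    | cast i =>
      have : Fin.natAdd n i.castSucc = (Fin.natAdd n i).castSucc := rfl
      rw [this, snoc, Fin.snoc_castSucc, Fin.append_right]

theorem addFun_succ {n k : ℕ} (f : Fin n → Fin k) (a : ℕ) :
    addFun f (a + 1) = padFun (addFun f a) := by
  rw [addFun, append_succ]
  refine congrArg₂ snoc ?_ rfl
  funext i
  induction i using Fin.addCases with
  | left i => rw [Fin.append_left, addFun, Fin.append_left]; rfl
  | right i => rw [Fin.append_right, addFun, Fin.append_right]; rfl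

/-- A Beck–Chevalley property: `[id, x]` and `f ⊕ id_a` out of `n + a` have as pushout `k`, with
legs `f` and `[id, f ∘ x]`. Each of the `a` copies is handled by one use of `cop_pad_up`. -/
theorem dn_idAppend_up {n k a : ℕ} (f : Fin n → Fin k) (x : Fin a → Fin n) :
    F.dn (idAppend x) ⨾ F.up (addFun f a) = F.up f ⨾ F.dn (idAppend fun i => f (x i)) := by
  induction a with
  | zero =>
    have h₁ : idAppend x = fun i => i := funext fun i => Fin.append_left _ _ i
    have h₂ : (idAppend fun i => f (x i)) = fun i => i := funext fun i => Fin.append_left _ _ i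
    have h₃ : addFun f 0 = f := funext fun i => Fin.append_left _ _ i
    rw [h₁, h₂, h₃]
    exact (congrArg (fun t => t ⨾ F.up f) (F.dn_id n)).trans ((B.id_comp _).trans
      ((B.comp_id _).symm.trans (congrArg (fun t => F.up f ⨾ t) (F.dn_id k).symm)))
  | succ a ih =>
    rw [idAppend, idAppend, append_succ, append_succ, dn_snoc, dn_snoc, addFun_succ, up_padFun,
      B.assoc, pad_eq (ih _), B.pad_comp, re (F.cop_pad_up f _), B.assoc]

/-- Permutations are sent to invertible arrows. -/
theorem up_perm (n : ℕ) (σ : Equiv.Perm (Fin n)) : F.up σ = F.dn σ.symm := by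
  -- Adjacent transpositions generate the symmetric group and are their own inverses, so `up` and
  -- `dn` need only agree on them. Each is a swap of the last two places with further strands padded
  -- on, and both constructions send it to a padded `sw`.
  have key : ∀ (n : ℕ) (i : Fin n), F.up (Equiv.swap i.castSucc i.succ) =
      F.dn (Equiv.swap i.castSucc i.succ) := by
    intro n
    induction n with
    | zero => exact fun i => i.elim0
    | succ n ih =>
      intro i
      induction i using Fin.lastCases with
      | last =>
        have h : (Equiv.swap (Fin.last n).castSucc (Fin.last n).succ :
            Fin (n + 1 + 1) → Fin (n + 1 + 1)) = swFun n := by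
          funext i
          induction i using Fin.lastCases with
          | last => simp [swFun, snoc, Fin.succ_last]
          | cast i =>
            induction i using Fin.lastCases with
            | last => simp [swFun, snoc]
            | cast i =>
              rw [Equiv.swap_apply_of_ne_of_ne]
              · simp [swFun, snoc]
              · simp [Fin.ext_iff]; omega
              · simp [Fin.ext_iff]; omega
        rw [h, up_swFun, dn_swFun]
      | cast i =>
        have h : (Equiv.swap i.castSucc.castSucc i.castSucc.succ :
            Fin (n + 1 + 1) → Fin (n + 1 + 1)) = padFun (Equiv.swap i.castSucc i.succ) := by
          funext j
          induction j using Fin.lastCases with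
          | last => 
            rw [Equiv.swap_apply_of_ne_of_ne]
            · simp [padFun, snoc]
            · simp [Fin.ext_iff]; omega
            · simp [Fin.ext_iff]; omega
          | cast j => 
            simp only [padFun, snoc, Fin.snoc_castSucc, Equiv.swap_apply_def, Fin.ext_iff]
            simp only [Fin.val_castSucc, Fin.val_succ]
            split_ifs <;> rfl
        rw [h, up_padFun, dn_padFun, ih]
  cases n with
  | zero => 
    have h₁ : (σ : Fin 0 → Fin 0) = fun i => i := funext fun i => i.elim0
    have h₂ : (σ.symm : Fin 0 → Fin 0) = fun i => i := funext fun i => i.elim0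
    rw [h₁, h₂, up_id, dn_id]
  | succ n =>
    have h := Equiv.Perm.mclosure_swap_castSucc_succ n
    have hσ : σ ∈ Submonoid.closure (Set.range fun i : Fin n ↦ Equiv.swap i.castSucc i.succ) := by
      rw [h]; trivial
    induction hσ using Submonoid.closure_induction with
    | mem x hx =>
      obtain ⟨i, rfl⟩ := hx
      rw [Equiv.symm_swap]
      exact key n i
    | one => 
      exact (F.up_id (n + 1)).trans (F.dn_id (n + 1)).symm
    | mul x y _ _ hx hy =>
      -- The product `x * y` applies `y` first, which in diagrammatic order puts `y` on the left.
      exact (F.up_comp y x).symm.trans ((congrArg₂ (fun s t => s ⨾ t) hy hx).trans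
        (F.dn_comp x.symm y.symm))

theorem up_equiv {n k : ℕ} (σ : Fin n ≃ Fin k) : F.up σ = F.dn σ.symm := by
  obtain rfl : n = k := by simpa using Fintype.card_congr σ
  exact F.up_perm n σ

theorem up_dn_equiv {n k : ℕ} (σ : Fin n ≃ Fin k) : F.up σ ⨾ F.dn σ = B.id n := by
  rw [show F.dn σ = F.up σ.symm from (F.up_equiv σ.symm).symm, up_comp]
  simp [up_id]

/-- The multiplication after a copying arrow is a merging arrow followed by a copying arrow. -/
theorem exists_dn_mu {m k : ℕ} (r : Fin (m + 1 + 1) → Fin k) :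
    ∃ (k' : ℕ) (c : Fin k → Fin k') (r' : Fin (m + 1) → Fin k'),
      F.dn r ⨾ F.M.mu m = F.up c ⨾ F.dn r' := by
  -- The outputs other than the last two do not take part: naturality of the multiplication moves
  -- them behind it.
  have key : ∀ {k : ℕ} (r : Fin m → Fin k) (u v : Fin k),
      F.dn (snoc (snoc r u) v) ⨾ F.M.mu m =
        F.cop v ⨾ B.pad (F.cop u) ⨾ F.M.mu k ⨾ B.pad (F.dn r) := fun r u v => by
    rw [dn_snoc, dn_snoc, B.pad_comp, B.assoc, B.assoc, F.M.mu_nat]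
  -- Two different strands, one of them last. By the Frobenius laws, multiplying their copies
  -- amounts to merging the last strand into `u` and reading all outputs off the result.
  have key' : ∀ {k : ℕ} (r : Fin m → Fin (k + 1)) (u : Fin k),
      F.dn (snoc (snoc r u.castSucc) (Fin.last k)) ⨾ F.M.mu m =
        F.up (snoc (fun i => i) u) ⨾
          F.dn (snoc (fun i => snoc (fun i => i) u (r i)) u) := by
    intro k r u
    have hd : F.dn (snoc (fun i => i) u) = F.cop u := F.W.up_snoc_id u
    have hu : F.up (snoc (fun i => i) u) = F.M.ins u := F.M.up_snoc_id u
    rw [key, hu, dn_snoc, ← F.dn_comp r (snoc (fun i => i) u), hd, B.pad_comp, re (F.cop_de u).symm,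
      cop_last, cop_castSucc, B.pad_comp, B.assoc, re (F.de_nat _), re (F.M.pad_sw_mu k), B.assoc,
      B.assoc, B.assoc, re (F.de_sw _), re (F.frob_right' k), B.assoc, re (F.de_sw _),
      re (F.pad_cop_mu u), B.assoc, B.assoc]
  have hr : ∃ (r₀ : Fin m → Fin k) (u v : Fin k), r = snoc (snoc r₀ u) v :=
    ⟨fun i => r i.castSucc.castSucc, r (Fin.last m).castSucc, r (Fin.last (m + 1)), by
      funext i
      induction i using Fin.lastCases with
      | last => simp [snoc]
      | cast i =>
        induction i using Fin.lastCases with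
        | last => simp [snoc]
        | cast i => simp [snoc]⟩
  obtain ⟨r₀, u, v, rfl⟩ := hr
  -- If both factors are copies of the same strand, the special law replaces them by a single copy
  -- and no strands are merged.
  by_cases huv : u = v
  · subst huv
    refine ⟨k, fun i => i, snoc r₀ u, ?_⟩
    rw [key, up_id, B.id_comp, dn_snoc, re (F.cop_de u).symm, B.assoc, re (F.de_mu k), B.id_comp]
  · obtain _ | k := k
    · exact u.elim0
    -- A permutation, inserted as `up σ ⨾ dn σ = id`, brings `v` to the last place so that `key'`
    -- applies. One strand is lost because `u` and `v` are identified.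
    let σ : Equiv.Perm (Fin (k + 1)) := Equiv.swap v (Fin.last k)
    have hu : σ u ≠ Fin.last k := fun h => huv (by
      rw [← Equiv.symm_apply_apply σ u, h]; simp [σ])
    obtain ⟨u', hu'⟩ := Fin.exists_castSucc_eq.2 hu
    have hv : σ v = Fin.last k := Equiv.swap_apply_left _ _
    have hσ : (fun i => σ (snoc (snoc r₀ u) v i)) =
        snoc (snoc (fun i => σ (r₀ i)) u'.castSucc) (Fin.last k) := by
      rw [hu', ← hv]
      funext i
      induction i using Fin.lastCases with
      | last => simp [snoc]
      | cast i =>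
        induction i using Fin.lastCases with
        | last => simp [snoc]
        | cast i => simp [snoc]
    refine ⟨k, fun i => snoc (fun i => i) u' (σ i),
      snoc (fun i => snoc (fun i => i) u' (σ (r₀ i))) u', ?_⟩
    rw [← B.id_comp (F.dn (snoc (snoc r₀ u) v)), ← F.up_dn_equiv σ, B.assoc, B.assoc,
      re (F.dn_comp _ _), hσ, key',
      ← F.up_comp σ (snoc (fun i => i) u'), B.assoc]

end PadFrob
end StringRewriting

namespace StringRewriting

/-! ## PROPs with a special Frobenius monoid -/

theorem castHom_trans (H : ℕ → ℕ → Type v) {a a' a'' b b' b'' : ℕ} (ha : a = a') (ha' : a' = a'')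
    (hb : b = b') (hb' : b' = b'') (f : H a b) :
    castHom H ha' hb' (castHom H ha hb f) = castHom H (ha.trans ha') (hb.trans hb') f := by
  subst ha ha' hb hb'; rfl

namespace PROP

variable (X : PROP.{v})

local infixr:80 "⨾" => PROP.comp _

variable {X}

/-- `a + 0` reduces to `a`, so the cast in `tensor_id_zero` is definitionally trivial. -/
theorem tensor_id_right {a b : ℕ} (f : X.Hom a b) : X.tensor f (X.id 0) = f :=
  X.tensor_id_zero f

theorem interchange {a b c d : ℕ} (f : X.Hom a b) (g : X.Hom c d) :
    X.tensor f (X.id c) ⨾ X.tensor (X.id b) g = X.tensor f g := by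
  rw [← X.tensor_comp, X.comp_id, X.id_comp]

theorem interchange' {a b c d : ℕ} (f : X.Hom a b) (g : X.Hom c d) :
    X.tensor (X.id a) g ⨾ X.tensor f (X.id d) = X.tensor f g := by
  rw [← X.tensor_comp, X.comp_id, X.id_comp]

theorem id_tensor_comp {a b c : ℕ} (n : ℕ) (f : X.Hom a b) (g : X.Hom b c) :
    X.tensor (X.id n) (f ⨾ g) = X.tensor (X.id n) f ⨾ X.tensor (X.id n) g := by
  rw [← X.tensor_comp, X.id_comp]

theorem comp_tensor_id {a b c : ℕ} (n : ℕ) (f : X.Hom a b) (g : X.Hom b c) :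
    X.tensor (f ⨾ g) (X.id n) = X.tensor f (X.id n) ⨾ X.tensor g (X.id n) := by
  rw [← X.tensor_comp, X.id_comp]

/-- Meant for symmetries with an empty second block: the hexagon `symm_add` with empty blocks makes
them idempotent, and `symm_symm` makes them invertible. -/
theorem eq_id_of_idem {n : ℕ} {f g : X.Hom n n} (h : f = f ⨾ f) (h' : g ⨾ f = X.id n) :
    f = X.id n := by
  calc f = X.comp (X.comp g f) f := by rw [h', X.id_comp]
    _ = X.comp g f := by rw [X.assoc, ← h]
    _ = X.id n := h'

end PROP

/-- A special commutative Frobenius monoid on the object `1` of a PROP. -/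
structure PROPFrob (X : PROP.{v}) where
  mul : X.Hom 2 1
  unit : X.Hom 0 1
  comul : X.Hom 1 2
  counit : X.Hom 1 0
  mul_comm : X.comp (X.symm 1 1) mul = mul
  mul_assoc : X.comp (X.tensor mul (X.id 1) :) mul = X.comp (X.tensor (X.id 1) mul :) mul
  unit_mul : X.comp (X.tensor unit (X.id 1) :) mul = X.id 1
  comul_comm : X.comp comul (X.symm 1 1) = comul
  comul_assoc : X.comp comul (X.tensor comul (X.id 1) :) = X.comp comul (X.tensor (X.id 1) comul :)
  counit_comul : X.comp comul (X.tensor counit (X.id 1) :) = X.id 1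
  special : X.comp comul mul = X.id 1
  frobenius_left : X.comp (X.tensor comul (X.id 1) :) (X.tensor (X.id 1) mul :) = X.comp mul comul
  frobenius_right : X.comp (X.tensor (X.id 1) comul :) (X.tensor mul (X.id 1) :) = X.comp mul comul

namespace PROP

variable (X : PROP.{v})

local infixr:80 "⨾" => PROP.comp _

theorem one_symm_zero : X.symm 1 0 = X.id 1 :=
  eq_id_of_idem (g := X.symm 0 1)
    ((X.symm_add 1 0 0).trans
      (congrArg₂ X.comp (X.tensor_id_zero (X.symm 1 0) :) (X.id_zero_tensor (X.symm 1 0))))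
    (X.symm_symm 0 1)

theorem zero_symm_zero : X.symm 0 0 = X.id 0 :=
  eq_id_of_idem (g := X.symm 0 0)
    ((X.symm_add 0 0 0).trans
      (congrArg₂ X.comp (X.tensor_id_zero (X.symm 0 0) :) (X.id_zero_tensor (X.symm 0 0))))
    (X.symm_symm 0 0)

theorem zero_symm_one : X.symm 0 1 = X.id 1 :=
  (X.comp_id _).symm.trans ((congrArg _ X.one_symm_zero.symm).trans (X.symm_symm 0 1))

theorem symm_one_two : X.symm 1 2 =
    X.comp (X.tensor (X.symm 1 1) (X.id 1) :) (X.tensor (X.id 1) (X.symm 1 1) :) :=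
  X.symm_add 1 1 1

theorem swap_pad_swap_pad :
    X.comp (X.tensor (X.symm 1 1) (X.id 1) :) (X.tensor (X.symm 1 1) (X.id 1) :) = X.id 3 := by
  rw [← comp_tensor_id, X.symm_symm]
  exact X.tensor_id 2 1

theorem pad_swap_pad_swap :
    X.comp (X.tensor (X.id 1) (X.symm 1 1) :) (X.tensor (X.id 1) (X.symm 1 1) :) = X.id 3 := by
  rw [← id_tensor_comp, X.symm_symm]
  exact X.tensor_id 1 2

/-- The hexagon law splits only the second block. The formula for a first block of size two is
obtained by inverting `symm_one_two`. -/
theorem symm_two_one : X.symm 2 1 =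
    X.comp (X.tensor (X.id 1) (X.symm 1 1) :) (X.tensor (X.symm 1 1) (X.id 1) :) := by
  have h : X.symm 1 2 ⨾ X.symm 2 1 = X.id 3 := X.symm_symm 1 2
  have h₁ := X.swap_pad_swap_pad
  have h₂ := X.pad_swap_pad_swap
  -- The types mix `1 + 2`, `2 + 1` and `3`. With the factors abstracted as endomorphisms of `3`,
  -- what remains is that `p q s = 1` with `p` and `q` involutions forces `s = q p`.
  generalize X.symm 2 1 = s at h
  rw [symm_one_two] at h
  change X.Hom 3 3 at s
  generalize (X.tensor (X.symm 1 1) (X.id 1) : X.Hom 3 3) = p at h h₁ ⊢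
  generalize (X.tensor (X.id 1) (X.symm 1 1) : X.Hom 3 3) = q at h h₂ ⊢
  change X.comp (X.comp p q) s = X.id 3 at h
  change X.comp p p = _ at h₁
  change X.comp q q = _ at h₂
  change s = X.comp q p
  rw [← X.comp_id (X.comp q p), ← h, X.assoc, X.assoc, ← X.assoc p p, h₁, X.id_comp, ← X.assoc, h₂,
    X.id_comp]

/-- Naturality of `symm 1 2` with respect to `symm 1 1`, with `symm 1 2` written as two adjacent
swaps. -/
theorem braid_one : X.comp (X.tensor (X.id 1) (X.symm 1 1) :) (X.comp (X.tensor (X.symm 1 1) (X.id 1) :)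
      (X.tensor (X.id 1) (X.symm 1 1) :)) =
    X.comp (X.tensor (X.symm 1 1) (X.id 1) :) (X.comp (X.tensor (X.id 1) (X.symm 1 1) :)
      (X.tensor (X.symm 1 1) (X.id 1) :)) := by
  have h := X.symm_natural (X.id 1) (X.symm 1 1)
  have h' : X.symm 1 (1 + 1) = _ := X.symm_one_two
  rw [h'] at h
  exact h.trans (X.assoc _ _ _)

/-- For numerals `a` and `b` the cast is definitionally trivial. The uses below therefore leave the
left-hand side as `_` and identify it with the uncast arrow. -/
theorem id_succ_tensor (n : ℕ) {a b : ℕ} (g : X.Hom a b) :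
    castHom X.Hom (Nat.add_assoc n 1 a) (Nat.add_assoc n 1 b) (X.tensor (X.id (n + 1)) g :) =
      X.tensor (X.id n) (X.tensor (X.id 1) g :) := by
  rw [← X.tensor_id]
  exact X.tensor_assoc _ _ _

/-- The underlying category of a PROP with the functor `- ⊕ id₁`. -/
def padCat : PadCat.{v} where
  Hom := X.Hom
  id := X.id
  comp := X.comp
  pad f := X.tensor f (X.id 1)
  sw n := (X.tensor (X.id n) (X.symm 1 1) :)
  id_comp := X.id_comp
  comp_id := X.comp_id
  assoc := X.assoc
  pad_id n := X.tensor_id n 1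
  pad_comp f g := comp_tensor_id 1 f g
  sw_nat {a b} f := by
    have h : X.tensor (X.tensor f (X.id 1) :) (X.id 1) = X.tensor f (X.id 2) :=
      (X.tensor_assoc f (X.id 1) (X.id 1)).trans (congrArg _ (X.tensor_id 1 1))
    rw [h]
    exact (interchange f (X.symm 1 1)).trans (interchange' f (X.symm 1 1)).symm
  sw_sw n := (id_tensor_comp n _ _).symm.trans ((congrArg _ (X.symm_symm 1 1)).trans
    (X.tensor_id n 2))
  braid n := by
    have h₁ : _ = X.tensor (X.id n) (X.tensor (X.id 1) (X.symm 1 1) :) :=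
      X.id_succ_tensor n (X.symm 1 1)
    have h₂ : _ = X.tensor (X.id n) (X.tensor (X.symm 1 1) (X.id 1) :) :=
      X.tensor_assoc (X.id n) (X.symm 1 1) (X.id 1)
    have := congrArg (X.tensor (X.id n)) X.braid_one
    simp only [id_tensor_comp] at this
    exact (congrArg₂ X.comp h₁ (congrArg₂ X.comp h₂ h₁)).trans (this.trans
      (congrArg₂ X.comp h₂ (congrArg₂ X.comp h₁ h₂)).symm)

end PROP

/-! ### From a Frobenius monoid in a PROP to structure on the last strands -/

namespace PROPFrob

open PROP

variable {X : PROP.{v}} (F : PROPFrob X)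

/-- The multiplication and the unit on the last strands. -/
def monoid : PadMonoid X.padCat where
  mu n := (X.tensor (X.id n) F.mul :)
  et n := (X.tensor (X.id n) F.unit :)
  mu_nat {a b} f := by
    have h : X.tensor (X.tensor f (X.id 1) :) (X.id 1) = X.tensor f (X.id 2) :=
      (X.tensor_assoc f (X.id 1) (X.id 1)).trans (congrArg _ (X.tensor_id 1 1))
    exact (congrArg (fun t => X.comp t _) h).trans
      ((interchange f F.mul).trans (interchange' f F.mul).symm)
  et_nat {a b} f :=
    (congrArg (fun t => X.comp t _) (tensor_id_right f).symm).trans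
      ((interchange f F.unit).trans (interchange' f F.unit).symm)
  sw_mu n := (id_tensor_comp n _ _).symm.trans (congrArg _ F.mul_comm)
  mu_assoc n := by
    -- The law on `n` further strands is `id_n ⊕ -` applied to the law of the monoid; `h₁` and `h₂`
    -- only move the brackets. The remaining laws follow the same pattern.
    have h₁ : _ = X.tensor (X.id n) (X.tensor (X.id 1) F.mul :) := X.id_succ_tensor n F.mul
    have h₂ : _ = X.tensor (X.id n) (X.tensor F.mul (X.id 1) :) :=
      X.tensor_assoc (X.id n) F.mul (X.id 1)
    have := congrArg (X.tensor (X.id n)) F.mul_assoc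
    simp only [id_tensor_comp] at this
    exact (congrArg (fun t => X.comp t _) h₂).trans
      (this.trans (congrArg (fun t => X.comp t _) h₁).symm)
  pad_et_mu n := by
    have h₂ : _ = X.tensor (X.id n) (X.tensor F.unit (X.id 1) :) :=
      X.tensor_assoc (X.id n) F.unit (X.id 1)
    have := congrArg (X.tensor (X.id n)) F.unit_mul
    simp only [id_tensor_comp] at this
    exact (congrArg (fun t => X.comp t _) h₂).trans (this.trans (X.tensor_id n 1))
  et_sw n := by
    have h₁ : _ = X.tensor (X.id n) (X.tensor (X.id 1) F.unit :) := X.id_succ_tensor n F.unit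
    have h₂ : _ = X.tensor (X.id n) (X.tensor F.unit (X.id 1) :) :=
      X.tensor_assoc (X.id n) F.unit (X.id 1)
    -- The unit has source `0`, so naturality leaves `symm 1 0`, which is an identity.
    have h : X.comp (X.tensor (X.id 1) F.unit :) (X.symm 1 1) = X.tensor F.unit (X.id 1) :=
      (X.symm_natural (X.id 1) F.unit).trans
        ((congrArg (fun t => X.comp t _) X.one_symm_zero).trans (X.id_comp _))
    have := congrArg (X.tensor (X.id n)) h
    simp only [id_tensor_comp] at this
    exact (congrArg (fun t => X.comp t _) h₁).trans (this.trans h₂.symm)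
  mu_sw n := by
    have h₁ : _ = X.tensor (X.id n) (X.tensor (X.id 1) F.mul :) := X.id_succ_tensor n F.mul
    have h₂ : _ = X.tensor (X.id n) (X.tensor F.mul (X.id 1) :) :=
      X.tensor_assoc (X.id n) F.mul (X.id 1)
    have h₃ : _ = X.tensor (X.id n) (X.tensor (X.id 1) (X.symm 1 1) :) :=
      X.id_succ_tensor n (X.symm 1 1)
    have h₄ : _ = X.tensor (X.id n) (X.tensor (X.symm 1 1) (X.id 1) :) :=
      X.tensor_assoc (X.id n) (X.symm 1 1) (X.id 1)
    have h : X.comp (X.tensor (X.id 1) F.mul :) (X.symm 1 1) =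
        X.comp (X.tensor (X.symm 1 1) (X.id 1) :) (X.comp (X.tensor (X.id 1) (X.symm 1 1) :)
          (X.tensor F.mul (X.id 1) :)) :=
      (X.symm_natural (X.id 1) F.mul).trans
        ((congrArg (fun t => X.comp t _) X.symm_one_two).trans (X.assoc _ _ _))
    have := congrArg (X.tensor (X.id n)) h
    simp only [id_tensor_comp] at this
    exact (congrArg (fun t => X.comp t _) h₁).trans (this.trans
      (congrArg₂ X.comp h₄ (congrArg₂ X.comp h₃ h₂)).symm)

/-- The comultiplication and the counit on the last strands. -/
def comonoid : PadMonoid X.padCat.op where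
  mu n := (X.tensor (X.id n) F.comul :)
  et n := (X.tensor (X.id n) F.counit :)
  mu_nat {a b} f := by
    have h : X.tensor (X.tensor f (X.id 1) :) (X.id 1) = X.tensor f (X.id 2) :=
      (X.tensor_assoc f (X.id 1) (X.id 1)).trans (congrArg _ (X.tensor_id 1 1))
    exact (congrArg (fun t => X.comp _ t) h).trans
      ((interchange' f F.comul).trans (interchange f F.comul).symm)
  et_nat {a b} f :=
    (congrArg (fun t => X.comp _ t) (tensor_id_right f).symm).trans
      ((interchange' f F.counit).trans (interchange f F.counit).symm)
  sw_mu n := (id_tensor_comp n _ _).symm.trans (congrArg _ F.comul_comm)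
  mu_assoc n := by
    have h₁ : _ = X.tensor (X.id n) (X.tensor (X.id 1) F.comul :) := X.id_succ_tensor n F.comul
    have h₂ : _ = X.tensor (X.id n) (X.tensor F.comul (X.id 1) :) :=
      X.tensor_assoc (X.id n) F.comul (X.id 1)
    have := congrArg (X.tensor (X.id n)) F.comul_assoc
    simp only [id_tensor_comp] at this
    exact (congrArg (fun t => X.comp _ t) h₂).trans
      (this.trans (congrArg (fun t => X.comp _ t) h₁).symm)
  pad_et_mu n := by
    have h₂ : _ = X.tensor (X.id n) (X.tensor F.counit (X.id 1) :) :=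
      X.tensor_assoc (X.id n) F.counit (X.id 1)
    have := congrArg (X.tensor (X.id n)) F.counit_comul
    simp only [id_tensor_comp] at this
    exact (congrArg (fun t => X.comp _ t) h₂).trans (this.trans (X.tensor_id n 1))
  et_sw n := by
    have h₁ : _ = X.tensor (X.id n) (X.tensor (X.id 1) F.counit :) := X.id_succ_tensor n F.counit
    have h₂ : _ = X.tensor (X.id n) (X.tensor F.counit (X.id 1) :) :=
      X.tensor_assoc (X.id n) F.counit (X.id 1)
    have h : X.comp (X.symm 1 1) (X.tensor (X.id 1) F.counit :) = X.tensor F.counit (X.id 1) :=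
      (X.symm_natural F.counit (X.id 1)).symm.trans
        ((congrArg (fun t => X.comp _ t) X.zero_symm_one).trans (X.comp_id _))
    have := congrArg (X.tensor (X.id n)) h
    simp only [id_tensor_comp] at this
    exact (congrArg (fun t => X.comp _ t) h₁).trans (this.trans h₂.symm)
  mu_sw n := by
    have h₁ : _ = X.tensor (X.id n) (X.tensor (X.id 1) F.comul :) := X.id_succ_tensor n F.comul
    have h₂ : _ = X.tensor (X.id n) (X.tensor F.comul (X.id 1) :) :=
      X.tensor_assoc (X.id n) F.comul (X.id 1)
    have h₃ : _ = X.tensor (X.id n) (X.tensor (X.id 1) (X.symm 1 1) :) :=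
      X.id_succ_tensor n (X.symm 1 1)
    have h₄ : _ = X.tensor (X.id n) (X.tensor (X.symm 1 1) (X.id 1) :) :=
      X.tensor_assoc (X.id n) (X.symm 1 1) (X.id 1)
    have h : X.comp (X.symm 1 1) (X.tensor (X.id 1) F.comul :) =
        X.comp (X.comp (X.tensor F.comul (X.id 1) :) (X.tensor (X.id 1) (X.symm 1 1) :))
          (X.tensor (X.symm 1 1) (X.id 1) :) :=
      (X.symm_natural F.comul (X.id 1)).symm.trans
        ((congrArg (fun t => X.comp _ t) X.symm_two_one).trans (X.assoc _ _ _).symm)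
    have := congrArg (X.tensor (X.id n)) h
    simp only [id_tensor_comp] at this
    exact (congrArg (fun t => X.comp _ t) h₁).trans (this.trans
      (congrArg₂ X.comp (congrArg₂ X.comp h₂ h₃) h₄).symm)

/-- The Frobenius structure on the last strands. -/
def padFrob : PadFrob X.padCat where
  M := F.monoid
  W := F.comonoid
  frob_left n := by
    have h₁ : _ = X.tensor (X.id n) (X.tensor (X.id 1) F.mul :) := X.id_succ_tensor n F.mul
    have h₂ : _ = X.tensor (X.id n) (X.tensor F.comul (X.id 1) :) :=
      X.tensor_assoc (X.id n) F.comul (X.id 1)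
    have := congrArg (X.tensor (X.id n)) F.frobenius_left
    simp only [id_tensor_comp] at this
    exact (congrArg₂ X.comp h₂ h₁).trans this
  frob_right n := by
    have h₁ : _ = X.tensor (X.id n) (X.tensor (X.id 1) F.comul :) := X.id_succ_tensor n F.comul
    have h₂ : _ = X.tensor (X.id n) (X.tensor F.mul (X.id 1) :) :=
      X.tensor_assoc (X.id n) F.mul (X.id 1)
    have := congrArg (X.tensor (X.id n)) F.frobenius_right
    simp only [id_tensor_comp] at this
    exact (congrArg₂ X.comp h₁ h₂).trans this
  special n := (id_tensor_comp n _ _).symm.trans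
    ((congrArg _ F.special).trans (X.tensor_id n 1))

end PROPFrob
end StringRewriting

namespace StringRewriting

/-! ### Adding identity strands on the left -/

namespace PadMonoid

open PadCat PadFrob

/-- The function `id_n ⊕ w`. -/
def idAdd (n : ℕ) {a b : ℕ} (w : Fin a → Fin b) : Fin (n + a) → Fin (n + b) :=
  Fin.append (Fin.castAdd b) fun i => Fin.natAdd n (w i)

/-- `up` is built from composition, `pad`, the swaps, the multiplication and the unit, so an
operation that commutes with these commutes with `up`. The operation in mind is `id_n ⊕ -`; keeping
`B` abstract lets one proof serve the monoid and, in the opposite category, the comonoid. -/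
theorem map_up_of_shift {B : PadCat.{v}} (M : PadMonoid B) (n : ℕ)
    (G : ∀ {a b : ℕ}, B.Hom a b → B.Hom (n + a) (n + b))
    (hid : ∀ a, G (B.id a) = B.id (n + a))
    (hcomp : ∀ {a b c} (f : B.Hom a b) (g : B.Hom b c), G (B.comp f g) = B.comp (G f) (G g))
    (hpad : ∀ {a b} (f : B.Hom a b), G (B.pad f) = B.pad (G f))
    (hsw : ∀ a, G (B.sw a) = B.sw (n + a)) (hmu : ∀ a, G (M.mu a) = M.mu (n + a))
    (het : ∀ a, G (M.et a) = M.et (n + a)) {a b : ℕ} (w : Fin a → Fin b) :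
    G (M.up w) = M.up (idAdd n w) := by
  have hins : ∀ {k : ℕ} (v : Fin k), G (M.ins v) = M.ins (Fin.natAdd n v) := by
    intro k
    induction k with
    | zero => exact fun v => v.elim0
    | succ k ih =>
      intro v
      induction v using Fin.lastCases with
      | last => 
        rw [ins_last, hmu]
        exact (M.ins_last _).symm
      | cast v => 
        rw [ins_castSucc, hcomp, hsw, hpad, ih]
        exact (M.ins_castSucc _).symm
  induction a with
  | zero =>
    -- With no inputs the shift still leaves `n` strands, so `k` units become the inclusion of the
    -- first `n` strands.
    have : ∀ k, G (M.units k) = M.up (Fin.castAdd k : Fin n → Fin (n + k)) := by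
      intro k
      induction k with
      | zero => exact (hid 0).trans (M.up_id n).symm
      | succ k ih =>
        rw [units, hcomp, ih, het]
        exact (M.up_castSucc _).symm
    refine (this b).trans (congrArg _ ?_)
    exact funext fun i => (Fin.append_left _ _ i).symm
  | succ a ih =>
    rw [up_succ, hcomp, hpad, ih, hins]
    refine (M.up_snoc _ _).symm.trans (congrArg _ ?_)
    exact (append_succ (Fin.castAdd b) fun i => Fin.natAdd n (w i)).symm

end PadMonoid

open PadMonoid PadFrob

/-! ### Functions on blocks of strands -/

/-- The function `f ⊕ g`. -/
def sumFun {a b c d : ℕ} (f : Fin a → Fin b) (g : Fin c → Fin d) : Fin (a + c) → Fin (b + d) :=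
  Fin.append (fun i => Fin.castAdd d (f i)) fun i => Fin.natAdd b (g i)

/-- The block swap. -/
def blockSwap (a b : ℕ) : Fin (a + b) → Fin (b + a) :=
  Fin.append (Fin.natAdd b) (Fin.castAdd a)

theorem blockSwap_blockSwap (a b : ℕ) (i : Fin (a + b)) : blockSwap b a (blockSwap a b i) = i := by
  induction i using Fin.addCases <;> simp [blockSwap]

/-- Identities between block functions with casts in between are checked on values by `omega`; this
and the following lemmas supply the values. -/
theorem append_val {n m k : ℕ} (f : Fin n → Fin k) (g : Fin m → Fin k) (i : Fin (n + m)) :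
    (Fin.append f g i).val = if h : i.val < n then (f ⟨i.val, h⟩).val else
      (g ⟨i.val - n, by omega⟩).val := by
  induction i using Fin.addCases <;> simp

theorem addFun_val {n k a : ℕ} (f : Fin n → Fin k) (i : Fin (n + a)) :
    (addFun f a i).val = if h : i.val < n then (f ⟨i.val, h⟩).val else k + (i.val - n) :=
  append_val _ _ i

/-- The value `0` is a default that never occurs, since `n ≤ i < n + a` gives `i - n < a`. -/
theorem idAdd_val {n a b : ℕ} (w : Fin a → Fin b) (i : Fin (n + a)) :
    (idAdd n w i).val = if i.val < n then i.val else
      if h : i.val - n < a then n + (w ⟨i.val - n, h⟩).val else 0 := by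
  refine (append_val _ _ i).trans ?_
  have := i.isLt
  split_ifs
  · rfl
  · rfl
  · omega

theorem sumFun_val {a b c d : ℕ} (f : Fin a → Fin b) (g : Fin c → Fin d) (i : Fin (a + c)) :
    (sumFun f g i).val = if h : i.val < a then (f ⟨i.val, h⟩).val else
      b + (g ⟨i.val - a, by omega⟩).val :=
  append_val _ _ i

theorem blockSwap_val {a b : ℕ} (i : Fin (a + b)) :
    (blockSwap a b i).val = if i.val < a then b + i.val else i.val - a := by
  induction i using Fin.addCases <;> simp [blockSwap]

/-! ### Merging and copying arrows in a PROP -/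

namespace PROPFrob

open PROP

variable {X : PROP.{v}} (F : PROPFrob X)

/-- The arrow `n ⟶ k` of a function `Fin n → Fin k`. -/
def up {n k : ℕ} (w : Fin n → Fin k) : X.Hom n k := F.padFrob.up w

/-- The arrow `k ⟶ n` of a function `Fin n → Fin k`. -/
def dn {n k : ℕ} (w : Fin n → Fin k) : X.Hom k n := F.padFrob.dn w

/-- The merging of the last of `k + 1` strands with the strand `v`. -/
def ins {k : ℕ} (v : Fin k) : X.Hom (k + 1) k := F.monoid.ins v

/-- The copying of the strand `v` to a new last strand. -/
def cop {k : ℕ} (v : Fin k) : X.Hom k (k + 1) := F.comonoid.ins v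

theorem ins_last (k : ℕ) : F.ins (Fin.last k) = (X.tensor (X.id k) F.mul :) :=
  F.monoid.ins_last k

theorem cop_last (k : ℕ) : F.cop (Fin.last k) = (X.tensor (X.id k) F.comul :) :=
  F.comonoid.ins_last k

theorem ins_castSucc {k : ℕ} (v : Fin k) : F.ins v.castSucc =
    X.comp (X.tensor (X.id k) (X.symm 1 1) :) (X.tensor (F.ins v) (X.id 1) :) :=
  F.monoid.ins_castSucc v

theorem cop_castSucc {k : ℕ} (v : Fin k) : F.cop v.castSucc =
    X.comp (X.tensor (F.cop v) (X.id 1) :) (X.tensor (X.id k) (X.symm 1 1) :) :=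
  F.comonoid.ins_castSucc v

theorem up_succ {n k : ℕ} (w : Fin (n + 1) → Fin k) : F.up w =
    X.comp (X.tensor (F.up fun i : Fin n => w i.castSucc) (X.id 1)) (F.ins (w (Fin.last n))) := rfl

theorem dn_succ {n k : ℕ} (w : Fin (n + 1) → Fin k) : F.dn w =
    X.comp (F.cop (w (Fin.last n))) (X.tensor (F.dn fun i : Fin n => w i.castSucc) (X.id 1)) := rfl

theorem up_of_zero (w : Fin 0 → Fin 0) : F.up w = X.id 0 := rfl

theorem dn_of_zero (w : Fin 0 → Fin 0) : F.dn w = X.id 0 := rfl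

theorem up_of_zero_succ {k : ℕ} (w : Fin 0 → Fin (k + 1)) : F.up w =
    X.comp (F.up (Fin.elim0 : Fin 0 → Fin k)) (X.tensor (X.id k) F.unit) := rfl

theorem dn_of_zero_succ {k : ℕ} (w : Fin 0 → Fin (k + 1)) : F.dn w =
    X.comp (X.tensor (X.id k) F.counit) (F.dn (Fin.elim0 : Fin 0 → Fin k)) := rfl

theorem up_comp {n k l : ℕ} (w : Fin n → Fin k) (v : Fin k → Fin l) :
    X.comp (F.up w) (F.up v) = F.up (fun i => v (w i)) := F.padFrob.up_comp w v

theorem dn_comp {n k l : ℕ} (w : Fin n → Fin k) (v : Fin k → Fin l) :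
    X.comp (F.dn v) (F.dn w) = F.dn (fun i => v (w i)) := F.padFrob.dn_comp w v

theorem up_id (n : ℕ) : F.up (fun i : Fin n => i) = X.id n := F.padFrob.up_id n

theorem dn_id (n : ℕ) : F.dn (fun i : Fin n => i) = X.id n := F.padFrob.dn_id n

theorem castHom_up {a a' b b' : ℕ} (ha : a = a') (hb : b = b') (w : Fin a → Fin b) :
    castHom X.Hom ha hb (F.up w) = F.up (fun i => Fin.cast hb (w (Fin.cast ha.symm i))) := by
  subst ha hb; rfl

theorem castHom_dn {a a' b b' : ℕ} (ha : a = a') (hb : b = b') (w : Fin b → Fin a) :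
    castHom X.Hom ha hb (F.dn w) = F.dn (fun i => Fin.cast ha (w (Fin.cast hb.symm i))) := by
  subst ha hb; rfl

theorem up_tensor_id {n k : ℕ} (w : Fin n → Fin k) (a : ℕ) :
    X.tensor (F.up w) (X.id a) = F.up (addFun w a) := by
  induction a with
  | zero =>
    rw [tensor_id_right]
    exact congrArg F.up (funext fun i => (Fin.append_left _ _ i).symm)
  | succ a ih =>
    rw [addFun_succ, ← X.tensor_id]
    refine (X.tensor_assoc _ _ _).symm.trans ?_
    rw [ih]
    exact (F.padFrob.up_padFun _).symm

theorem dn_tensor_id {n k : ℕ} (w : Fin n → Fin k) (a : ℕ) :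
    X.tensor (F.dn w) (X.id a) = F.dn (addFun w a) := by
  induction a with
  | zero =>
    rw [tensor_id_right]
    exact congrArg F.dn (funext fun i => (Fin.append_left _ _ i).symm)
  | succ a ih =>
    rw [addFun_succ, ← X.tensor_id]
    refine (X.tensor_assoc _ _ _).symm.trans ?_
    rw [ih]
    exact (F.padFrob.dn_padFun _).symm

theorem id_add_tensor (n m : ℕ) {a b : ℕ} (g : X.Hom a b) :
    X.tensor (X.id n) (X.tensor (X.id m) g) =
      castHom X.Hom (Nat.add_assoc n m a) (Nat.add_assoc n m b) (X.tensor (X.id (n + m)) g) := by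
  rw [← X.tensor_id]
  exact (X.tensor_assoc _ _ _).symm

theorem id_tensor_up (n : ℕ) {a b : ℕ} (w : Fin a → Fin b) :
    X.tensor (X.id n) (F.up w) = F.up (idAdd n w) :=
  F.monoid.map_up_of_shift n (fun f => X.tensor (X.id n) f) (X.tensor_id n)
    (id_tensor_comp n) (fun f => (X.tensor_assoc (X.id n) f (X.id 1)).symm)
    (fun a => id_add_tensor n a (X.symm 1 1)) (fun a => id_add_tensor n a F.mul)
    (fun a => id_add_tensor n a F.unit) w

theorem id_tensor_dn (n : ℕ) {a b : ℕ} (w : Fin a → Fin b) :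
    X.tensor (X.id n) (F.dn w) = F.dn (idAdd n w) :=
  F.comonoid.map_up_of_shift n (fun f => X.tensor (X.id n) f) (X.tensor_id n)
    (fun f g => id_tensor_comp n g f) (fun f => (X.tensor_assoc (X.id n) f (X.id 1)).symm)
    (fun a => id_add_tensor n a (X.symm 1 1)) (fun a => id_add_tensor n a F.comul)
    (fun a => id_add_tensor n a F.counit) w

theorem up_tensor_up {a b c d : ℕ} (f : Fin a → Fin b) (g : Fin c → Fin d) :
    X.tensor (F.up f) (F.up g) = F.up (sumFun f g) := by
  rw [← interchange, up_tensor_id, id_tensor_up, up_comp]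
  congr 1
  funext i
  induction i using Fin.addCases <;> simp [addFun, idAdd, sumFun]

theorem dn_tensor_dn {a b c d : ℕ} (f : Fin a → Fin b) (g : Fin c → Fin d) :
    X.tensor (F.dn f) (F.dn g) = F.dn (sumFun f g) := by
  rw [← interchange, dn_tensor_id, id_tensor_dn, dn_comp]
  congr 1
  funext i
  induction i using Fin.addCases <;> simp [addFun, idAdd, sumFun]

theorem up_dn_equiv {n k : ℕ} (σ : Fin n ≃ Fin k) : X.comp (F.up σ) (F.dn σ) = X.id n :=
  F.padFrob.up_dn_equiv σ

/-- The symmetries are the arrows of the block swaps. -/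
theorem symm_eq_up (a b : ℕ) : X.symm a b = F.up (blockSwap a b) := by
  -- The hexagon splits one strand off the second block, and `inv` exchanges the two blocks.
  -- Together they reduce all symmetries to `symm 0 0`, `symm 1 0` and `symm 1 1`.
  have step : ∀ a b : ℕ, X.symm a b = F.up (blockSwap a b) →
      X.symm a 1 = F.up (blockSwap a 1) → X.symm a (b + 1) = F.up (blockSwap a (b + 1)) := by
    intro a b h h'
    rw [X.symm_add, h, h', up_tensor_id, id_tensor_up, castHom_up, castHom_up, up_comp]
    congr 1
    funext i
    apply Fin.ext
    simp only [Fin.val_cast, idAdd_val, addFun_val, blockSwap_val]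
    split_ifs <;> omega
  have inv : ∀ a b : ℕ, X.symm a b = F.up (blockSwap a b) →
      X.symm b a = F.up (blockSwap b a) := by
    intro a b h
    have h₁ : X.comp (F.up (blockSwap a b)) (F.up (blockSwap b a)) = X.id _ := by
      rw [up_comp]
      simp only [blockSwap_blockSwap, up_id]
    rw [← X.comp_id (X.symm b a), ← h₁, ← h, ← X.assoc, X.symm_symm, X.id_comp]
  have one : X.symm 1 1 = F.up (blockSwap 1 1) := by
    have h : X.tensor (X.id 0) (X.symm 1 1) = F.up (swFun 0) := (F.padFrob.up_swFun 0).symm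
    refine (X.id_zero_tensor (X.symm 1 1)).symm.trans ?_
    rw [h, castHom_up]
    congr 1
    funext i
    fin_cases i <;> rfl
  have zero_zero : X.symm 0 0 = F.up (blockSwap 0 0) :=
    X.zero_symm_zero.trans (F.up_of_zero _).symm
  have one_zero : X.symm 1 0 = F.up (blockSwap 1 0) :=
    X.one_symm_zero.trans ((F.up_id 1).symm.trans
      (congrArg F.up (funext fun i => Subsingleton.elim (α := Fin 1) _ _)))
  have zero' : ∀ b, X.symm 0 b = F.up (blockSwap 0 b) := fun b => by
    induction b with
    | zero => exact zero_zero
    | succ b ih => exact step 0 b ih (inv 1 0 one_zero)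
  have one' : ∀ b, X.symm 1 b = F.up (blockSwap 1 b) := fun b => by
    induction b with
    | zero => exact one_zero
    | succ b ih => exact step 1 b ih one
  induction b with
  | zero => exact inv 0 a (zero' a)
  | succ b ih => exact step a b ih (inv 1 a (one' a))

theorem symm_eq_dn (a b : ℕ) : X.symm a b = F.dn (blockSwap b a) := by
  rw [symm_eq_up]
  exact F.padFrob.up_equiv
    ⟨blockSwap a b, blockSwap b a, blockSwap_blockSwap a b, blockSwap_blockSwap b a⟩

/-! ### Caps, bending and the action of states -/

/-- The cap `unit ; comultiplication`. -/
abbrev oneCap : X.Hom 0 (1 + 1) := X.comp F.unit F.comul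

theorem unit_eq_up (w : Fin 0 → Fin 1) : F.unit = F.up w := by
  have h : X.tensor (X.id 0) F.unit = F.up (fun i : Fin 0 => i.castSucc) :=
    F.padFrob.M.et_eq_up 0
  refine (X.id_zero_tensor F.unit).symm.trans ((congrArg _ h).trans (congrArg F.up ?_))
  exact funext fun i => i.elim0

theorem comul_eq_dn (w : Fin 2 → Fin 1) : F.comul = F.dn w := by
  have h : X.tensor (X.id 0) F.comul = F.dn (snoc (fun i => i) (0 : Fin 1)) :=
    ((F.padFrob.W.up_snoc_id 0).trans (F.padFrob.W.ins_last 0)).symm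
  refine (X.id_zero_tensor F.comul).symm.trans ((congrArg _ h).trans (congrArg F.dn ?_))
  exact funext fun i => Subsingleton.elim (α := Fin 1) _ _

theorem counit_eq_dn (w : Fin 0 → Fin 1) : F.counit = F.dn w := by
  have h : X.tensor (X.id 0) F.counit = F.dn (fun i : Fin 0 => i.castSucc) :=
    F.padFrob.W.et_eq_up 0
  refine (X.id_zero_tensor F.counit).symm.trans ((congrArg _ h).trans (congrArg F.dn ?_))
  exact funext fun i => i.elim0

/-- Create `n` strands by units and copy each of them once. The permutation in the recursion for
`cap` is itself of the form `dn`, so functoriality absorbs it. -/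
theorem cap_eq (n : ℕ) : X.cap F.oneCap n =
    X.comp (F.up (Fin.elim0 : Fin 0 → Fin n)) (F.dn (idAppend fun i => i)) := by
  induction n with
  | zero =>
    have h : F.dn (idAppend fun i : Fin 0 => i) = X.id 0 := F.dn_id 0
    rw [h, X.comp_id, up_of_zero]
    rfl
  | succ n ih =>
    have h : F.oneCap = X.comp (F.up (Fin.elim0 : Fin 0 → Fin 1)) (F.dn fun _ => 0) :=
      congrArg₂ X.comp (F.unit_eq_up _) (F.comul_eq_dn _)
    have h' : X.cap F.oneCap (n + 1) = X.comp (X.tensor (X.cap F.oneCap n) F.oneCap)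
      (castHom X.Hom (by omega : n + ((n + 1) + 1) = (n + n) + (1 + 1))
        (by omega : n + ((1 + n) + 1) = (n + 1) + (n + 1))
        (X.tensor (X.id n) (X.tensor (X.symm n 1) (X.id 1)))) := rfl
    rw [h', ih, h, X.tensor_comp, up_tensor_up, dn_tensor_dn, symm_eq_dn, dn_tensor_id,
      id_tensor_dn, castHom_dn, X.assoc, dn_comp]
    refine congrArg₂ X.comp (congrArg F.up (funext fun i => i.elim0)) (congrArg F.dn ?_)
    funext i
    apply Fin.ext
    simp only [Fin.val_cast, idAdd_val, addFun_val, blockSwap_val, sumFun_val, append_val]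
    have := i.isLt
    split_ifs <;> omega

/-- The bending of an arrow. -/
def bendArrow {a b : ℕ} (g : X.Hom a b) : X.Hom 0 (a + b) :=
  X.comp (X.cap F.oneCap a) (X.tensor (X.id a) g)

/-- The action of a state `g : 0 ⟶ p` on `k` strands, where the strand `i` of the state is merged with
the strand `z i`. -/
def act {k p : ℕ} (g : X.Hom 0 p) (z : Fin p → Fin k) : X.Hom k k :=
  X.comp (X.tensor (X.id k) g : X.Hom (k + 0) (k + p)) (F.up (idAppend z))

theorem comp_id_tensor_state {n k p : ℕ} (f : X.Hom n k) (g : X.Hom 0 p) :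
    X.comp f (X.tensor (X.id k) g : X.Hom (k + 0) (k + p)) =
      X.comp (X.tensor (X.id n) g : X.Hom (n + 0) (n + p)) (X.tensor f (X.id p)) :=
  (congrArg (fun t => X.comp t _) (tensor_id_right f).symm).trans
    ((interchange f g).trans (interchange' f g).symm)

theorem idAppend_addFun {n k p : ℕ} (f : Fin n → Fin k) (z : Fin p → Fin k) (i : Fin (n + p)) :
    idAppend z (addFun f p i) = Fin.append f z i := by
  induction i using Fin.addCases <;> simp [addFun]

/-- The state is independent of the strands, so it slides in front of `up f`; all merges then
compose to a single `up`. -/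
theorem up_act {n k p : ℕ} (f : Fin n → Fin k) (g : X.Hom 0 p) (z : Fin p → Fin k) :
    X.comp (F.up f) (F.act g z) =
      X.comp (X.tensor (X.id n) g : X.Hom (n + 0) (n + p)) (F.up (Fin.append f z)) := by
  rw [act, ← X.assoc, comp_id_tensor_state, up_tensor_id, X.assoc, up_comp]
  simp only [idAppend_addFun]

theorem act_up {k l p : ℕ} (g : X.Hom 0 p) (z : Fin p → Fin k) (f : Fin k → Fin l) :
    X.comp (F.act g z) (F.up f) = X.comp (F.up f) (F.act g fun i => f (z i)) := by
  rw [up_act, act, X.assoc, up_comp]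
  congr 3
  funext i
  induction i using Fin.addCases <;> simp

/-- A cast in the middle of a composite is harmless before an `up`: it becomes a `Fin.cast` inside
the function. -/
theorem tensor_assoc_comp {a b c a' b' c' d : ℕ} (f : X.Hom a a') (g : X.Hom b b')
    (h : X.Hom c c') (w : Fin (a' + (b' + c')) → Fin d) :
    X.comp (X.tensor f (X.tensor g h)) (F.up w) =
      castHom X.Hom (Nat.add_assoc a b c) rfl (X.comp (X.tensor (X.tensor f g) h)
        (F.up fun i => w (Fin.cast (Nat.add_assoc a' b' c') i))) := by
  rw [← X.tensor_assoc]
  have key : ∀ {x x' y y' : ℕ} (hx : x = x') (hy : y = y') (s : X.Hom x y)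
      (w : Fin y' → Fin d), X.comp (castHom X.Hom hx hy s) (F.up w) =
      castHom X.Hom hx rfl (X.comp s (F.up fun i => w (Fin.cast hy i))) := by
    rintro x x' y y' rfl rfl s w; rfl
  exact key _ _ _ _

theorem act_comp_act {k p q : ℕ} (g : X.Hom 0 p) (z : Fin p → Fin k) (g' : X.Hom 0 q)
    (z' : Fin q → Fin k) : X.comp (F.act g z) (F.act g' z') =
      F.act (X.tensor g g' : X.Hom (0 + 0) (p + q)) (Fin.append z z') := by
  have h := F.tensor_assoc_comp (X.id k) g g' (idAppend (Fin.append z z'))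
  refine Eq.trans ?_ h.symm
  rw [act, X.assoc, up_act, ← X.assoc]
  have h' : X.comp (X.tensor (X.id k) g) (X.tensor (X.id (k + p)) g' : X.Hom (k + p + 0) _) =
      (X.tensor (X.tensor (X.id k) g) g') :=
    (congrArg (fun t => X.comp t _) (tensor_id_right _).symm).trans (interchange _ g')
  refine congrArg₂ X.comp h' (congrArg F.up ?_)
  exact (Fin.append_assoc _ _ _)

theorem act_comp_up {k p q : ℕ} (g : X.Hom 0 p) (v : Fin p → Fin q) (z : Fin q → Fin k) :
    F.act (X.comp g (F.up v)) z = F.act g fun i => z (v i) := by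
  rw [act, act, id_tensor_comp, id_tensor_up]
  refine (X.assoc _ _ _).trans ?_
  rw [up_comp]
  congr 2
  funext i
  induction i using Fin.addCases <;> simp [idAdd]

/-- Actions of states commute. -/
theorem act_comm {k p q : ℕ} (g : X.Hom 0 p) (z : Fin p → Fin k) (g' : X.Hom 0 q)
    (z' : Fin q → Fin k) :
    X.comp (F.act g z) (F.act g' z') = X.comp (F.act g' z') (F.act g z) := by
  rw [act_comp_act, act_comp_act]
  -- States have source `0`, so exchanging them costs only `symm 0 0`, an identity; the block swap
  -- of their outputs is absorbed by the function that attaches them.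
  have h : X.comp (X.tensor g' g) (X.symm q p) = X.tensor g g' :=
    (X.symm_natural g' g).trans ((congrArg (fun t => X.comp t _) X.zero_symm_zero).trans
      (X.id_comp _))
  rw [← h, F.symm_eq_up]
  refine (F.act_comp_up _ _ _).trans (congrArg _ ?_)
  funext i
  induction i using Fin.addCases <;> simp [blockSwap]

/-- An arrow applied to copied strands is the action of its bending. -/
theorem dn_idAppend_comp {k a b : ℕ} (o : X.Hom a b) (x : Fin a → Fin k) :
    X.comp (F.dn (idAppend x)) (X.tensor (X.id k) o) =
      X.comp (F.up (Fin.castAdd b)) (F.act (F.bendArrow o)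
        (Fin.append (fun i => Fin.castAdd b (x i)) (Fin.natAdd k))) := by
  have key : ∀ {x x' y z : ℕ} (hx : x = x') (f : Fin x' → Fin z) (s : X.Hom x y),
      X.comp (F.dn f) (castHom X.Hom hx rfl s) = X.comp (F.dn fun i => f (Fin.cast hx i)) s := by
    rintro x x' y z rfl f s; rfl
  rw [up_act, bendArrow, id_tensor_comp, cap_eq, id_tensor_comp, id_tensor_up, id_tensor_dn]
  refine Eq.trans ?_ (X.assoc _ _ _).symm
  rw [tensor_assoc_comp]
  refine Eq.trans ?_ (X.assoc _ _ _).symm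
  rw [key, X.tensor_id]
  have h₁ : (fun i : Fin (k + a + b) => Fin.append (Fin.castAdd b)
      (Fin.append (fun i => Fin.castAdd b (x i)) (Fin.natAdd k)) (Fin.cast (Nat.add_assoc k a b) i)) =
      addFun (idAppend x) b := by
    refine (Fin.append_assoc _ _ _).symm.trans (congrArg₂ Fin.append ?_ rfl)
    funext i
    induction i using Fin.addCases <;> simp
  have h₂ : (fun i : Fin (k + a + a) => idAdd k (idAppend fun i : Fin a => i)
      (Fin.cast (Nat.add_assoc k a a) i)) = idAppend (Fin.natAdd k) := by
    funext i
    apply Fin.ext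
    simp only [Fin.val_cast, idAdd_val, append_val, Fin.val_natAdd]
    split_ifs <;> omega
  -- The arrow `o` touches only the last block and slides past the merges of the first `k + a`
  -- strands.
  have h₃ : X.comp (X.tensor (X.id (k + a)) o) (F.up (addFun (idAppend x) b)) =
      X.comp (F.up (addFun (idAppend x) a)) (X.tensor (X.id k) o) := by
    rw [← up_tensor_id, ← up_tensor_id, interchange, interchange']
  -- The cap supplies `a` fresh strands and their copies. By the Frobenius property, merging the
  -- fresh strands into `x` after copying equals merging first and then copying from `x`.
  have h₄ : X.comp (F.dn (idAppend (Fin.natAdd k))) (F.up (addFun (idAppend x) a)) =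
      X.comp (F.up (idAppend x)) (F.dn (idAppend x)) := by
    refine (F.padFrob.dn_idAppend_up (idAppend x) (Fin.natAdd k)).trans ?_
    exact congrArg (fun t => X.comp (F.up (idAppend x)) (F.dn (idAppend t)))
      (funext fun i => Fin.append_right _ _ i)
  -- Now the fresh strands are bare units merged into existing strands, and they vanish.
  have h₅ : X.comp (F.up (idAdd k (Fin.elim0 : Fin 0 → Fin a))) (F.up (idAppend x)) = X.id k := by
    rw [up_comp]
    refine Eq.trans (congrArg F.up ?_) (F.up_id k)
    funext i
    induction i using Fin.addCases with
    | left i => exact (congrArg _ (Fin.append_left _ _ i)).trans (Fin.append_left _ _ i)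
    | right i => exact i.elim0
  rw [h₁, h₂, h₃, ← X.assoc (F.dn _), h₄, X.assoc]
  refine Eq.trans ?_ (X.assoc _ _ _)
  rw [h₅, X.id_comp]

end PROPFrob
end StringRewriting

namespace StringRewriting

open PadMonoid (padFun idAdd)
open PadFrob (idAppend addFun)
open PROP PROPFrob

/-! ## Normal forms of the arrows of `𝐒_S + Frob` -/

theorem frob_arr_eq (S : Signature.{u}) {n m : ℕ} {f g : Term FrobGen.{u} n m} (h : FrobEq f g) :
    (synFrobSMT S).arr (f.map fun o => .inr o) = (synFrobSMT S).arr (g.map fun o => .inr o) :=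
  SMT.arr_eq (.ax (Or.inr ⟨f, g, h, rfl, rfl⟩))

/-- The Frobenius monoid of `𝐒_S + Frob`. -/
def synFrobenius (S : Signature.{u}) : PROPFrob (synFrob S) where
  mul := (synFrobSMT S).arr (.gen (.inr .mul))
  unit := (synFrobSMT S).arr (.gen (.inr .unit))
  comul := (synFrobSMT S).arr (.gen (.inr .comul))
  counit := (synFrobSMT S).arr (.gen (.inr .counit))
  mul_comm := frob_arr_eq S .mul_comm
  mul_assoc := frob_arr_eq S .mul_assoc
  unit_mul := frob_arr_eq S .unit_mul
  comul_comm := frob_arr_eq S .comul_comm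
  comul_assoc := frob_arr_eq S .comul_assoc
  counit_comul := frob_arr_eq S .counit_comul
  special := frob_arr_eq S .special
  frobenius_left := frob_arr_eq S .frobenius_left
  frobenius_right := frob_arr_eq S .frobenius_right

/-- A hyperedge on the nodes `Fin k`. -/
structure Edge (S : Signature.{u}) (k : ℕ) where
  a : ℕ
  b : ℕ
  o : S a b
  s : Fin a → Fin k
  t : Fin b → Fin k

namespace Edge

variable {S : Signature.{u}}

/-- Renaming of nodes. -/
def map {k l : ℕ} (f : Fin k → Fin l) (e : Edge S k) : Edge S l :=
  ⟨e.a, e.b, e.o, fun i => f (e.s i), fun i => f (e.t i)⟩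

/-- The action of a hyperedge on the strands that represent the nodes. -/
def arrow {k : ℕ} (e : Edge S k) : (synFrob S).Hom k k :=
  (synFrobenius S).act ((synFrobenius S).bendArrow ((synFrobSMT S).arr (.gen (.inl e.o))))
    (Fin.append e.s e.t)

theorem arrow_up {k l : ℕ} (e : Edge S k) (f : Fin k → Fin l) :
    (synFrob S).comp e.arrow ((synFrobenius S).up f) =
      (synFrob S).comp ((synFrobenius S).up f) (e.map f).arrow := by
  rw [arrow, act_up]
  congr 2
  funext i
  induction i using Fin.addCases <;> simp [map]

/-- The action of a list of hyperedges. -/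
def arrows {k : ℕ} : List (Edge S k) → (synFrob S).Hom k k
  | [] => (synFrob S).id k
  | e :: es => (synFrob S).comp e.arrow (arrows es)

theorem arrows_up {k l : ℕ} (es : List (Edge S k)) (f : Fin k → Fin l) :
    (synFrob S).comp (arrows es) ((synFrobenius S).up f) =
      (synFrob S).comp ((synFrobenius S).up f) (arrows (es.map (map f))) := by
  induction es with
  | nil => exact ((synFrob S).id_comp _).trans ((synFrob S).comp_id _).symm
  | cons e es ih =>
    rw [arrows, (synFrob S).assoc, ih, ← (synFrob S).assoc, arrow_up, (synFrob S).assoc]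
    rfl

theorem arrows_append {k : ℕ} (es es' : List (Edge S k)) :
    arrows (es ++ es') = (synFrob S).comp (arrows es) (arrows es') := by
  induction es with
  | nil => exact ((synFrob S).id_comp _).symm
  | cons e es ih => rw [List.cons_append, arrows, arrows, ih, (synFrob S).assoc]

/-- A permutation of a list is a chain of exchanges of neighbours, and neighbouring actions commute
by `act_comm`. -/
theorem arrows_perm {k : ℕ} {es es' : List (Edge S k)} (h : es.Perm es') :
    arrows es = arrows es' := by
  induction h with
  | nil => rfl
  | cons e _ ih => rw [arrows, arrows, ih]
  | swap e e' es =>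
    rw [arrows, arrows, arrows, arrows, ← (synFrob S).assoc, ← (synFrob S).assoc]
    exact congrArg (fun t => (synFrob S).comp t _) (act_comm _ _ _ _ _)
  | trans _ _ ih₁ ih₂ => exact ih₁.trans ih₂

end Edge

section NormalForm

variable {S : Signature.{u}}

/-- The arrow of a hypergraph with nodes `Fin k`, given by its legs and its hyperedges. -/
def normalForm {n m k : ℕ} (l : Fin n → Fin k) (es : List (Edge S k)) (r : Fin m → Fin k) :
    (synFrob S).Hom n m :=
  (synFrob S).comp ((synFrobenius S).up l)
    ((synFrob S).comp (Edge.arrows es) ((synFrobenius S).dn r))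

/-- Normal forms are invariant under isomorphism. -/
theorem normalForm_equiv {n m k k' : ℕ} (l : Fin n → Fin k) (es : List (Edge S k))
    (r : Fin m → Fin k) (σ : Fin k ≃ Fin k') {es' : List (Edge S k')}
    (h : (es.map (Edge.map σ)).Perm es') :
    normalForm (fun i => σ (l i)) es' (fun i => σ (r i)) = normalForm l es r := by
  rw [normalForm, normalForm, ← Edge.arrows_perm h, ← up_comp _ l σ, (synFrob S).assoc,
    ← (synFrob S).assoc _ (Edge.arrows _), ← Edge.arrows_up, ← dn_comp _ r σ, (synFrob S).assoc,
    ← (synFrob S).assoc ((synFrobenius S).up σ), up_dn_equiv, (synFrob S).id_comp]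

/-- The arrows in normal form. -/
def IsNormal {n m : ℕ} (x : (synFrob S).Hom n m) : Prop :=
  ∃ (k : ℕ) (l : Fin n → Fin k) (es : List (Edge S k)) (r : Fin m → Fin k), x = normalForm l es r

theorem IsNormal.castHom {n m n' m' : ℕ} (hn : n = n') (hm : m = m') {x : (synFrob S).Hom n m}
    (h : IsNormal x) : IsNormal (castHom (synFrob S).Hom hn hm x) := by
  subst hn hm; exact h

theorem isNormal_id (n : ℕ) : IsNormal ((synFrob S).id n) := by
  refine ⟨n, fun i => i, [], fun i => i, ?_⟩
  rw [normalForm, Edge.arrows, up_id, dn_id, (synFrob S).id_comp, (synFrob S).id_comp]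

/-- Only the right leg of `x` meets `y`. The merges `c` that this produces slide left past the
hyperedges of `x`, renaming their nodes, and end in the left leg. -/
theorem IsNormal.comp_of_dn {n m m' : ℕ} {x : (synFrob S).Hom n m} {y : (synFrob S).Hom m m'}
    (hx : IsNormal x)
    (hy : ∀ {k : ℕ} (r : Fin m → Fin k), ∃ (k' : ℕ) (c : Fin k → Fin k') (es : List (Edge S k'))
      (r' : Fin m' → Fin k'), (synFrob S).comp ((synFrobenius S).dn r) y = normalForm c es r') :
    IsNormal ((synFrob S).comp x y) := by
  obtain ⟨k, l, es, r, rfl⟩ := hx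
  obtain ⟨k', c, es', r', h⟩ := hy r
  refine ⟨k', fun i => c (l i), es.map (Edge.map c) ++ es', r', ?_⟩
  rw [normalForm, normalForm, (synFrob S).assoc, (synFrob S).assoc, h, normalForm,
    ← (synFrob S).assoc (Edge.arrows es), Edge.arrows_up, Edge.arrows_append, ← up_comp _ l c,
    (synFrob S).assoc, (synFrob S).assoc, (synFrob S).assoc]

theorem normalForm_nil {n m k : ℕ} (l : Fin n → Fin k) (r : Fin m → Fin k) :
    normalForm (S := S) l [] r =
      (synFrob S).comp ((synFrobenius S).up l) ((synFrobenius S).dn r) := by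
  rw [normalForm, Edge.arrows, (synFrob S).id_comp]

/-- The arrows that preserve normal forms when applied to the last strands. -/
def Preserves {n m : ℕ} (t : (synFrob S).Hom n m) : Prop :=
  ∀ (N c : ℕ) (x : (synFrob S).Hom N (c + n)), IsNormal x →
    IsNormal ((synFrob S).comp x ((synFrob S).tensor ((synFrob S).id c) t))

theorem preserves_dn {n m : ℕ} (w : Fin m → Fin n) : Preserves ((synFrobenius S).dn w) := by
  intro N c x hx
  refine hx.comp_of_dn fun r => ⟨_, fun i => i, [], fun i => r (idAdd c w i), ?_⟩
  rw [id_tensor_dn, dn_comp, normalForm_nil, up_id, (synFrob S).id_comp]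

theorem Preserves.comp {a b c : ℕ} {f : (synFrob S).Hom a b} {g : (synFrob S).Hom b c}
    (hf : Preserves f) (hg : Preserves g) : Preserves ((synFrob S).comp f g) := by
  intro N c x hx
  rw [id_tensor_comp, ← (synFrob S).assoc]
  exact hg N c _ (hf N c x hx)

/-- The `b` additional strands join the `c` idle ones; this is why `Preserves` quantifies over `c`.
-/
theorem Preserves.id_tensor {n m : ℕ} (b : ℕ) {g : (synFrob S).Hom n m} (hg : Preserves g) :
    Preserves ((synFrob S).tensor ((synFrob S).id b) g) := by
  intro N c x hx
  have key : ∀ {y y' z z' : ℕ} (hy : y = y') (hz : z = z') (x : (synFrob S).Hom N y')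
      (s : (synFrob S).Hom y z), (synFrob S).comp x (StringRewriting.castHom (synFrob S).Hom hy hz s) =
        StringRewriting.castHom (synFrob S).Hom rfl hz
          ((synFrob S).comp (StringRewriting.castHom (synFrob S).Hom rfl hy.symm x) s) := by
    rintro y y' z z' rfl rfl x s; rfl
  rw [id_add_tensor, key]
  exact (hg N (c + b) _ (hx.castHom _ _)).castHom _ _

theorem preserves_symm (a b : ℕ) : Preserves ((synFrob S).symm a b) := by
  rw [(synFrobenius S).symm_eq_dn]
  exact preserves_dn _

/-- Idle strands on the right are moved to the left by conjugating with block swaps, which preserve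
normal forms. -/
theorem Preserves.tensor_id {n m : ℕ} (b : ℕ) {f : (synFrob S).Hom n m} (hf : Preserves f) :
    Preserves ((synFrob S).tensor f ((synFrob S).id b)) := by
  have h : (synFrob S).tensor f ((synFrob S).id b) =
      (synFrob S).comp ((synFrob S).symm n b) ((synFrob S).comp
        ((synFrob S).tensor ((synFrob S).id b) f) ((synFrob S).symm b m)) := by
    rw [(synFrob S).symm_natural, ← (synFrob S).assoc, (synFrob S).symm_symm, (synFrob S).id_comp]
  rw [h]
  exact (preserves_symm n b).comp ((hf.id_tensor b).comp (preserves_symm b m))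

theorem preserves_mul : Preserves (synFrobenius S).mul := by
  intro N c x hx
  refine hx.comp_of_dn fun r => ?_
  obtain ⟨k', f, r', h⟩ := (synFrobenius S).padFrob.exists_dn_mu r
  exact ⟨k', f, [], r', h.trans (normalForm_nil _ _).symm⟩

/-- The unit adds a new last node, which no hyperedge and no point of the left leg meets, and lets
the new output point to it. -/
theorem preserves_unit : Preserves (synFrobenius S).unit := by
  intro N c x hx
  refine hx.comp_of_dn fun r => ⟨_, Fin.castSucc, [], padFun r, ?_⟩
  rw [normalForm_nil]
  exact ((synFrobenius S).monoid.et_nat _).trans (congrArg₂ (synFrob S).comp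
    ((synFrobenius S).monoid.et_eq_up _) ((synFrobenius S).padFrob.dn_padFun r).symm)

/-- A generator adds `b` new nodes as targets of a new hyperedge; its sources are the nodes that its
inputs already point to. -/
theorem preserves_gen {a b : ℕ} (o : S a b) :
    Preserves ((synFrobSMT S).arr (.gen (.inl o))) := by
  intro N c x hx
  refine hx.comp_of_dn fun {k} r => ?_
  -- The right leg factors as `[id, r₂] ∘ (r₁ ⊕ id_a)`: first the inputs of `o` are copied off all
  -- `k` nodes, then the `c` idle outputs are read off. The first factor is what `dn_idAppend_comp`
  -- needs.
  have hr : r = fun i => idAppend (fun i => r (Fin.natAdd c i))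
      (addFun (fun i => r (Fin.castAdd a i)) a i) := by
    funext i
    rw [idAppend_addFun]
    induction i using Fin.addCases <;> simp
  refine ⟨k + b, Fin.castAdd b, [⟨a, b, o, fun i => Fin.castAdd b (r (Fin.natAdd c i)),
    Fin.natAdd k⟩], addFun (fun i => r (Fin.castAdd a i)) b, ?_⟩
  conv_lhs => rw [hr]
  rw [← dn_comp _ (addFun (fun i => r (Fin.castAdd a i)) a)
    (idAppend fun i => r (Fin.natAdd c i)), (synFrob S).assoc, ← dn_tensor_id, interchange, ← interchange', ← (synFrob S).assoc,
    dn_idAppend_comp, normalForm, Edge.arrows, Edge.arrows, (synFrob S).comp_id, dn_tensor_id,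
    (synFrob S).assoc]
  rfl

theorem preserves_arr {n m : ℕ} (t : Term (synFrobSMT S).sig n m) :
    Preserves ((synFrobSMT S).arr t) := by
  induction t with
  | gen o =>
    rcases o with o | o
    · exact preserves_gen o
    · cases o with
      | mul => exact preserves_mul
      | unit => exact preserves_unit
      | comul => 
        have h := preserves_dn (S := S) (fun _ : Fin 2 => (0 : Fin 1))
        rwa [← comul_eq_dn] at h
      | counit => 
        have h := preserves_dn (S := S) (Fin.elim0 : Fin 0 → Fin 1)
        rwa [← counit_eq_dn] at h
  | id n => 
    have h := preserves_dn (S := S) (fun i : Fin n => i)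
    rwa [dn_id] at h
  | symm n m => exact preserves_symm n m
  | comp f g hf hg => exact hf.comp hg
  | tensor f g hf hg => 
    have h := (hf.tensor_id _).comp (hg.id_tensor _)
    rwa [interchange] at h

/-- Every arrow of `𝐒_S + Frob` has a normal form. -/
theorem isNormal {n m : ℕ} (x : (synFrob S).Hom n m) : IsNormal x := by
  obtain ⟨t, rfl⟩ : ∃ t, (synFrobSMT S).arr t = x := Quotient.exists_rep x
  have key : ∀ {y y' z : ℕ} (hy : y = y') (s : (synFrob S).Hom y' z),
      (synFrob S).comp (castHom (synFrob S).Hom rfl hy ((synFrob S).id y)) s =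
        castHom (synFrob S).Hom hy.symm rfl s := by
    rintro y y' z rfl s; exact (synFrob S).id_comp s
  -- An arrow is the identity followed by itself, with no idle strands; the casts compare `0 + n`
  -- with `n`.
  have h := preserves_arr t n 0 _ ((isNormal_id (S := S) n).castHom rfl (Nat.zero_add n).symm)
  rw [key] at h
  have h' := h.castHom rfl (Nat.zero_add m)
  rw [castHom_trans] at h'
  rwa [← (synFrob S).id_zero_tensor ((synFrobSMT S).arr t)]

end NormalForm

end StringRewriting

namespace StringRewriting

open PadMonoid (padFun idAdd snoc swFun)
open PadFrob (idAppend addFun)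
open Hyp

variable {S : Signature.{u}}

/-! ## The termgraphs of functions -/

/-- The class of the cospan `n ⟶ k ⟵ k` of a function `Fin n → Fin k`. -/
def funGraph (S : Signature.{u}) {n k : ℕ} (w : Fin n → Fin k) : (FTerm S).Hom n k :=
  Cospan.cls ⟨disc S k, ofFun w, 𝟙 _⟩

/-- The class of the cospan `k ⟶ k ⟵ n` of a function `Fin n → Fin k`. -/
def cofunGraph (S : Signature.{u}) {n k : ℕ} (w : Fin n → Fin k) : (FTerm S).Hom k n :=
  Cospan.cls ⟨disc S k, 𝟙 _, ofFun w⟩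

/-- One of the glued legs is an identity, so the pushout leaves the apex as it is. -/
theorem funGraph_comp_cls {n k m : ℕ} (w : Fin n → Fin k) (A : Cospan S k m) :
    (FTerm S).comp (funGraph S w) A.cls = (A.preLeft (ofFun w)).cls :=
  (Cospan.comp_equiv (Cospan.isComp_preLeft (ofFun w) A)).cls_eq

theorem cls_comp_cofunGraph {n k m : ℕ} (w : Fin n → Fin k) (A : Cospan S m k) :
    (FTerm S).comp A.cls (cofunGraph S w) = (A.preRight (ofFun w)).cls :=
  (Cospan.comp_equiv (Cospan.isComp_preRight A (ofFun w))).cls_eq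

theorem funGraph_comp {n k l : ℕ} (w : Fin n → Fin k) (v : Fin k → Fin l) :
    (FTerm S).comp (funGraph S w) (funGraph S v) = funGraph S (fun i => v (w i)) :=
  (funGraph_comp_cls w ⟨disc S l, ofFun v, 𝟙 _⟩).trans
    (congrArg (fun t => Cospan.cls ⟨disc S l, t, 𝟙 _⟩) (disc_hom_ext fun _ => rfl))

theorem cofunGraph_comp {n k l : ℕ} (w : Fin n → Fin k) (v : Fin k → Fin l) :
    (FTerm S).comp (cofunGraph S v) (cofunGraph S w) = cofunGraph S (fun i => v (w i)) :=
  (cls_comp_cofunGraph w ⟨disc S l, 𝟙 _, ofFun v⟩).trans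
    (congrArg (fun t => Cospan.cls ⟨disc S l, 𝟙 _, t⟩) (disc_hom_ext fun _ => rfl))

theorem discDesc_id (b d : ℕ) :
    discDesc (𝟙 (disc S b) ≫ discInl S b d) (𝟙 (disc S d) ≫ discInr S b d) = 𝟙 _ := by
  rw [Category.id_comp, Category.id_comp, Cospan.discDesc_id]

theorem funGraph_tensor {a b c d : ℕ} (f : Fin a → Fin b) (g : Fin c → Fin d) :
    (FTerm S).tensor (funGraph S f) (funGraph S g) = funGraph S (sumFun f g) := by
  refine (Cospan.tensor_disc _ _ _ _).cls_eq.trans ?_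
  rw [discDesc_id]
  rfl

theorem cofunGraph_tensor {a b c d : ℕ} (f : Fin a → Fin b) (g : Fin c → Fin d) :
    (FTerm S).tensor (cofunGraph S f) (cofunGraph S g) = cofunGraph S (sumFun f g) := by
  refine (Cospan.tensor_disc _ _ _ _).cls_eq.trans ?_
  rw [discDesc_id]
  rfl

theorem id_eq_funGraph (n : ℕ) : (FTerm S).id n = funGraph S fun i => i :=
  congrArg (fun t => Cospan.cls ⟨disc S n, t, 𝟙 _⟩) (disc_hom_ext fun _ => rfl)

theorem id_eq_cofunGraph (n : ℕ) : (FTerm S).id n = cofunGraph S fun i => i :=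
  congrArg (fun t => Cospan.cls ⟨disc S n, 𝟙 _, t⟩) (disc_hom_ext fun _ => rfl)

theorem symm_eq_funGraph (n m : ℕ) : (FTerm S).symm n m = funGraph S (blockSwap n m) :=
  (Cospan.symm_equiv n m).cls_eq

theorem symm_eq_cofunGraph (n m : ℕ) : (FTerm S).symm n m = cofunGraph S (blockSwap m n) := rfl

theorem spider_left (n : ℕ) : (spider S n 1).cls = funGraph S fun _ : Fin n => (0 : Fin 1) :=
  Cospan.Equiv.cls_eq ⟨Iso.refl _, to_one_ext _ _, to_one_ext _ _⟩

theorem spider_right (n : ℕ) : (spider S 1 n).cls = cofunGraph S fun _ : Fin n => (0 : Fin 1) :=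
  Cospan.Equiv.cls_eq ⟨Iso.refl _, to_one_ext _ _, to_one_ext _ _⟩

theorem snoc_val {n k : ℕ} (w : Fin n → Fin k) (v : Fin k) (i : Fin (n + 1)) :
    (snoc w v i).val = if h : i.val < n then (w ⟨i.val, h⟩).val else v.val := by
  induction i using Fin.lastCases <;> simp [snoc]

/-- `Φ` sends multiplication, unit and symmetries to cospans of functions, and such cospans compose
and add as functions do. Along the recursion that defines `up` only equalities of functions on `Fin`
remain. -/
theorem Phi_up {n k : ℕ} (w : Fin n → Fin k) :
    (Phi S).map ((synFrobenius S).up w) = funGraph S w := by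
  have hmul : (Phi S).map (synFrobenius S).mul = funGraph S fun _ : Fin 2 => (0 : Fin 1) :=
    spider_left 2
  have hunit : (Phi S).map (synFrobenius S).unit = funGraph S fun _ : Fin 0 => (0 : Fin 1) :=
    spider_left 0
  have hins : ∀ {k : ℕ} (v : Fin k),
      (Phi S).map ((synFrobenius S).ins v) = funGraph S (snoc (fun i => i) v) := by
    intro k
    induction k with
    | zero => exact fun v => v.elim0
    | succ k ih =>
      intro v
      induction v using Fin.lastCases with
      | last =>
        rw [PROPFrob.ins_last, (Phi S).map_tensor, hmul, (Phi S).map_id, id_eq_funGraph,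
          funGraph_tensor]
        congr 1
        funext i
        apply Fin.ext
        simp only [snoc_val, sumFun_val, Fin.val_last, Fin.val_zero]
        have := i.isLt
        split_ifs <;> first | rfl | omega
      | cast v =>
        rw [PROPFrob.ins_castSucc, (Phi S).map_comp, (Phi S).map_tensor, (Phi S).map_tensor,
          (Phi S).map_symm, (Phi S).map_id, (Phi S).map_id, ih, symm_eq_funGraph,
          id_eq_funGraph, id_eq_funGraph, funGraph_tensor, funGraph_tensor]
        refine (funGraph_comp _ _).trans ?_
        congr 1
        funext i
        apply Fin.ext
        simp only [snoc_val, sumFun_val, blockSwap_val, Fin.val_castSucc]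
        have := i.isLt
        split_ifs <;> first | rfl | omega
  induction n with
  | zero =>
    induction k with
    | zero =>
      rw [PROPFrob.up_of_zero, (Phi S).map_id, id_eq_funGraph]
      exact congrArg (funGraph S) (funext fun i => i.elim0)
    | succ k ih =>
      rw [PROPFrob.up_of_zero_succ, (Phi S).map_comp, ih, (Phi S).map_tensor, hunit,
        (Phi S).map_id, id_eq_funGraph, funGraph_tensor]
      exact (funGraph_comp _ _).trans (congrArg (funGraph S) (funext fun i => i.elim0))
  | succ n ih =>
    rw [PROPFrob.up_succ, (Phi S).map_comp, (Phi S).map_tensor, hins, ih, (Phi S).map_id,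
      id_eq_funGraph, funGraph_tensor, funGraph_comp]
    congr 1
    funext i
    apply Fin.ext
    simp only [snoc_val, sumFun_val]
    have := i.isLt
    split_ifs <;> first | rfl | omega | (congr 2; apply Fin.ext; simp; omega)

theorem Phi_dn {n k : ℕ} (w : Fin n → Fin k) :
    (Phi S).map ((synFrobenius S).dn w) = cofunGraph S w := by
  have hcomul : (Phi S).map (synFrobenius S).comul = cofunGraph S fun _ : Fin 2 => (0 : Fin 1) :=
    spider_right 2
  have hcounit : (Phi S).map (synFrobenius S).counit =
      cofunGraph S fun _ : Fin 0 => (0 : Fin 1) :=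
    spider_right 0
  have hcop : ∀ {k : ℕ} (v : Fin k),
      (Phi S).map ((synFrobenius S).cop v) = cofunGraph S (snoc (fun i => i) v) := by
    intro k
    induction k with
    | zero => exact fun v => v.elim0
    | succ k ih =>
      intro v
      induction v using Fin.lastCases with
      | last =>
        rw [PROPFrob.cop_last, (Phi S).map_tensor, hcomul, (Phi S).map_id, id_eq_cofunGraph,
          cofunGraph_tensor]
        congr 1
        funext i
        apply Fin.ext
        simp only [snoc_val, sumFun_val, Fin.val_last, Fin.val_zero]
        have := i.isLt
        split_ifs <;> first | rfl | omega
      | cast v =>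
        rw [PROPFrob.cop_castSucc, (Phi S).map_comp, (Phi S).map_tensor, (Phi S).map_tensor,
          (Phi S).map_symm, (Phi S).map_id, (Phi S).map_id, ih, symm_eq_cofunGraph,
          id_eq_cofunGraph, id_eq_cofunGraph, cofunGraph_tensor, cofunGraph_tensor]
        refine (cofunGraph_comp _ _).trans ?_
        congr 1
        funext i
        apply Fin.ext
        simp only [snoc_val, sumFun_val, blockSwap_val, Fin.val_castSucc]
        have := i.isLt
        split_ifs <;> first | rfl | omega
  induction n with
  | zero =>
    induction k with
    | zero =>
      rw [PROPFrob.dn_of_zero, (Phi S).map_id, id_eq_cofunGraph]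
      exact congrArg (cofunGraph S) (funext fun i => i.elim0)
    | succ k ih =>
      rw [PROPFrob.dn_of_zero_succ, (Phi S).map_comp, ih, (Phi S).map_tensor, hcounit,
        (Phi S).map_id, id_eq_cofunGraph, cofunGraph_tensor]
      exact (cofunGraph_comp _ _).trans (congrArg (cofunGraph S) (funext fun i => i.elim0))
  | succ n ih =>
    rw [PROPFrob.dn_succ, (Phi S).map_comp, (Phi S).map_tensor, hcop, ih, (Phi S).map_id,
      id_eq_cofunGraph, cofunGraph_tensor, cofunGraph_comp]
    congr 1
    funext i
    apply Fin.ext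
    simp only [snoc_val, sumFun_val]
    have := i.isLt
    split_ifs <;> first | rfl | omega | (congr 2; apply Fin.ext; simp; omega)

/-! ## Bending of termgraphs -/

/-- The cospan `0 ⟶ G ⟵ n + m` that corresponds to `n ⟶ G ⟵ m`. -/
def Cospan.bent {n m : ℕ} (A : Cospan S n m) : Cospan S 0 (n + m) :=
  ⟨A.apex, ofFun Fin.elim0, discDesc A.left A.right⟩

/-- The codiagonal identifies the `n` free nodes of the disjoint union with the images of the left
leg, so only `A.apex` survives. -/
theorem isPushout_bent {n m : ℕ} (A : Cospan S n m) :
    IsPushout (ofFun (idAppend fun i => i) : disc S (n + n) ⟶ disc S n)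
      (discDesc (𝟙 (disc S n) ≫ inl _ _) (A.left ≫ inr _ _)) A.left (desc A.left (𝟙 A.apex)) := by
  have hl : discInl S n n ≫ (ofFun (idAppend fun i => i) : disc S (n + n) ⟶ disc S n) = 𝟙 _ :=
    disc_hom_ext fun i => Fin.append_left (fun i : Fin n => i) (fun i : Fin n => i) i
  have hr : discInr S n n ≫ (ofFun (idAppend fun i => i) : disc S (n + n) ⟶ disc S n) = 𝟙 _ :=
    disc_hom_ext fun i => Fin.append_right (fun i : Fin n => i) (fun i : Fin n => i) i
  refine isPushout_of_desc ?_ ?_ ?_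
  · apply disc_add_hom_ext
    · rw [← Category.assoc, hl]; simp
    · rw [← Category.assoc, hr]; simp
  · intro K s t w
    have w₁ := congrArg (fun f => discInl S _ _ ≫ f) w
    have w₂ := congrArg (fun f => discInr S _ _ ≫ f) w
    simp only [discInl_discDesc_assoc, discInr_discDesc_assoc, Category.assoc] at w₁ w₂
    rw [← Category.assoc, hl] at w₁
    rw [← Category.assoc, hr] at w₂
    simp only [Category.id_comp] at w₁ w₂
    refine ⟨inr _ _ ≫ t, w₂.symm, ?_⟩
    apply sum_hom_ext
    · rw [inl_desc_assoc, ← w₂, w₁]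
    · simp
  · intro K u u' _ h
    have := congrArg (fun f => inr _ _ ≫ f) h
    simpa using this

theorem Phi_bend {n m : ℕ} {d : (synFrob S).Hom n m} {A : Cospan S n m}
    (h : (Phi S).map d = A.cls) : (Phi S).map (bend d) = A.bent.cls := by
  rw [bend, (Phi S).map_comp, (Phi S).map_tensor, (Phi S).map_id, h,
    show (synFrob S).cap (frobCap S) n = _ from (synFrobenius S).cap_eq n, (Phi S).map_comp,
    Phi_up, Phi_dn]
  refine (congrArg (fun t => (FTerm S).comp t _) (funGraph_comp_cls _ _)).trans ?_
  refine (Cospan.comp_equiv ?_).cls_eq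
  refine ⟨A.left, desc A.left (𝟙 A.apex), isPushout_bent A, disc_hom_ext fun i => i.elim0, ?_⟩
  change discDesc (𝟙 (disc S n) ≫ inl _ _) (A.right ≫ inr _ _) ≫ desc A.left (𝟙 A.apex) =
    discDesc A.left A.right
  apply disc_add_hom_ext <;> simp

/-! ## The termgraphs of normal forms -/

/-- The hyperedges of type `o` in a family. -/
inductive FamilyEdge {k p : ℕ} (f : Fin p → Edge S k) : ∀ {a b : ℕ}, S a b → Type
  | mk (i : Fin p) : FamilyEdge f (f i).o

namespace FamilyEdge

variable {k p : ℕ} {f : Fin p → Edge S k}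

/-- The sources of a hyperedge. -/
def src : ∀ {a b : ℕ} {o : S a b}, FamilyEdge f o → Fin a → Fin k
  | _, _, _, .mk i => (f i).s

/-- The targets of a hyperedge. -/
def tgt : ∀ {a b : ℕ} {o : S a b}, FamilyEdge f o → Fin b → Fin k
  | _, _, _, .mk i => (f i).t

/-- The index of a hyperedge. -/
def index : ∀ {a b : ℕ} {o : S a b}, FamilyEdge f o → Fin p
  | _, _, _, .mk i => i

theorem apply_index {a b : ℕ} {o : S a b} (e : FamilyEdge f o) :
    f e.index = ⟨a, b, o, e.src, e.tgt⟩ := by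
  cases e; rfl

/-- The type of a hyperedge depends on its label, so hyperedges with different presentations of that
label can be compared only in the total space. -/
theorem sigma_eq {a b : ℕ} {o : S a b} (e : FamilyEdge f o) :
    (⟨a, b, o, e⟩ : (a : ℕ) × (b : ℕ) × (o : S a b) × FamilyEdge f o) =
      ⟨_, _, _, .mk e.index⟩ := by
  cases e; rfl

theorem index_injective {a b : ℕ} {o : S a b} {e e' : FamilyEdge f o} (h : e.index = e'.index) :
    e = e' := by
  have := (sigma_eq e).trans ((by rw [h]) : _ = _) |>.trans (sigma_eq e').symm
  simpa using this

/-- Functions on the hyperedges of a family. -/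
def elim {E : ∀ {a b : ℕ}, S a b → Type} (g : ∀ i, E (f i).o) :
    ∀ {a b : ℕ} {o : S a b}, FamilyEdge f o → E o
  | _, _, _, .mk i => g i

end FamilyEdge

/-- The hypergraph with nodes `Fin k` and the hyperedges of a family. -/
def familyGraph {k p : ℕ} (f : Fin p → Edge S k) : Hyp S where
  V := Fin k
  E o := FamilyEdge f o
  src e := e.src
  tgt e := e.tgt
  finite_V := inferInstance
  finite_E := Finite.of_surjective (α := Fin p) (fun i => ⟨_, _, _, .mk i⟩) (by
    rintro ⟨a, b, o, e⟩
    exact ⟨e.index, (FamilyEdge.sigma_eq e).symm⟩)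

namespace familyGraph

variable {k p : ℕ} {f : Fin p → Edge S k} {K : Hyp S}

/-- Homomorphisms out of the hypergraph of a family. -/
def lift (φ : Fin k → K.V) (g : ∀ i, K.E (f i).o)
    (hs : ∀ i j, K.src (g i) j = φ ((f i).s j)) (ht : ∀ i j, K.tgt (g i) j = φ ((f i).t j)) :
    familyGraph f ⟶ K :=
  Hom.mk φ (fun e => FamilyEdge.elim (E := K.E) g e) (by rintro a b o ⟨i⟩ j; exact hs i j)
    (by rintro a b o ⟨i⟩ j; exact ht i j)

theorem ext {u v : familyGraph f ⟶ K} (hV : ∀ i : Fin k, u.onV i = v.onV i)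
    (hE : ∀ i, u.onE (FamilyEdge.mk i : FamilyEdge f _) = v.onE (FamilyEdge.mk i : FamilyEdge f _)) :
    u = v :=
  hom_ext hV (by rintro a b o ⟨i⟩; exact hE i)

end familyGraph

end StringRewriting

namespace StringRewriting

open PadFrob (idAppend addFun)
open Hyp

variable {S : Signature.{u}}

theorem Hyp.congr_onV {G H : Hyp S} {f g : G ⟶ H} (h : f = g) (v : G.V) : f.onV v = g.onV v := by
  rw [h]

theorem Hyp.congr_onE {G H : Hyp S} {f g : G ⟶ H} (h : f = g) {a b : ℕ} {o : S a b} (e : G.E o) :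
    f.onE e = g.onE e := by
  rw [h]

/-- The cospan of a family of hyperedges. -/
def familyCospan {n m k p : ℕ} (l : Fin n → Fin k) (f : Fin p → Edge S k) (r : Fin m → Fin k) :
    Cospan S n m :=
  ⟨familyGraph f, ofFun l, ofFun r⟩

/-- The hypergraph of a generator as part of the hypergraph of a single hyperedge. -/
def genToFamily {k : ℕ} (e : Edge S k) : (genCospan e.o).apex ⟶ familyGraph fun _ : Fin 1 => e :=
  Hom.mk (Sum.elim e.s e.t) (fun x => match x with | .edge => FamilyEdge.mk 0)
    (by rintro a b o ⟨⟩ i; rfl) (by rintro a b o ⟨⟩ i; rfl)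

/-- The endpoints of the hyperedge of a generator are free; gluing along `[id, [s, t]]` attaches
them to the prescribed nodes and adds none. This is the pushout that computes `Φ` on the action of a
hyperedge. -/
theorem isPushout_edge {k : ℕ} (e : Edge S k) :
    IsPushout
      (discDesc (𝟙 (disc S k) ≫ inl (disc S k) (genCospan e.o).apex)
        (discDesc (genCospan e.o).left (genCospan e.o).right ≫
          inr (disc S k) (genCospan e.o).apex))
      (ofFun (idAppend (Fin.append e.s e.t)) : disc S (k + (e.a + e.b)) ⟶ disc S k)
      (desc (ofFun fun i => i) (genToFamily e))
      (ofFun fun i => i : disc S k ⟶ familyGraph fun _ : Fin 1 => e) := by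
  have hz : (ofFun (idAppend (Fin.append e.s e.t)) : disc S (k + (e.a + e.b)) ⟶ disc S k) =
      discDesc (𝟙 _) (discDesc (ofFun e.s) (ofFun e.t)) := rfl
  rw [hz]
  refine isPushout_of_desc ?_ ?_ ?_
  · apply disc_add_hom_ext
    · simp
    · apply disc_add_hom_ext
      · simp
        exact disc_hom_ext fun _ => rfl
      · simp
        exact disc_hom_ext fun _ => rfl
  · intro K s t w
    have w₁ := congrArg (fun f => discInl S _ _ ≫ f) w
    have w₂ := congrArg (fun f => discInr S _ _ ≫ f) w
    simp only [discInl_discDesc_assoc, discInr_discDesc_assoc, Category.assoc,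
      Category.id_comp] at w₁ w₂
    have w₃ := congrArg (fun f => discInl S _ _ ≫ f) w₂
    have w₄ := congrArg (fun f => discInr S _ _ ≫ f) w₂
    simp only [discInl_discDesc_assoc, discInr_discDesc_assoc] at w₃ w₄
    have h₁ : ∀ v : Fin k, s.onV (.inl v) = t.onV v := fun v => congr_onV w₁ v
    have h₃ : ∀ v : Fin e.a, s.onV (.inr (.inl v)) = t.onV (e.s v) := fun v => congr_onV w₃ v
    have h₄ : ∀ v : Fin e.b, s.onV (.inr (.inr v)) = t.onV (e.t v) := fun v => congr_onV w₄ v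
    -- On nodes a cocone is determined by `t`; from `s` only the image of the one hyperedge is
    -- needed.
    refine ⟨familyGraph.lift t.onV (fun _ => s.onE (Sum.inr SingleEdge.edge))
      (fun _ j => (s.src_onE _ _).trans (h₃ j)) (fun _ j => (s.tgt_onE _ _).trans (h₄ j)), ?_, ?_⟩
    · apply sum_hom_ext
      · exact disc_hom_ext fun v => (h₁ v).symm
      · refine hom_ext ?_ ?_
        · rintro (v | v)
          exacts [(h₃ v).symm, (h₄ v).symm]
        · rintro a b o ⟨⟩
          rfl
    · exact disc_hom_ext fun _ => rfl
  · intro K u u' h₁ h₂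
    refine familyGraph.ext (fun i => congr_onV h₂ i) fun i => ?_
    obtain rfl : i = 0 := Subsingleton.elim _ _
    exact congr_onE h₁ (o := e.o) (Sum.inr SingleEdge.edge)

/-- Gluing along all `k` nodes identifies the node sets and puts the hyperedges side by side. -/
theorem isPushout_cons {k p : ℕ} (f : Fin (p + 1) → Edge S k) :
    IsPushout (ofFun fun i => i : disc S k ⟶ familyGraph fun _ : Fin 1 => f 0)
      (ofFun fun i => i : disc S k ⟶ familyGraph fun i => f i.succ)
      (familyGraph.lift (fun i => i) (fun _ => FamilyEdge.mk 0) (fun _ _ => rfl) (fun _ _ => rfl))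
      (familyGraph.lift (K := familyGraph f) (fun i => i) (fun i => FamilyEdge.mk i.succ)
        (fun _ _ => rfl) (fun _ _ => rfl)) := by
  refine isPushout_of_desc (disc_hom_ext fun _ => rfl) ?_ ?_
  · intro K s t w
    have h : ∀ v : Fin k, s.onV v = t.onV v := fun v => congr_onV w v
    refine ⟨familyGraph.lift s.onV
      (Fin.cases (s.onE (.mk 0 : FamilyEdge (fun _ : Fin 1 => f 0) _))
        fun i => t.onE (.mk i : FamilyEdge (fun i => f i.succ) _)) ?_ ?_, ?_, ?_⟩
    · intro i j
      induction i using Fin.cases with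
      | zero => exact s.src_onE _ _
      | succ i => exact (t.src_onE _ _).trans (h _).symm
    · intro i j
      induction i using Fin.cases with
      | zero => exact s.tgt_onE _ _
      | succ i => exact (t.tgt_onE _ _).trans (h _).symm
    · refine familyGraph.ext (fun _ => rfl) fun i => ?_
      obtain rfl : i = 0 := Subsingleton.elim _ _
      rfl
    · exact familyGraph.ext (fun v => h v) fun i => rfl
  · intro K u u' h₁ h₂
    refine familyGraph.ext (fun i => congr_onV h₁ i) fun i => ?_
    induction i using Fin.cases with
    | zero =>
      exact congr_onE h₁ (.mk 0 : FamilyEdge (fun _ : Fin 1 => f 0) _)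
    | succ i =>
      exact congr_onE h₂ (.mk i : FamilyEdge (fun i => f i.succ) _)

theorem Phi_arrow {k : ℕ} (e : Edge S k) : (Phi S).map e.arrow =
    (familyCospan (fun i => i) (fun _ : Fin 1 => e) fun i => i).cls := by
  have h : (Phi S).map ((synFrobenius S).bendArrow ((synFrobSMT S).arr (.gen (.inl e.o)))) =
      (genCospan e.o).bent.cls := Phi_bend rfl
  rw [Edge.arrow, PROPFrob.act, (Phi S).map_comp, (Phi S).map_tensor, (Phi S).map_id, h, Phi_up]
  refine (Cospan.comp_equiv (C := familyCospan (fun i => i) (fun _ : Fin 1 => e) fun i => i)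
    ⟨_, _, isPushout_edge e, ?_, ?_⟩).cls_eq
  · refine disc_hom_ext fun i => ?_
    have := congrArg (fun f => Hom.onV f i)
      (discInl_discDesc (𝟙 (disc S k) ≫ inl _ (genCospan e.o).apex)
        ((genCospan e.o).bent.left ≫ inr _ _))
    exact congrArg (desc (ofFun fun i => i) (genToFamily e)).onV this
  · exact Category.id_comp _

theorem Phi_arrows {k p : ℕ} (f : Fin p → Edge S k) : (Phi S).map (Edge.arrows (List.ofFn f)) =
    (familyCospan (fun i => i) f fun i => i).cls := by
  induction p with
  | zero =>
    rw [List.ofFn_zero, Edge.arrows, (Phi S).map_id]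
    refine Cospan.Equiv.cls_eq ⟨⟨ofFun fun i => i, familyGraph.lift (fun i => i) (fun i => i.elim0)
      (fun i => i.elim0) (fun i => i.elim0), ?_, ?_⟩, ?_, ?_⟩
    · exact disc_hom_ext fun _ => rfl
    · exact familyGraph.ext (fun _ => rfl) fun i => i.elim0
    · exact disc_hom_ext fun _ => rfl
    · exact disc_hom_ext fun _ => rfl
  | succ p ih =>
    rw [List.ofFn_succ, Edge.arrows, (Phi S).map_comp, Phi_arrow, ih]
    exact (Cospan.comp_equiv (C := familyCospan (fun i => i) f fun i => i)
      ⟨_, _, isPushout_cons f, disc_hom_ext fun _ => rfl, disc_hom_ext fun _ => rfl⟩).cls_eq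

theorem Phi_normalForm {n m k p : ℕ} (l : Fin n → Fin k) (f : Fin p → Edge S k)
    (r : Fin m → Fin k) :
    (Phi S).map (normalForm l (List.ofFn f) r) = (familyCospan l f r).cls := by
  rw [normalForm, (Phi S).map_comp, (Phi S).map_comp, Phi_up, Phi_dn, Phi_arrows,
    cls_comp_cofunGraph, funGraph_comp_cls]
  refine congrArg Cospan.cls ?_
  rw [familyCospan, Cospan.preLeft, Cospan.preRight, familyCospan]
  congr 1
  · exact disc_hom_ext fun _ => rfl
  · exact disc_hom_ext fun _ => rfl

/-! ## `Φ` is an isomorphism -/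

/-- A bijective homomorphism is an isomorphism. -/
theorem Hyp.exists_iso_of_bijective {G H : Hyp S} (φ : G ⟶ H) (hV : Function.Bijective φ.onV)
    (hE : ∀ {a b : ℕ} (o : S a b), Function.Bijective (φ.onE : G.E o → H.E o)) :
    ∃ i : G ≅ H, i.hom = φ := by
  let eV := Equiv.ofBijective _ hV
  let eE := fun {a b : ℕ} (o : S a b) => Equiv.ofBijective _ (hE o)
  refine ⟨⟨φ, Hom.mk eV.symm (fun {a b o} e => (eE o).symm e) ?_ ?_, ?_, ?_⟩, rfl⟩
  · intro a b o e i
    apply hV.1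
    rw [← φ.src_onE]
    exact (congrArg (fun x => H.src x i) ((eE o).apply_symm_apply e)).trans
      (eV.apply_symm_apply _).symm
  · intro a b o e i
    apply hV.1
    rw [← φ.tgt_onE]
    exact (congrArg (fun x => H.tgt x i) ((eE o).apply_symm_apply e)).trans
      (eV.apply_symm_apply _).symm
  · exact hom_ext (fun v => eV.symm_apply_apply v) fun {a b o} e => (eE o).symm_apply_apply e
  · exact hom_ext (fun v => eV.apply_symm_apply v) fun {a b o} e => (eE o).apply_symm_apply e

/-- Every cospan is isomorphic to the cospan of a family of hyperedges. -/
theorem exists_familyCospan {n m : ℕ} (A : Cospan S n m) :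
    ∃ (k p : ℕ) (l : Fin n → Fin k) (f : Fin p → Edge S k) (r : Fin m → Fin k),
      (familyCospan l f r).Equiv A := by
  have := A.apex.finite_V
  have := A.apex.finite_E
  obtain ⟨k, ⟨σ⟩⟩ := Finite.exists_equiv_fin A.apex.V
  obtain ⟨p, ⟨τ⟩⟩ := Finite.exists_equiv_fin
    ((a : ℕ) × (b : ℕ) × (o : S a b) × A.apex.E o)
  let f : Fin p → Edge S k := fun i => ⟨(τ.symm i).1, (τ.symm i).2.1, (τ.symm i).2.2.1,
    fun j => σ (A.apex.src (τ.symm i).2.2.2 j), fun j => σ (A.apex.tgt (τ.symm i).2.2.2 j)⟩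
  let φ : familyGraph f ⟶ A.apex := familyGraph.lift σ.symm (fun i => (τ.symm i).2.2.2)
    (fun i j => (σ.symm_apply_apply _).symm) (fun i j => (σ.symm_apply_apply _).symm)
  have hφ : ∀ {a b : ℕ} {o : S a b} (e : FamilyEdge f o),
      τ.symm e.index = ⟨a, b, o, φ.onE e⟩ := by
    rintro a b o ⟨i⟩; rfl
  obtain ⟨i, hi⟩ := Hyp.exists_iso_of_bijective φ σ.symm.bijective (by
    intro a b o
    constructor
    · intro e e' h
      apply FamilyEdge.index_injective
      apply τ.symm.injective
      refine (hφ e).trans (Eq.trans ?_ (hφ e').symm)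
      rw [h]
    · intro e
      -- The label of the hyperedge numbered `i` agrees with `o` only propositionally. With an
      -- arbitrary total element `y` in place of `⟨a, b, o, e⟩`, the equation can be substituted
      -- away.
      have key : ∀ (y : (a : ℕ) × (b : ℕ) × (o : S a b) × A.apex.E o) (i : Fin p),
          τ.symm i = y → ∃ x : FamilyEdge f y.2.2.1, φ.onE x = y.2.2.2 := by
        rintro _ i rfl
        exact ⟨.mk i, rfl⟩
      exact key ⟨a, b, o, e⟩ (τ ⟨a, b, o, e⟩) (τ.symm_apply_apply _))
  refine ⟨k, p, fun i => σ (A.left.onV i), f, fun i => σ (A.right.onV i), i, ?_, ?_⟩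
  · rw [hi]
    exact disc_hom_ext fun i => σ.symm_apply_apply _
  · rw [hi]
    exact disc_hom_ext fun i => σ.symm_apply_apply _

/-- An isomorphism consists of a bijection `σ` of nodes and a bijection `τ` of hyperedges. The first
is absorbed by `normalForm_equiv`, and the second says that the renamed list is a permutation of the
other. -/
theorem normalForm_eq_of_equiv {n m k k' p p' : ℕ} {l : Fin n → Fin k} {f : Fin p → Edge S k}
    {r : Fin m → Fin k} {l' : Fin n → Fin k'} {f' : Fin p' → Edge S k'} {r' : Fin m → Fin k'}
    (h : (familyCospan l f r).Equiv (familyCospan l' f' r')) :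
    normalForm l (List.ofFn f) r = normalForm l' (List.ofFn f') r' := by
  obtain ⟨φ, hl, hr⟩ := h
  let σ : Fin k ≃ Fin k' := ⟨φ.hom.onV, φ.inv.onV,
    fun v => congr_onV φ.hom_inv_id v, fun v => congr_onV φ.inv_hom_id v⟩
  -- Passing to the index and back replaces the label `o` by `(f' i).o`; `hi` and `hh` say that the
  -- homomorphisms do not notice, as needed for `τ` to be a bijection.
  have hi : ∀ {a b : ℕ} {o : S a b} (e : FamilyEdge f' o),
      FamilyEdge.index (f := f) (φ.inv.onE (FamilyEdge.mk e.index : FamilyEdge f' _)) =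
        FamilyEdge.index (f := f) (φ.inv.onE e) := by
    rintro a b o ⟨i⟩; rfl
  have hh : ∀ {a b : ℕ} {o : S a b} (e : FamilyEdge f o),
      FamilyEdge.index (f := f') (φ.hom.onE (FamilyEdge.mk e.index : FamilyEdge f _)) =
        FamilyEdge.index (f := f') (φ.hom.onE e) := by
    rintro a b o ⟨i⟩; rfl
  let τ : Fin p ≃ Fin p' :=
    ⟨fun i => FamilyEdge.index (f := f') (φ.hom.onE (FamilyEdge.mk i : FamilyEdge f _)),
    fun i => FamilyEdge.index (f := f) (φ.inv.onE (FamilyEdge.mk i : FamilyEdge f' _)),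
    fun i => (hi (o := (f i).o) (φ.hom.onE (FamilyEdge.mk i : FamilyEdge f _))).trans
      (congrArg (FamilyEdge.index (f := f))
        (congr_onE φ.hom_inv_id (FamilyEdge.mk i : FamilyEdge f _))),
    fun i => (hh (o := (f' i).o) (φ.inv.onE (FamilyEdge.mk i : FamilyEdge f' _))).trans
      (congrArg (FamilyEdge.index (f := f'))
        (congr_onE φ.inv_hom_id (FamilyEdge.mk i : FamilyEdge f' _)))⟩
  have hτ : (fun i => (f i).map σ) = fun i => f' (τ i) := by
    funext i
    refine Eq.trans ?_ (FamilyEdge.apply_index (f := f') (o := (f i).o)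
      (φ.hom.onE (FamilyEdge.mk i : FamilyEdge f _))).symm
    rw [Edge.map]
    congr 1
    · exact funext fun j => (φ.hom.src_onE (FamilyEdge.mk i : FamilyEdge f _) j).symm
    · exact funext fun j => (φ.hom.tgt_onE (FamilyEdge.mk i : FamilyEdge f _) j).symm
  obtain rfl : p = p' := by simpa using Fintype.card_congr τ
  have hp : ((List.ofFn f).map (Edge.map σ)).Perm (List.ofFn f') := by
    rw [List.map_ofFn]
    have : Edge.map σ ∘ f = f' ∘ τ := hτ
    rw [this]
    exact Equiv.Perm.ofFn_comp_perm τ f'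
  rw [← normalForm_equiv l (List.ofFn f) r σ hp]
  congr 1
  · exact funext fun i => congr_onV hl i
  · exact funext fun i => congr_onV hr i

/-- Injectivity: two arrows in normal form with equal images come from isomorphic cospans, hence
coincide. Surjectivity: each cospan is isomorphic to an enumerated one, the image of its normal
form. -/
theorem Phi_isIso (S : Signature.{u}) : (Phi S).IsIso := by
  intro n m
  constructor
  · intro x y h
    obtain ⟨k, l, es, r, rfl⟩ := isNormal x
    obtain ⟨k', l', es', r', rfl⟩ := isNormal y
    rw [← List.ofFn_get es, ← List.ofFn_get es'] at h ⊢
    have h' := (Phi_normalForm l es.get r).symm.trans (h.trans (Phi_normalForm l' es'.get r'))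
    exact normalForm_eq_of_equiv (Quotient.exact (s := Cospan.setoid S n m) h')
  · intro y
    obtain ⟨A, rfl⟩ : ∃ A : Cospan S n m, A.cls = y := Quotient.exists_rep y
    obtain ⟨k, p, l, f, r, h⟩ := exists_familyCospan A
    exact ⟨_, (Phi_normalForm l f r).trans h.cls_eq⟩

end StringRewriting

namespace StringRewriting

open Hyp

variable {S : Signature.{u}}

/-! ## Rewriting steps and double pushouts -/

theorem Hyp.discDesc_eta {n m : ℕ} {G : Hyp S} (f : disc S (n + m) ⟶ G) :
    discDesc (discInl S n m ≫ f) (discInr S n m ≫ f) = f := by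
  apply disc_add_hom_ext <;> simp

theorem exists_rep {n m : ℕ} (x : (FTerm S).Hom n m) : ∃ A : Cospan S n m, x = A.cls :=
  (Quotient.exists_rep x).imp fun _ h => h.symm

/-- The cospan `n ⟶ G ⟵ m` that corresponds to `0 ⟶ G ⟵ n + m`. -/
def Cospan.unbent {n m : ℕ} (A : Cospan S 0 (n + m)) : Cospan S n m :=
  ⟨A.apex, discInl S n m ≫ A.right, discInr S n m ≫ A.right⟩

/-- Bending loses nothing: an isomorphism of bent cospans respects both blocks of the right leg,
which are the two legs before bending. -/
theorem Phi_of_bend {n m : ℕ} {d : (synFrob S).Hom n m} {A : Cospan S 0 (n + m)}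
    (h : A.cls = (Phi S).map (bend d)) : (Phi S).map d = A.unbent.cls := by
  obtain ⟨D, hD⟩ := exists_rep ((Phi S).map d)
  obtain ⟨φ, _, hr⟩ := Quotient.exact (s := Cospan.setoid S 0 (n + m))
    ((Phi_bend hD).symm.trans h.symm)
  have hr' : discDesc D.left D.right ≫ φ.hom = A.right := hr
  rw [hD]
  refine Cospan.Equiv.cls_eq ⟨φ, ?_, ?_⟩
  · change D.left ≫ φ.hom = discInl S n m ≫ A.right
    rw [← hr']
    exact (discInl_discDesc_assoc D.left D.right φ.hom).symm
  · change D.right ≫ φ.hom = discInr S n m ≫ A.right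
    rw [← hr']
    exact (discInr_discDesc_assoc D.left D.right φ.hom).symm

/-- The pushout of `L` and a context `P`, obtained by gluing two cospans `A` and `B` along `k`, is
the composite `A ; (id_k ⊕ L) ; B`. -/
theorem isComp_of_context {n m i j k : ℕ} (A : Cospan S n (k + i)) (B : Cospan S (k + j) m)
    (L : Cospan S i j) (G : Cospan S n m) {P : Hyp S} {α : A.apex ⟶ P} {β : B.apex ⟶ P}
    {f : L.apex ⟶ G.apex} {g : P ⟶ G.apex}
    (hP : IsPushout (discInl S k i ≫ A.right) (discInl S k j ≫ B.left) α β)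
    (hG : IsPushout (discDesc L.left L.right)
      (discDesc (discInr S k i ≫ A.right ≫ α) (discInr S k j ≫ B.left ≫ β)) f g)
    (hl : A.left ≫ α ≫ g = G.left) (hr : B.right ≫ β ≫ g = G.right) :
    (A.comp ((Cospan.id S k).tensor L)).IsComp B G := by
  -- The first composite is replaced by an unspecified pushout `X`, so that only its universal
  -- property is used.
  obtain ⟨X, p, q, hX, h⟩ : ∃ (X : Hyp S) (p : A.apex ⟶ X) (q : (disc S k).sum L.apex ⟶ X),
      IsPushout A.right
        (discDesc (𝟙 (disc S k) ≫ inl (disc S k) L.apex) (L.left ≫ inr (disc S k) L.apex)) p q ∧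
      A.comp ((Cospan.id S k).tensor L) = ⟨X, A.left ≫ p,
        discDesc (𝟙 (disc S k) ≫ inl (disc S k) L.apex) (L.right ≫ inr (disc S k) L.apex) ≫ q⟩ :=
    ⟨_, _, _, isPushout_glue _ _, rfl⟩
  rw [h]
  simp only [Category.id_comp] at hX ⊢
  have hPw : discInl S k i ≫ A.right ≫ α = discInl S k j ≫ B.left ≫ β := by
    simpa using hP.w
  have hGl := congrArg (fun t => discInl S _ _ ≫ t) hG.w
  have hGr := congrArg (fun t => discInr S _ _ ≫ t) hG.w
  simp only [discInl_discDesc_assoc, discInr_discDesc_assoc, Category.assoc] at hGl hGr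
  have hXl := congrArg (fun t => discInl S _ _ ≫ t) hX.w
  have hXr := congrArg (fun t => discInr S _ _ ≫ t) hX.w
  simp only [discInl_discDesc_assoc, discInr_discDesc_assoc, Category.assoc] at hXl hXr
  -- The comparison map: `A` and the `k` passing strands reach `G` through the context `P`, and `L`
  -- reaches it through `f`.
  let x : X ⟶ G.apex := hX.desc (α ≫ g) (desc (discInl S k i ≫ A.right ≫ α ≫ g) f) (by
    apply disc_add_hom_ext
    · simp
    · simp [hGl])
  have hx₁ : p ≫ x = α ≫ g := hX.inl_desc _ _ _
  have hx₂ : q ≫ x = desc (discInl S k i ≫ A.right ≫ α ≫ g) f := hX.inr_desc _ _ _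
  refine ⟨x, β ≫ g, isPushout_of_desc ?_ ?_ ?_, ?_, hr⟩
  · apply disc_add_hom_ext
    · simp [hx₂, reassoc_of% hPw]
    · simp [hx₂, hGr]
  · intro K s t w
    have w₁ := congrArg (fun t => discInl S _ _ ≫ t) w
    have w₂ := congrArg (fun t => discInr S _ _ ≫ t) w
    simp only [discInl_discDesc_assoc, discInr_discDesc_assoc, Category.assoc] at w₁ w₂
    -- A cocone under `X` and `B` restricts to `A` and `B`, which agree on the `k` strands and so
    -- define a map on `P`. Together with its restriction to `L` this gives the map on `G`.
    let c : P ⟶ K := hP.desc (p ≫ s) t (by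
      rw [Category.assoc, Category.assoc, reassoc_of% hXl, w₁])
    have hc₁ : α ≫ c = p ≫ s := hP.inl_desc _ _ _
    have hc₂ : β ≫ c = t := hP.inr_desc _ _ _
    let u : G.apex ⟶ K := hG.desc (inr _ _ ≫ q ≫ s) c (by
      apply disc_add_hom_ext
      · simp [hc₁, reassoc_of% hXr]
      · simp [hc₂, w₂])
    have hu₁ : f ≫ u = inr _ _ ≫ q ≫ s := hG.inl_desc _ _ _
    have hu₂ : g ≫ u = c := hG.inr_desc _ _ _
    refine ⟨u, ?_, ?_⟩
    · refine hX.hom_ext ?_ ?_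
      · rw [reassoc_of% hx₁, hu₂, hc₁]
      · rw [reassoc_of% hx₂]
        apply sum_hom_ext
        · simp [hu₂, hc₁, reassoc_of% hXl]
        · simp [hu₁]
    · rw [Category.assoc, hu₂, hc₂]
  · intro K u u' h₁ h₂
    have k₁ := congrArg (fun t => p ≫ t) h₁
    have k₂ := congrArg (fun t => inr _ _ ≫ q ≫ t) h₁
    simp only [reassoc_of% hx₁, reassoc_of% hx₂, inr_desc_assoc, Category.assoc] at k₁ k₂ h₂
    exact hG.hom_ext k₂ (hP.hom_ext k₁ h₂)
  · rw [Category.assoc, hx₁, hl]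

theorem Phi_context {n m i j k : ℕ} {c₁ : (synFrob S).Hom n (k + i)}
    {c₂ : (synFrob S).Hom (k + j) m} {l : (synFrob S).Hom i j}
    {A : Cospan S n (k + i)} {B : Cospan S (k + j) m} {L : Cospan S i j} {G : Cospan S n m}
    (h₁ : (Phi S).map c₁ = A.cls) (h₂ : (Phi S).map c₂ = B.cls) (h : (Phi S).map l = L.cls)
    (hG : (A.comp ((Cospan.id S k).tensor L)).IsComp B G) :
    (Phi S).map ((synFrob S).comp ((synFrob S).comp c₁
      ((synFrob S).tensor ((synFrob S).id k) l)) c₂) = G.cls := by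
  rw [(Phi S).map_comp, (Phi S).map_comp, (Phi S).map_tensor, (Phi S).map_id, h₁, h₂, h]
  exact (Cospan.comp_equiv hG).cls_eq

/-- The pushout complement is the context itself: the cospans of `c₁` and `c₂` glued along the `k`
passing strands, with the hole as interface `i + j` and the outer boundary as interface `n + m`. -/
theorem dpoStep_of_step {R : (synFrob S).System} {n m : ℕ} {d e : (synFrob S).Hom n m}
    (h : (synFrob S).Step R d e) :
    DPOStep (dpoSystem ((Phi S).mapSystem (bendSystem R))) ((Phi S).map (bend d))
      ((Phi S).map (bend e)) := by
  obtain ⟨ρ, hρ, k, c₁, c₂, rfl, rfl⟩ := h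
  obtain ⟨A, hA⟩ := exists_rep ((Phi S).map c₁)
  obtain ⟨B, hB⟩ := exists_rep ((Phi S).map c₂)
  obtain ⟨L, hL⟩ := exists_rep ((Phi S).map ρ.lhs)
  obtain ⟨M, hM⟩ := exists_rep ((Phi S).map ρ.rhs)
  let α := glueInl (discInl S k ρ.i ≫ A.right) (discInl S k ρ.j ≫ B.left)
  let β := glueInr (discInl S k ρ.i ≫ A.right) (discInl S k ρ.j ≫ B.left)
  let γ := discDesc (discInr S k ρ.i ≫ A.right ≫ α) (discInr S k ρ.j ≫ B.left ≫ β)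
  -- The context is fixed before the arrow `x` in the hole, so this applies to both sides of the
  -- rule with the same `C`.
  have key : ∀ {x : (synFrob S).Hom ρ.i ρ.j} {L : Cospan S ρ.i ρ.j}, (Phi S).map x = L.cls →
      ∃ G : Cospan S 0 (n + m), G.cls = (Phi S).map (bend ((synFrob S).comp ((synFrob S).comp c₁
        ((synFrob S).tensor ((synFrob S).id k) x)) c₂)) ∧
      ∃ (f : L.apex ⟶ G.apex) (g : glue (discInl S k ρ.i ≫ A.right) (discInl S k ρ.j ≫ B.left) ⟶
        G.apex), IsPushout L.bent.right γ f g ∧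
          discDesc (A.left ≫ α) (B.right ≫ β) ≫ g = G.right := by
    intro x L hx
    have hG := isPushout_glue (discDesc L.left L.right) γ
    let G : Cospan S n m := ⟨glue (discDesc L.left L.right) γ,
      A.left ≫ α ≫ glueInr (discDesc L.left L.right) γ,
      B.right ≫ β ≫ glueInr (discDesc L.left L.right) γ⟩
    refine ⟨G.bent, (Phi_bend (Phi_context hA hB hx
      (isComp_of_context A B L G (isPushout_glue _ _) hG rfl rfl))).symm, _, _, hG, ?_⟩
    apply disc_add_hom_ext <;> simp [Cospan.bent, G]
  obtain ⟨G, hG, f, g, hp, hr⟩ := key hL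
  obtain ⟨H, hH, f', g', hp', hr'⟩ := key hM
  refine ⟨G, H, hG, hH, ⟨ρ.i + ρ.j, L.apex, M.apex, L.bent.right, M.bent.right⟩,
    ⟨_, ⟨ρ, hρ, rfl⟩,
      congrArg₂ (PROP.Rule.mk (X := FTerm S) 0 (ρ.i + ρ.j)) (Phi_bend hL) (Phi_bend hM)⟩,
    ⟨_, γ, discDesc (A.left ≫ α) (B.right ≫ β)⟩, f, f', g, g', hp, hp',
    hr, hr'⟩

/-- The given context `C` is cut into two cospans, these are lifted along the full `Φ`, and the
resulting equations are reflected by its faithfulness. -/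
theorem step_of_dpoStep {R : (synFrob S).System} {n m : ℕ} {d e : (synFrob S).Hom n m}
    (h : DPOStep (dpoSystem ((Phi S).mapSystem (bendSystem R))) ((Phi S).map (bend d))
      ((Phi S).map (bend e))) :
    (synFrob S).Step R d e := by
  obtain ⟨G, H, hG, hH, ⟨j, L, M, l, r⟩, ⟨_, ⟨ρ, hρ, rfl⟩, hρ'⟩, C, f, f', g, g', hp, hp', hr,
    hr'⟩ := h
  obtain ⟨-, hj, hL, hM⟩ := PROP.Rule.mk.inj hρ'
  dsimp only at hj
  subst hj
  -- The DPO system determines the two sides of a rule only up to isomorphism of cospans; unbending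
  -- shows that they represent the images of `ρ.lhs` and `ρ.rhs`.
  replace hL := Phi_of_bend (eq_of_heq hL).symm
  replace hM := Phi_of_bend (eq_of_heq hM).symm
  dsimp only at C f f' g g' hp hp' hr hr' hL hM
  -- The first half creates `i` fresh strands beside the `n` inputs. One end of each fresh strand
  -- enters the rule and the other is passed on, so `k = n + i`.
  let A : Cospan S n ((n + ρ.i) + ρ.i) :=
    ⟨disc S (n + ρ.i), discInl S n ρ.i, discDesc (𝟙 _) (discInr S n ρ.i)⟩
  -- The second half is all of `C`: the `n` passed inputs, the passed ends of the `i` fresh strands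
  -- and the `j` outputs of the rule are attached where the interfaces of `C` prescribe.
  let B : Cospan S ((n + ρ.i) + ρ.j) m :=
    ⟨C.apex, discDesc (discDesc (discInl S n m ≫ C.right) (discInl S ρ.i ρ.j ≫ C.left))
      (discInr S ρ.i ρ.j ≫ C.left), discInr S n m ≫ C.right⟩
  obtain ⟨c₁, hA⟩ := (Phi_isIso S _ _).2 A.cls
  obtain ⟨c₂, hB⟩ := (Phi_isIso S _ _).2 B.cls
  have key : ∀ {x : (synFrob S).Hom ρ.i ρ.j} {y : (synFrob S).Hom n m}
      {L : Cospan S 0 (ρ.i + ρ.j)} {G : Cospan S 0 (n + m)} {f : L.apex ⟶ G.apex}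
      {g : C.apex ⟶ G.apex}, (Phi S).map x = L.unbent.cls → G.cls = (Phi S).map (bend y) →
      IsPushout L.right C.left f g → C.right ≫ g = G.right →
      y = (synFrob S).comp ((synFrob S).comp c₁
        ((synFrob S).tensor ((synFrob S).id (n + ρ.i)) x)) c₂ := by
    intro x y L G f g hx hy hp hr
    apply (Phi_isIso S _ _).1
    refine (Phi_of_bend hy).trans (Phi_context hA hB hx (isComp_of_context A B L.unbent G.unbent
      (α := discDesc (discInl S n m ≫ C.right) (discInl S ρ.i ρ.j ≫ C.left)) (β := 𝟙 _)
      (f := f) (g := g) ?_ ?_ ?_ ?_)).symm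
    -- Gluing `A` and `B` along `k` returns `C`, because the leg `k ⟶ A` is an identity.
    · simp only [A, B, discInl_discDesc]
      exact IsPushout.of_id_fst
    · simpa [A, B, Cospan.unbent, discDesc_eta] using hp
    · simp [A, Cospan.unbent, hr]
    · simp [B, Cospan.unbent, hr]
  exact ⟨ρ, hρ, n + ρ.i, c₁, c₂, key hL hG hp hr, key hM hH hp' hr'⟩

end StringRewriting

theorem mainTheorem4 (S : StringRewriting.Signature.{u}) :
    (StringRewriting.Phi S).IsIso ∧
    ∀ (R : (StringRewriting.synFrob S).System) {n m : ℕ}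
      (d e : (StringRewriting.synFrob S).Hom n m),
      (StringRewriting.synFrob S).Step R d e ↔
        StringRewriting.DPOStep
          (StringRewriting.dpoSystem
            ((StringRewriting.Phi S).mapSystem (StringRewriting.bendSystem R)))
          ((StringRewriting.Phi S).map (StringRewriting.bend d))
          ((StringRewriting.Phi S).map (StringRewriting.bend e)) :=
  ⟨StringRewriting.Phi_isIso S, fun _ {_ _} _ _ =>
    ⟨StringRewriting.dpoStep_of_step, StringRewriting.step_of_dpoStep⟩⟩
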